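/- **Setting.** Let $\mathcal A$ be a von Neumann algebra with separable predual and $\psi$ a faithful normal state, represented on the (separable) GNS Hilbert space $\mathcal H$ with cyclic and separating unit vector $\Omega$, $\psi=\langle\Omega,\cdot\,\Omega\rangle$. A *subalgebra* of $(\mathcal A,\psi)$ is a von Neumann subalgebra onto which a $\psi$-preserving conditional expectation exists. Let $\mathcal A_0$ be a subalgebra with conditional expectation $E_0$. Let $S=(S_t)_{t\in\mathbb R}$ be a pointwise weak* continuous group of $\psi$-preserving automorphisms of $\mathcal A$, and let $(\mathcal A_I)_I$ be a monotone family of subalgebras containing $\mathcal A_0$, indexed by the intervals $I\subseteq\mathbb R$ (empty, degenerate and unbounded ones included), such that the $\mathcal A_I$ with $I$ bounded generate $\mathcal A$. Assume that $(\mathcal A,\psi,S,(\mathcal A_I))$ is an $\mathcal A_0$-expected continuous Bernoulli shift: $\mathcal A_0$ is the fixed point algebra of $S$; $S_t\mathcal A_I=\mathcal A_{I+t}$; and $E_0(xy)=E_0(x)E_0(y)$ for $x\in\mathcal A_I$, $y\in\mathcal A_J$ whenever $I\cap J=\emptyset$. Let $e_0$ be the orthogonal projection onto $\overline{\mathcal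 A_0\Omega}$. Let $\mathcal E$ and $\mathcal E_I$ be the closures of $\mathcal Ae_0$ and $\mathcal A_Ie_0$ in the strong operator (stop) topology. Put $\langle x,y\rangle=x^*y\in\mathcal A_0e_0\cong\mathcal A_0$, $|x|^2=\langle x,x\rangle$, $\|x\|_0=\|\langle x,x\rangle\|^{1/2}$, $E_0x=e_0x$; the unit of $\mathcal E$ is $\mathbf 1=e_0$. The shift $S_t$ extends to $\mathcal E$ by $S_t(ae_0)=S_t(a)e_0$. If $x\in\mathcal E_I$ and $y\in\mathcal E_J$, where $I$ and $J$ have disjoint interiors, the product is $xy=\lim_n x_ny$ (stop), for any sequence $x_n\in\mathcal A_I$ with $x_ne_0\to x$ (stop). A family $(x_t)_{t\ge0}$ in $\mathcal E$ is *adapted* if $x_t\in\mathcal E_{(-\infty,t]}$ and *locally adapted* if $x_t\in\mathcal E_{[0,t]}$ for all $t\geq 0$. A *centred additive cocycle* is a $\|\cdot\|_0$-continuous locally adapted family $c$ with $c_{t+s}=c_t+S_tc_s$ and $E_0c_t=0$ for all $s,t\ge0$. Its covariance is $\Lambda(a)=\langle c_1,a\,c_1\rangle$, $a\in\mathcal A_0$.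 Let $\mathcal V$ be the space of piecewise stop-continuous adapted families. For $x\in\mathcal V$ the Itô integral $\int_0^t dc_s\,x_s$ is the stop-limit of the sums $\sum_i(c_{s_{i+1}}-c_{s_i})x_{s_i}$ over partitions $0=s_0<\dots<s_n=t$ as the mesh tends to $0$. A *unital cocycle* is a weak* continuous locally adapted family $u$ with $|u_t|=\mathbf 1$ and $u_{t+s}=(S_tu_s)u_t$ for all $s,t\ge0$. **Theorem 8.1.** Let $c$ be a centred additive cocycle and $K\in\mathcal A_0$. Then there is a unique $u\in\mathcal V$ (as a family indexed by $t\ge0$) with $$u_t=\mathbf 1+\int_0^t dc_s\,u_s+\int_0^tKu_s\,ds\qquad(t\ge0).$$ It is locally adapted and $\|\cdot\|_0$-continuous, and $u_{s+t}=(S_tu_s)u_t$ for all $s,t\ge0$. Moreover: 1. $A_t:=E_0u_t$ defines a norm continuous semigroup in $\mathcal A_0$, and $A_t=e^{tK}$. 2. $R_t(a):=\langle u_t,a\,u_t\rangle$ defines a norm continuous semigroup of completely positive maps on $\mathcal A_0$, with generator $\mathcal L(a)=\Lambda(a)+K^*a+aK$. The following are equivalent: (a) $u$ is a unital cocycle;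 (b) $R_t(\mathbf 1)=\mathbf 1$ for all $t\ge0$; (b') $\mathcal L(\mathbf 1)=0$; (c) $|c_t|^2+(K+K^*)t=0$ for all $t\ge0$. If they hold, then every $R_t$ is a contraction. -/

import Mathlib

open Set Filter Topology
open scoped InnerProductSpace

noncomputable section

namespace NCShift

variable {H : Type*} [NormedAddCommGroup H] [InnerProductSpace ℂ H] [CompleteSpace H]

/-! ### Operators and von Neumann algebras in GNS representation -/

/-- The closure of a set of bounded operators in the strong operator (stop) topology, which is the
topology of pointwise convergence, induced from the product topology of `H → H`. -/
def stopClosure (X : Set (H →L[ℂ] H)) : Set (H →L[ℂ] H) :=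
  {x | (x : H → H) ∈ closure ((fun y : H →L[ℂ] H => (y : H → H)) '' X)}

/-- The linear map `a ↦ a Ω` from a von Neumann algebra to the Hilbert space on which it acts. -/
def orbitMap (M : VonNeumannAlgebra H) (Ω : H) : M.toStarSubalgebra →ₗ[ℂ] H where
  toFun a := (a : H →L[ℂ] H) Ω
  map_add' _ _ := rfl
  map_smul' _ _ := rfl

/-- `E` is the conditional expectation from `A` onto the von Neumann subalgebra `N` which leaves
the vector state `⟪Ω, · Ω⟫` invariant. -/
structure IsCondExp (A : VonNeumannAlgebra H) (Ω : H) (N : VonNeumannAlgebra H)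
    (E : A.toStarSubalgebra →ₗ[ℂ] A.toStarSubalgebra) : Prop where
  mem : ∀ x, (E x : H →L[ℂ] H) ∈ N
  fix : ∀ x : A.toStarSubalgebra, (x : H →L[ℂ] H) ∈ N → E x = x
  bimodule : ∀ a x b : A.toStarSubalgebra, (a : H →L[ℂ] H) ∈ N → (b : H →L[ℂ] H) ∈ N →
    E (a * x * b) = a * E x * b
  pos : ∀ x, (E (star x * x) : H →L[ℂ] H).IsPositive
  state : ∀ x, ⟪Ω, (E x : H →L[ℂ] H) Ω⟫_ℂ = ⟪Ω, (x : H →L[ℂ] H) Ω⟫_ℂ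

/-- An operator-valued expected (noncommutative) continuous Bernoulli shift `(A, ψ, S, (A_I)_I)`
over `A₀`. The von Neumann algebra `A` acts on its GNS Hilbert space `H` and the faithful normal
state is `ψ = ⟪Ω, · Ω⟫` with the cyclic and separating unit vector `Ω`. The intervals (possibly
empty, degenerate or unbounded) are the order-connected subsets of `ℝ`; the values of `alg` at other
sets play no role. -/
structure ContinuousBernoulliShift (H : Type*) [NormedAddCommGroup H] [InnerProductSpace ℂ H]
    [CompleteSpace H] where
  /-- the von Neumann algebra -/
  A : VonNeumannAlgebra H
  /-- the GNS vector of the state -/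
  Ω : H
  norm_Ω : ‖Ω‖ = 1
  cyclic : DenseRange (orbitMap A Ω)
  separating : Function.Injective (orbitMap A Ω)
  /-- the distinguished subalgebra -/
  A₀ : VonNeumannAlgebra H
  A₀_le : A₀ ≤ A
  /-- the conditional expectation onto the distinguished subalgebra -/
  E₀ : A.toStarSubalgebra →ₗ[ℂ] A.toStarSubalgebra
  condExp₀ : IsCondExp A Ω A₀ E₀
  /-- the shift, a one-parameter group of automorphisms -/
  S : ℝ → (A.toStarSubalgebra ≃⋆ₐ[ℂ] A.toStarSubalgebra)
  S_zero : ∀ x, S 0 x = x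
  S_add : ∀ s t x, S (s + t) x = S s (S t x)
  S_state : ∀ t x, ⟪Ω, (S t x : H →L[ℂ] H) Ω⟫_ℂ = ⟪Ω, (x : H →L[ℂ] H) Ω⟫_ℂ
  /-- Pointwise weak* continuity; on the norm bounded orbit of `x` the weak* topology is the
  weak operator topology. -/
  S_cont : ∀ (x : A.toStarSubalgebra) (ξ η : H),
    Continuous fun t => ⟪ξ, (S t x : H →L[ℂ] H) η⟫_ℂ
  /-- the filtration -/
  alg : Set ℝ → VonNeumannAlgebra H
  alg_le : ∀ I : Set ℝ, I.OrdConnected → alg I ≤ A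
  alg_condExp : ∀ I : Set ℝ, I.OrdConnected → ∃ E, IsCondExp A Ω (alg I) E
  alg_mono : ∀ I J : Set ℝ, I.OrdConnected → J.OrdConnected → I ⊆ J → alg I ≤ alg J
  /-- Minimality: `A` is generated by the algebras of the bounded intervals. -/
  minimal : Set.centralizer (Set.centralizer
      (⋃ I ∈ {I : Set ℝ | I.OrdConnected ∧ Bornology.IsBounded I}, (alg I : Set (H →L[ℂ] H)))) = A
  /-- The distinguished subalgebra is the fixed point algebra of the shift. -/
  fixed : ∀ x : A.toStarSubalgebra, (∀ t, S t x = x) ↔ (x : H →L[ℂ] H) ∈ A₀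
  /-- Covariance: the image of `alg I` under `S t` is `alg (I + t)`. -/
  covariant : ∀ (t : ℝ) (I : Set ℝ), I.OrdConnected → ∀ x : A.toStarSubalgebra,
    (x : H →L[ℂ] H) ∈ alg I ↔ (S t x : H →L[ℂ] H) ∈ alg ((fun r => r + t) '' I)
  A₀_le_alg : ∀ I : Set ℝ, I.OrdConnected → A₀ ≤ alg I
  /-- Independence over the distinguished subalgebra for disjoint intervals. -/
  indep : ∀ I J : Set ℝ, I.OrdConnected → J.OrdConnected → Disjoint I J →
    ∀ x y : A.toStarSubalgebra, (x : H →L[ℂ] H) ∈ alg I → (y : H →L[ℂ] H) ∈ alg J →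
      E₀ (x * y) = E₀ x * E₀ y

namespace ContinuousBernoulliShift

variable (B : ContinuousBernoulliShift H)

/-! ### The GNS Bernoulli shift

Elements of the Hilbert bimodule are bounded operators `x` on `H` with `x = x e₀`; the inner product
is `⟨x, y⟩₀ = x⋆ y`, an element of `A₀ e₀`, which is identified with `A₀` through `a ↦ a e₀`. The
module norm `‖⟨x, x⟩₀‖ ^ (1 / 2)` is thus the operator norm of `x`, the bimodule operations are
operator products, the unit element is `e₀`, and the conditional expectation onto `A₀` is
`x ↦ e₀ x = ⟨1, x⟩₀`. -/

/-- The orthogonal projection of `H` onto the closure of `A₀ Ω`. -/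
def e₀ : H →L[ℂ] H :=
  (LinearMap.range (orbitMap B.A₀ B.Ω)).topologicalClosure.starProjection

/-- The Hilbert bimodule of a subalgebra `N`: the stop closure of `N e₀`. -/
def bimod (N : VonNeumannAlgebra H) : Set (H →L[ℂ] H) :=
  stopClosure ((fun a : H →L[ℂ] H => a * B.e₀) '' (N : Set (H →L[ℂ] H)))

/-- The inner product of the Hilbert bimodule. -/
def ip (x y : H →L[ℂ] H) : H →L[ℂ] H := star x * y

/-- The unitary extension of `S t` to the GNS Hilbert space, `a Ω ↦ (S t a) Ω`. The extension of
`S t` to the Hilbert bimodule is `x ↦ B.U t * x`, as it sends `a e₀` to `(S t a) e₀`. -/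
def U (t : ℝ) : H →L[ℂ] H :=
  (orbitMap B.A B.Ω ∘ₗ
    ((B.S t).toStarAlgHom.toAlgHom.toLinearMap)).extendOfNorm (orbitMap B.A B.Ω)

theorem norm_orbit_S (t : ℝ) (a : B.A.toStarSubalgebra) :
    ‖(B.S t a : H →L[ℂ] H) B.Ω‖ = ‖(a : H →L[ℂ] H) B.Ω‖ := by
  have key : ∀ b : B.A.toStarSubalgebra,
      ⟪(b : H →L[ℂ] H) B.Ω, (b : H →L[ℂ] H) B.Ω⟫_ℂ
        = ⟪B.Ω, ((star b * b : B.A.toStarSubalgebra) : H →L[ℂ] H) B.Ω⟫_ℂ := by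
    intro b
    have : ((star b * b : B.A.toStarSubalgebra) : H →L[ℂ] H)
        = ContinuousLinearMap.adjoint (b : H →L[ℂ] H) * (b : H →L[ℂ] H) := rfl
    rw [this]
    exact (ContinuousLinearMap.adjoint_inner_right _ _ _).symm
  have h : ⟪(B.S t a : H →L[ℂ] H) B.Ω, (B.S t a : H →L[ℂ] H) B.Ω⟫_ℂ
      = ⟪(a : H →L[ℂ] H) B.Ω, (a : H →L[ℂ] H) B.Ω⟫_ℂ := by
    rw [key, key, ← map_star, ← map_mul, B.S_state]
  rw [inner_self_eq_norm_sq_to_K, inner_self_eq_norm_sq_to_K] at h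
  have h2 : ‖(B.S t a : H →L[ℂ] H) B.Ω‖ ^ 2 = ‖(a : H →L[ℂ] H) B.Ω‖ ^ 2 := by exact_mod_cast h
  exact (sq_eq_sq₀ (norm_nonneg _) (norm_nonneg _)).1 h2

theorem U_apply (t : ℝ) (a : B.A.toStarSubalgebra) :
    B.U t ((a : H →L[ℂ] H) B.Ω) = (B.S t a : H →L[ℂ] H) B.Ω :=
  LinearMap.extendOfNorm_eq B.cyclic
    ⟨1, fun b => by rw [one_mul]; exact (B.norm_orbit_S t b).le⟩ a

/-- `z` is the product `x y` of `x` in the bimodule of `N` with `y`: the strong limit of `b n * y`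
for a sequence `b` in `N` such that `b n * e₀` tends to `x` strongly. -/
def IsProd (N : VonNeumannAlgebra H) (x y z : H →L[ℂ] H) : Prop :=
  ∃ b : ℕ → (H →L[ℂ] H), (∀ n, b n ∈ N) ∧
    (∀ ξ : H, Tendsto (fun n => (b n * B.e₀) ξ) atTop (𝓝 (x ξ))) ∧
    (∀ ξ : H, Tendsto (fun n => (b n * y) ξ) atTop (𝓝 (z ξ)))

open Classical in
/-- The product `x y` for `x` in the bimodule of `N` and `y` in the bimodule of an algebra which is
independent of `N` (the limit exists and does not depend on the approximation in this case). -/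
def indepMul (N : VonNeumannAlgebra H) (x y : H →L[ℂ] H) : H →L[ℂ] H :=
  if h : ∃ z, B.IsProd N x y z then h.choose else 0

/-! ### Adapted families and cocycles, indexed by times `t ≥ 0` -/

/-- Adaptedness to the past filtration. -/
def IsAdapted (x : ℝ → (H →L[ℂ] H)) : Prop := ∀ t, 0 ≤ t → x t ∈ B.bimod (B.alg (Iic t))

/-- Local adaptedness. -/
def IsLocallyAdapted (x : ℝ → (H →L[ℂ] H)) : Prop := ∀ t, 0 ≤ t → x t ∈ B.bimod (B.alg (Icc 0 t))

/-- A centred additive cocycle of the GNS Bernoulli shift. -/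
structure IsCentredAdditiveCocycle (c : ℝ → (H →L[ℂ] H)) : Prop where
  cont : ContinuousOn c (Ici 0)
  adapted : B.IsLocallyAdapted c
  cocycle : ∀ s t, 0 ≤ s → 0 ≤ t → c (t + s) = c t + B.U t * c s
  centred : ∀ t, 0 ≤ t → B.e₀ * c t = 0

/-- The multiplicative cocycle identity `u_{t+s} = (S_t u_s) u_t`. -/
def CocycleIdentity (u : ℝ → (H →L[ℂ] H)) : Prop :=
  ∀ s t, 0 ≤ s → 0 ≤ t → u (t + s) = B.indepMul (B.alg (Icc t (t + s))) (B.U t * u s) (u t)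

/-- A unital cocycle of the GNS Bernoulli shift. The condition `unital` says `|u_t|₀ = 1`, and as
it makes `u` norm bounded, weak* continuity is continuity in the weak operator topology. -/
structure IsUnitalCocycle (u : ℝ → (H →L[ℂ] H)) : Prop where
  cont : ∀ ξ η : H, ContinuousOn (fun t => ⟪ξ, u t η⟫_ℂ) (Ici 0)
  unital : ∀ t, 0 ≤ t → ip (u t) (u t) = B.e₀
  adapted : B.IsLocallyAdapted u
  cocycle : B.CocycleIdentity u

/-! ### Itô integration -/

/-- Piecewise stop-continuity on `[0, ∞)`: in every `[0, T]` there are at most finitely many points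
of discontinuity, and the one-sided strong limits exist everywhere. -/
def PiecewiseStopContinuous (x : ℝ → (H →L[ℂ] H)) : Prop :=
  (∀ T : ℝ, ∃ D : Set ℝ, D.Finite ∧ ∀ t ∈ Icc 0 T \ D, ∀ ξ : H,
      ContinuousWithinAt (fun s => x s ξ) (Ici 0) t) ∧
  (∀ t, 0 ≤ t → ∀ ξ : H, ∃ l : H, Tendsto (fun s => x s ξ) (𝓝[>] t) (𝓝 l)) ∧
  (∀ t, 0 < t → ∀ ξ : H, ∃ l : H, Tendsto (fun s => x s ξ) (𝓝[<] t) (𝓝 l))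

/-- The space of integrands: piecewise stop-continuous adapted families. -/
def Integrand (x : ℝ → (H →L[ℂ] H)) : Prop := B.IsAdapted x ∧ PiecewiseStopContinuous x

/-- The points `τ 0 < τ 1 < ⋯ < τ n` form a partition of `[0, t]` of mesh less than `δ`. -/
def IsPartition (t : ℝ) (n : ℕ) (τ : ℕ → ℝ) (δ : ℝ) : Prop :=
  τ 0 = 0 ∧ τ n = t ∧ ∀ i < n, τ i < τ (i + 1) ∧ τ (i + 1) - τ i < δ

/-- The left Itô integral of the simple adapted family `∑ x_{τ i} 1_{[τ i, τ (i+1))}`, that is,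
`∑ (c_{τ (i+1)} - c_{τ i}) x_{τ i}`. -/
def itoSum (c x : ℝ → (H →L[ℂ] H)) (n : ℕ) (τ : ℕ → ℝ) : H →L[ℂ] H :=
  ∑ i ∈ Finset.range n,
    B.indepMul (B.alg (Icc (τ i) (τ (i + 1)))) (c (τ (i + 1)) - c (τ i)) (x (τ i))

/-- `I` is the Itô integral `∫₀ᵗ dc_s x_s`: the limit in the stop topology of the integrals of the
simple adapted families attached to partitions whose mesh tends to zero. -/
def HasItoIntegral (c x : ℝ → (H →L[ℂ] H)) (t : ℝ) (I : H →L[ℂ] H) : Prop :=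
  ∀ ξ : H, ∀ ε > 0, ∃ δ > 0, ∀ (n : ℕ) (τ : ℕ → ℝ), IsPartition t n τ δ →
    ‖B.itoSum c x n τ ξ - I ξ‖ < ε

/-- `u` solves `u_t = 1 + ∫₀ᵗ dc_s u_s + ∫₀ᵗ K u_s ds`, the last integral being taken in the stop
topology. -/
def IsSolution (c : ℝ → (H →L[ℂ] H)) (K : H →L[ℂ] H) (u : ℝ → (H →L[ℂ] H)) : Prop :=
  B.Integrand u ∧ ∀ t, 0 ≤ t → ∃ I : H →L[ℂ] H, B.HasItoIntegral c u t I ∧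
    ∀ ξ : H, u t ξ = B.e₀ ξ + I ξ + ∫ s in (0 : ℝ)..t, K (u s ξ)

end ContinuousBernoulliShift

/-! ### Semigroups and complete positivity -/

/-- `T` is a norm continuous one-parameter semigroup, indexed by `t ≥ 0`. -/
def IsContSemigroup {M : Type*} [Monoid M] [TopologicalSpace M] (T : ℝ → M) : Prop :=
  T 0 = 1 ∧ (∀ s t, 0 ≤ s → 0 ≤ t → T (s + t) = T s * T t) ∧ ContinuousOn T (Ici 0)

/-- Positivity of an `n × n` matrix of operators, as an operator on `Hⁿ`. -/
def MatrixPos {n : ℕ} (M : Fin n → Fin n → (H →L[ℂ] H)) : Prop :=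
  ∀ ξ : Fin n → H, ∃ r : ℝ, 0 ≤ r ∧ ∑ i, ∑ j, ⟪ξ i, M i j (ξ j)⟫_ℂ = (r : ℂ)

/-- Complete positivity of a linear map on a von Neumann algebra. -/
def IsCompletelyPositive {N : VonNeumannAlgebra H}
    (Φ : N.toStarSubalgebra →L[ℂ] N.toStarSubalgebra) : Prop :=
  ∀ (n : ℕ) (M : Fin n → Fin n → N.toStarSubalgebra),
    MatrixPos (fun i j => (M i j : H →L[ℂ] H)) →
      MatrixPos (fun i j => (Φ (M i j) : H →L[ℂ] H))

end NCShift

end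

/-!
The Hilbert bimodule of the shift consists of the operators `x = x e₀` on the GNS space, and its
inner product `x⋆ y` takes values in the reduced algebra `A₀ e₀`. As `Ω` is cyclic for the commutant
of `A₀`, the map `a ↦ a e₀` is isometric and multiplicative on `A₀`, and an operator `e₀ z e₀` that
commutes with the reduced commutant lifts to `A₀` (`IsReduced.exists_lift`). Positivity of matrices
over `A₀` can be tested on `e₀ H` (`matrixPos_of_reduced`), which makes `a ↦ ⟨x, a x⟩` completely
positive.

Independence over `A₀` says that `N` acts on the closure of `M Ω`, up to compression, through the
conditional expectation `E₀`. It passes from disjoint intervals to adjacent ones because the shift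
is weakly continuous (`isIndep_adjacent`). A Kaplansky density argument (`exists_bounded_near`)
provides bounded sequences in `N` approximating a given `x` in the bimodule of `N`, and independence
turns their convergence on `e₀ H` into convergence on `M Ω`. So left multiplication by `x` is a
well-defined operator there, with `⟪x ξ, x' η⟫ = ⟪ξ, ⟨x, x'⟩ η⟫` (`IsIndepPair.inner_leftMul`).

Applied to the increments of an additive cocycle `c`, this yields operators `D s t` on the closure
of the past `A_{(-∞, s]} Ω` which are orthogonal to the past and have covariance `(t - s) Q`, where
`Q` is the lift of `⟨c 1, c 1⟩`. These properties (`OrthogonalNoise`) are all that Itô integration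
needs: Itô sums of a process `y` have squared norm at most `‖Q‖ ∑ (t - s) ‖y s‖²`, hence the
integral equation is a contraction by the factor `1 / 2` in an exponentially weighted supremum norm.
That gives the solution by Picard iteration (`exists_sde_solution`), and its uniqueness among
piecewise strongly continuous adapted families (`solution_unique`), where the integrals exist in the
strong sense only. The estimate is applied to the orbits of a vector.

Both sides of `u_{s+t} = (S_t u_s) u_t` solve, as functions of `s`, the equation driven by the
shifted noise with initial value `u_t`, so they agree (`cocycleIdentity`). As `e₀` annihilates the
noise, `e₀ u_t` solves `y' = K y`, which identifies it with `e^{tK} e₀`; and the cocycle identity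
together with the inner product formula for products makes the compressions `R_t` a semigroup. Its
generator is read off from `u_t = e₀ + c_t + O(t)`: the cross terms of `e₀` and `c_t` vanish, the
square of `c_t` contributes `t Λ`, and the remaining first order terms are those of `e^{tK}`. A norm
continuous semigroup fixes the unit if and only if its generator annihilates it, and `|c_t|²` is
linear in `t`; this is the equivalence of the conditions for unitality.
-/

noncomputable section

namespace NCShift

section Noise

/-! ### Partitions of an interval -/

/-- The first `p.1 + 1` values of the sequence `p.2` form a strictly increasing partition of
`[a, b]` of mesh less than `δ`. -/
structure IsSubdivision (a b δ : ℝ) (p : ℕ × (ℕ → ℝ)) : Prop where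
  left : p.2 0 = a
  right : p.2 p.1 = b
  lt : ∀ i < p.1, p.2 i < p.2 (i + 1)
  sub_lt : ∀ i < p.1, p.2 (i + 1) - p.2 i < δ

/-- The filter of partitions of `[a, b]` whose mesh tends to zero. -/
def mesh (a b : ℝ) : Filter (ℕ × (ℕ → ℝ)) :=
  ⨅ δ ∈ Ioi (0 : ℝ), 𝓟 {p | IsSubdivision a b δ p}

/-- The sum of the values of a function of intervals over the intervals of a partition. -/
def intervalSum {E : Type*} [AddCommMonoid E] (G : ℝ → ℝ → E) (p : ℕ × (ℕ → ℝ)) : E :=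
  ∑ i ∈ Finset.range p.1, G (p.2 i) (p.2 (i + 1))

theorem IsSubdivision.mono {a b δ δ' : ℝ} {p : ℕ × (ℕ → ℝ)} (h : IsSubdivision a b δ p)
    (hδ : δ ≤ δ') : IsSubdivision a b δ' p :=
  ⟨h.left, h.right, h.lt, fun i hi => (h.sub_lt i hi).trans_le hδ⟩

theorem hasBasis_mesh (a b : ℝ) :
    (mesh a b).HasBasis (fun δ : ℝ => 0 < δ) fun δ => {p | IsSubdivision a b δ p} := by
  refine hasBasis_biInf_principal ?_ ⟨1, mem_Ioi.2 one_pos⟩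
  intro x hx y hy
  exact ⟨min x y, lt_min (mem_Ioi.1 hx) (mem_Ioi.1 hy),
    fun p hp => IsSubdivision.mono hp (min_le_left _ _),
    fun p hp => IsSubdivision.mono hp (min_le_right _ _)⟩

theorem eventually_mesh {a b δ : ℝ} (hδ : 0 < δ) : ∀ᶠ p in mesh a b, IsSubdivision a b δ p :=
  (hasBasis_mesh a b).mem_of_mem hδ

theorem mesh_neBot {a b : ℝ} (hab : a ≤ b) : (mesh a b).NeBot := by
  refine (hasBasis_mesh a b).neBot_iff.2 fun {δ} hδ => ?_
  rcases hab.eq_or_lt with rfl | hlt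
  · exact ⟨(0, fun _ => a), rfl, rfl, fun i hi => absurd hi (Nat.not_lt_zero i),
      fun i hi => absurd hi (Nat.not_lt_zero i)⟩
  · obtain ⟨n, hn⟩ := exists_nat_gt ((b - a) / δ)
    have hn0 : (0 : ℝ) < n := lt_of_le_of_lt (by have := sub_pos.2 hlt; positivity) hn
    have key : ∀ i : ℕ, (a + (b - a) * ((i + 1 : ℕ) : ℝ) / n) - (a + (b - a) * (i : ℝ) / n)
        = (b - a) / n := by
      intro i; push_cast; field_simp; ring
    refine ⟨(n, fun i => a + (b - a) * i / n), by simp, ?_, fun i _ => ?_, fun i _ => ?_⟩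
    · simp only
      field_simp
      ring
    · have := key i
      have h2 : 0 < (b - a) / n := div_pos (sub_pos.2 hlt) hn0
      simp only
      linarith
    · simp only
      rw [key i, div_lt_iff₀ hn0]
      rw [div_lt_iff₀ hδ] at hn
      linarith

namespace IsSubdivision

variable {a b δ : ℝ} {p : ℕ × (ℕ → ℝ)}

theorem mono_points (h : IsSubdivision a b δ p) {i j : ℕ} (hij : i ≤ j) (hj : j ≤ p.1) :
    p.2 i ≤ p.2 j := by
  induction j, hij using Nat.le_induction with
  | base => exact le_rfl
  | succ j _ ih => exact (ih (by omega)).trans (h.lt j (by omega)).le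

theorem mem_Icc (h : IsSubdivision a b δ p) {i : ℕ} (hi : i ≤ p.1) : p.2 i ∈ Icc a b :=
  ⟨h.left ▸ h.mono_points (Nat.zero_le i) hi, h.right ▸ h.mono_points hi le_rfl⟩

theorem sum_sub (h : IsSubdivision a b δ p) (g : ℝ → ℝ) :
    intervalSum (fun s t => g t - g s) p = g b - g a := by
  rw [intervalSum, Finset.sum_range_sub (fun i => g (p.2 i)), h.left, h.right]

theorem norm_intervalSum_le {E : Type*} [SeminormedAddCommGroup E] (h : IsSubdivision a b δ p)
    {G : ℝ → ℝ → E} {g : ℝ → ℝ}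
    (hG : ∀ s t, a ≤ s → s < t → t ≤ b → t - s < δ → ‖G s t‖ ≤ g t - g s) :
    ‖intervalSum G p‖ ≤ g b - g a := by
  rw [← h.sum_sub g]
  refine (norm_sum_le _ _).trans (Finset.sum_le_sum fun i hi => ?_)
  have hi := Finset.mem_range.1 hi
  exact hG _ _ (h.mem_Icc hi.le).1 (h.lt i hi) (h.mem_Icc hi).2 (h.sub_lt i hi)

end IsSubdivision

theorem tendsto_mesh_shift (a b t : ℝ) :
    Tendsto (fun p : ℕ × (ℕ → ℝ) => (p.1, fun i => p.2 i + t)) (mesh a b)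
      (mesh (a + t) (b + t)) := by
  refine ((hasBasis_mesh a b).tendsto_iff (hasBasis_mesh _ _)).2 fun δ hδ => ⟨δ, hδ, fun p hp => ?_⟩
  exact ⟨by simp [hp.left], by simp [hp.right], fun i hi => by simpa using hp.lt i hi,
    fun i hi => by simpa using hp.sub_lt i hi⟩

/-- The concatenation of a partition of `[a, b]` with a partition of `[b, c]`. -/
def concat (p q : ℕ × (ℕ → ℝ)) : ℕ × (ℕ → ℝ) :=
  (p.1 + q.1, fun i => if i ≤ p.1 then p.2 i else q.2 (i - p.1))

theorem concat_right {p q : ℕ × (ℕ → ℝ)} (h : p.2 p.1 = q.2 0) (i : ℕ) :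
    (concat p q).2 (p.1 + i) = q.2 i := by
  rcases Nat.eq_zero_or_pos i with rfl | hi
  · simp [concat, h]
  · simp [concat, hi.ne']

theorem intervalSum_concat {E : Type*} [AddCommMonoid E] (G : ℝ → ℝ → E) {p q : ℕ × (ℕ → ℝ)}
    (h : p.2 p.1 = q.2 0) :
    intervalSum G (concat p q) = intervalSum G p + intervalSum G q := by
  rw [intervalSum, intervalSum, intervalSum]
  change ∑ i ∈ Finset.range (p.1 + q.1), _ = _
  rw [Finset.sum_range_add]
  congr 1
  · refine Finset.sum_congr rfl fun i hi => ?_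
    have hi := Finset.mem_range.1 hi
    simp [concat, hi.le, Nat.succ_le_of_lt hi]
  · refine Finset.sum_congr rfl fun i _ => ?_
    rw [add_assoc, concat_right h, concat_right h]

theorem tendsto_mesh_concat (a b c : ℝ) :
    Tendsto (fun r : (ℕ × (ℕ → ℝ)) × (ℕ × (ℕ → ℝ)) => concat r.1 r.2) (mesh a b ×ˢ mesh b c)
      (mesh a c) := by
  refine (((hasBasis_mesh a b).prod (hasBasis_mesh b c)).tendsto_iff (hasBasis_mesh a c)).2
    fun δ hδ => ⟨(δ, δ), ⟨hδ, hδ⟩, ?_⟩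
  rintro ⟨p, q⟩ ⟨hp, hq⟩
  have h : p.2 p.1 = q.2 0 := by rw [hp.right, hq.left]
  have key : ∀ i < (concat p q).1, 0 < (concat p q).2 (i + 1) - (concat p q).2 i ∧
      (concat p q).2 (i + 1) - (concat p q).2 i < δ := by
    intro i hi
    rcases lt_or_ge i p.1 with h1 | h1
    · have e1 : (concat p q).2 i = p.2 i := if_pos h1.le
      have e2 : (concat p q).2 (i + 1) = p.2 (i + 1) := if_pos h1
      rw [e1, e2]
      exact ⟨sub_pos.2 (hp.lt i h1), hp.sub_lt i h1⟩
    · obtain ⟨j, rfl⟩ := Nat.exists_eq_add_of_le h1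
      have hj : j < q.1 := by
        have : p.1 + j < p.1 + q.1 := hi
        omega
      rw [add_assoc, concat_right h, concat_right h]
      exact ⟨sub_pos.2 (hq.lt j hj), hq.sub_lt j hj⟩
  refine ⟨?_, ?_, fun i hi => sub_pos.1 (key i hi).1, fun i hi => (key i hi).2⟩
  · have e0 : (concat p q).2 0 = p.2 0 := by simp [concat]
    exact e0.trans hp.left
  · exact (concat_right h q.1).trans hq.right

/-- Sums over partitions of `[a, b]` and `[b, c]` add up in the limit. -/
theorem tendsto_intervalSum_add {E : Type*} [AddCommMonoid E] [TopologicalSpace E]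
    [ContinuousAdd E] [T2Space E] {G : ℝ → ℝ → E} {a b c : ℝ} (hab : a ≤ b) (hbc : b ≤ c)
    {x y z : E} (hx : Tendsto (intervalSum G) (mesh a b) (𝓝 x))
    (hy : Tendsto (intervalSum G) (mesh b c) (𝓝 y))
    (hz : Tendsto (intervalSum G) (mesh a c) (𝓝 z)) : z = x + y := by
  have := mesh_neBot hab
  have := mesh_neBot hbc
  refine tendsto_nhds_unique (hz.comp (tendsto_mesh_concat a b c)) ?_
  refine ((hx.comp tendsto_fst).add (hy.comp tendsto_snd)).congr' ?_
  filter_upwards [(eventually_mesh one_pos).prod_mk (eventually_mesh one_pos)] with r hr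
  exact (intervalSum_concat G (by rw [hr.1.right, hr.2.left])).symm

/-- Riemann sums of a continuous function converge to its integral. -/
theorem tendsto_riemannSum {E : Type*} [NormedAddCommGroup E] [NormedSpace ℝ E] [CompleteSpace E]
    {f : ℝ → E} {a b : ℝ} (hab : a ≤ b) (hf : ContinuousOn f (Icc a b)) :
    Tendsto (intervalSum fun s t => (t - s) • f s) (mesh a b) (𝓝 (∫ s in a..b, f s)) := by
  have huc := isCompact_Icc.uniformContinuousOn_of_continuous hf
  rw [Metric.uniformContinuousOn_iff] at huc
  rw [Metric.tendsto_nhds]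
  intro ε hε
  obtain ⟨δ, hδ, H⟩ := huc (ε / (b - a + 1)) (by have := sub_nonneg.2 hab; positivity)
  filter_upwards [eventually_mesh hδ] with p hp
  have hint : ∀ s t, a ≤ s → s ≤ t → t ≤ b → IntervalIntegrable f MeasureTheory.volume s t :=
    fun s t h1 h2 h3 =>
      (hf.mono (by rw [uIcc_of_le h2]; exact Icc_subset_Icc h1 h3)).intervalIntegrable
  have hsum : intervalSum (fun s t => ∫ r in s..t, f r) p = ∫ s in a..b, f s := by
    rw [intervalSum, intervalIntegral.sum_integral_adjacent_intervals, hp.left, hp.right]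
    intro k hk
    exact hint _ _ (hp.mem_Icc hk.le).1 (hp.lt k hk).le (hp.mem_Icc hk).2
  rw [dist_eq_norm, ← hsum]
  have : intervalSum (fun s t => (t - s) • f s) p - intervalSum (fun s t => ∫ r in s..t, f r) p
      = intervalSum (fun s t => (t - s) • f s - ∫ r in s..t, f r) p := by
    simp [intervalSum, Finset.sum_sub_distrib]
  rw [this]
  have hle := hp.norm_intervalSum_le (G := fun s t => (t - s) • f s - ∫ r in s..t, f r)
    (g := fun s => ε / (b - a + 1) * s) ?_
  · refine hle.trans_lt ?_
    have := sub_nonneg.2 hab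
    rw [← mul_sub, div_mul_eq_mul_div, div_lt_iff₀ (by positivity)]
    nlinarith
  · intro s t h1 h2 h3 h4
    have e : (t - s) • f s - ∫ r in s..t, f r = ∫ r in s..t, (f s - f r) := by
      rw [intervalIntegral.integral_sub (by simp) (hint s t h1 h2.le h3)]
      simp
    rw [e]
    refine (intervalIntegral.norm_integral_le_of_norm_le_const (C := ε / (b - a + 1)) ?_).trans_eq ?_
    · intro r hr
      rw [uIoc_of_le h2.le] at hr
      rw [← dist_eq_norm]
      refine (H s ⟨h1, h2.le.trans h3⟩ r ⟨h1.trans hr.1.le, hr.2.trans h3⟩ ?_).le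
      rw [Real.dist_eq, abs_sub_comm, abs_of_pos (sub_pos.2 hr.1)]
      linarith [hr.2]
    · rw [abs_of_pos (sub_pos.2 h2)]; ring

/-! ### Orthogonal noise -/

variable {H : Type*} [NormedAddCommGroup H] [InnerProductSpace ℂ H]

/-- A noise `D` with orthogonal increments with respect to a filtration `F` of subspaces. The
increment `D s t` is a bounded operator whose values matter on `F s` only; there it has the
covariance `(t - s) Q`. -/
structure OrthogonalNoise (F : ℝ → Submodule ℂ H) (D : ℝ → ℝ → (H →L[ℂ] H)) (Q : H →L[ℂ] H) :
    Prop where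
  mono : Monotone F
  mem : ∀ s t, 0 ≤ s → s ≤ t → ∀ y ∈ F s, D s t y ∈ F t
  orth : ∀ s t, 0 ≤ s → s ≤ t → ∀ y ∈ F s, ∀ z ∈ F s, ⟪z, D s t y⟫_ℂ = 0
  add : ∀ r s t, 0 ≤ r → r ≤ s → s ≤ t → ∀ y ∈ F r, D r t y = D r s y + D s t y
  cov : ∀ s t, 0 ≤ s → s ≤ t → ∀ y ∈ F s, ∀ z ∈ F s,
    ⟪D s t y, D s t z⟫_ℂ = ((t - s : ℝ) : ℂ) * ⟪y, Q z⟫_ℂ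

/-- The length of the intersection of `[s, t]` and `[s', t']`. -/
def overlap (s t s' t' : ℝ) : ℝ := max 0 (min t t' - max s s')

theorem overlap_comm (s t s' t' : ℝ) : overlap s t s' t' = overlap s' t' s t := by
  rw [overlap, overlap, min_comm, max_comm s]

theorem overlap_nonneg (s t s' t' : ℝ) : 0 ≤ overlap s t s' t' := le_max_left _ _

theorem overlap_eq_sub {s t s' t' : ℝ} (h : s ≤ t) (h' : s' ≤ t') :
    overlap s t s' t' = max s (min t t') - max s (min t s') := by
  rw [overlap]
  rcases le_total t t' with h1 | h1 <;> rcases le_total t s' with h2 | h2 <;>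
    rcases le_total s s' with h3 | h3 <;> rcases le_total s t' with h4 | h4 <;>
    simp only [min_def, max_def] <;> split_ifs <;> linarith

theorem abs_sub_lt_of_overlap {s t s' t' δ : ℝ} (h1 : t - s < δ) (h2 : t' - s' < δ)
    (h : overlap s t s' t' ≠ 0) : |s - s'| < δ := by
  have h3 : 0 < overlap s t s' t' := (overlap_nonneg _ _ _ _).lt_of_ne' h
  rw [overlap, lt_max_iff] at h3
  simp only [lt_irrefl, false_or, sub_pos, max_lt_iff, lt_min_iff] at h3
  rw [abs_lt]; constructor <;> linarith [h3.1.1, h3.1.2, h3.2.1, h3.2.2]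

theorem IsSubdivision.sum_overlap {a b δ s t : ℝ} {p : ℕ × (ℕ → ℝ)} (hp : IsSubdivision a b δ p)
    (ha : a ≤ s) (hst : s ≤ t) (hb : t ≤ b) : intervalSum (overlap s t) p = t - s := by
  have : intervalSum (overlap s t) p
      = intervalSum (fun s' t' => max s (min t t') - max s (min t s')) p :=
    Finset.sum_congr rfl fun i hi =>
      overlap_eq_sub hst (hp.lt i (Finset.mem_range.1 hi)).le
  rw [this, hp.sum_sub fun r => max s (min t r), min_eq_left hb, max_eq_right hst,
    min_eq_right (ha.trans hst), max_eq_left ha]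

namespace OrthogonalNoise

variable {F : ℝ → Submodule ℂ H} {D : ℝ → ℝ → (H →L[ℂ] H)} {Q : H →L[ℂ] H}

theorem inner_of_le (hD : OrthogonalNoise F D Q) {s t s' t' : ℝ} (hs : 0 ≤ s) (hst : s ≤ t)
    (hst' : s' ≤ t') (h : s ≤ s') {y z : H} (hy : y ∈ F s) (hz : z ∈ F s') :
    ⟪D s t y, D s' t' z⟫_ℂ = (overlap s t s' t' : ℂ) * ⟪y, Q z⟫_ℂ ∧
    ⟪D s' t' z, D s t y⟫_ℂ = (overlap s t s' t' : ℂ) * ⟪z, Q y⟫_ℂ := by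
  have hs' := hs.trans h
  have hy' : y ∈ F s' := hD.mono h hy
  have orth' : ∀ r u, 0 ≤ r → r ≤ u → ∀ v ∈ F r, ∀ w ∈ F r, ⟪D r u v, w⟫_ℂ = 0 := by
    intro r u hr hu v hv w hw
    rw [← inner_conj_symm, hD.orth r u hr hu v hv w hw, map_zero]
  rcases le_total t s' with h1 | h1
  · have hm := hD.mono h1 (hD.mem s t hs hst y hy)
    have ho : overlap s t s' t' = 0 := by
      rw [overlap]
      exact max_eq_left (by linarith [min_le_left t t', le_max_right s s'])
    rw [hD.orth s' t' hs' hst' z hz _ hm, orth' s' t' hs' hst' z hz _ hm, ho]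
    simp
  · have hadd := hD.add s s' t hs h h1 y hy
    have hm := hD.mem s s' hs h y hy
    rw [hadd, inner_add_left, inner_add_right, hD.orth s' t' hs' hst' z hz _ hm,
      orth' s' t' hs' hst' z hz _ hm, zero_add, zero_add]
    rcases le_total t t' with h2 | h2
    · have ho : overlap s t s' t' = t - s' := by
        rw [overlap, min_eq_left h2, max_eq_right h, max_eq_right (sub_nonneg.2 h1)]
      have hm1 := hD.mem s' t hs' h1 y hy'
      have hzt := hD.mono h1 hz
      have ht := hs'.trans h1
      rw [hD.add s' t t' hs' h1 h2 z hz, inner_add_left, inner_add_right,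
        hD.orth t t' ht h2 z hzt _ hm1, orth' t t' ht h2 z hzt _ hm1,
        hD.cov s' t hs' h1 y hy' z hz, hD.cov s' t hs' h1 z hz y hy', ho]
      simp
    · have ho : overlap s t s' t' = t' - s' := by
        rw [overlap, min_eq_right h2, max_eq_right h, max_eq_right (sub_nonneg.2 hst')]
      have hm1 := hD.mem s' t' hs' hst' z hz
      have hyt := hD.mono hst' hy'
      have ht := hs'.trans hst'
      rw [hD.add s' t' t hs' hst' h2 y hy', inner_add_left, inner_add_right,
        hD.orth t' t ht h2 y hyt _ hm1, orth' t' t ht h2 y hyt _ hm1,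
        hD.cov s' t' hs' hst' y hy' z hz, hD.cov s' t' hs' hst' z hz y hy', ho]
      simp

/-- The covariance of two increments is the length of the overlap of the two intervals. -/
theorem inner_eq (hD : OrthogonalNoise F D Q) {s t s' t' : ℝ} (hs : 0 ≤ s) (hs' : 0 ≤ s')
    (hst : s ≤ t) (hst' : s' ≤ t') {y z : H} (hy : y ∈ F s) (hz : z ∈ F s') :
    ⟪D s t y, D s' t' z⟫_ℂ = (overlap s t s' t' : ℂ) * ⟪y, Q z⟫_ℂ := by
  rcases le_total s s' with h | h
  · exact (hD.inner_of_le hs hst hst' h hy hz).1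
  · rw [overlap_comm]; exact (hD.inner_of_le hs' hst' hst h hz hy).2

/-- Sums of increments applied to an adapted vector process obey the Itô isometry. -/
theorem inner_intervalSum_self (hD : OrthogonalNoise F D Q) {a b δ : ℝ} (ha : 0 ≤ a)
    {p : ℕ × (ℕ → ℝ)} (hp : IsSubdivision a b δ p) {y : ℝ → H} (hy : ∀ s ∈ Icc a b, y s ∈ F s) :
    ⟪intervalSum (fun s t => D s t (y s)) p, intervalSum (fun s t => D s t (y s)) p⟫_ℂ
      = intervalSum (fun s t => ((t - s : ℝ) : ℂ) * ⟪y s, Q (y s)⟫_ℂ) p := by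
  have key : ∀ k ≤ p.1,
      (∑ i ∈ Finset.range k, D (p.2 i) (p.2 (i + 1)) (y (p.2 i))) ∈ F (p.2 k) ∧
      ⟪∑ i ∈ Finset.range k, D (p.2 i) (p.2 (i + 1)) (y (p.2 i)),
        ∑ i ∈ Finset.range k, D (p.2 i) (p.2 (i + 1)) (y (p.2 i))⟫_ℂ
      = ∑ i ∈ Finset.range k, ((p.2 (i + 1) - p.2 i : ℝ) : ℂ) * ⟪y (p.2 i), Q (y (p.2 i))⟫_ℂ := by
    intro k
    induction k with
    | zero => intro _; simp
    | succ k ih =>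
      intro hk
      obtain ⟨h1, h2⟩ := ih (by omega)
      have h0 : 0 ≤ p.2 k := ha.trans (hp.mem_Icc (by omega)).1
      have hle := (hp.lt k (by omega)).le
      have hyk := hy _ (hp.mem_Icc (show k ≤ p.1 by omega))
      refine ⟨?_, ?_⟩
      · rw [Finset.sum_range_succ]
        exact add_mem (hD.mono hle h1) (hD.mem _ _ h0 hle _ hyk)
      · have ho := hD.orth _ _ h0 hle _ hyk _ h1
        have ho' : ⟪D (p.2 k) (p.2 (k + 1)) (y (p.2 k)),
            ∑ i ∈ Finset.range k, D (p.2 i) (p.2 (i + 1)) (y (p.2 i))⟫_ℂ = 0 := by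
          rw [← inner_conj_symm, ho, map_zero]
        rw [Finset.sum_range_succ, Finset.sum_range_succ, inner_add_left, inner_add_right,
          inner_add_right, ho, ho', h2, hD.cov _ _ h0 hle _ hyk _ hyk]
        simp
  exact (key p.1 le_rfl).2

/-- The Itô estimate for adapted vector processes. -/
theorem norm_intervalSum_sq_le (hD : OrthogonalNoise F D Q) {a b δ : ℝ} (ha : 0 ≤ a)
    {p : ℕ × (ℕ → ℝ)} (hp : IsSubdivision a b δ p) {y : ℝ → H} (hy : ∀ s ∈ Icc a b, y s ∈ F s) :
    ‖intervalSum (fun s t => D s t (y s)) p‖ ^ 2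
      ≤ ‖Q‖ * intervalSum (fun s t => (t - s) * ‖y s‖ ^ 2) p := by
  have h := hD.inner_intervalSum_self ha hp hy
  have h2 : ‖intervalSum (fun s t => D s t (y s)) p‖ ^ 2
      = ‖intervalSum (fun s t => ((t - s : ℝ) : ℂ) * ⟪y s, Q (y s)⟫_ℂ) p‖ := by
    rw [← h, inner_self_eq_norm_sq_to_K]
    simp
  rw [h2, intervalSum, intervalSum, Finset.mul_sum]
  refine (norm_sum_le _ _).trans (Finset.sum_le_sum fun i hi => ?_)
  have hle := (hp.lt i (Finset.mem_range.1 hi)).le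
  rw [norm_mul, Complex.norm_real, Real.norm_of_nonneg (sub_nonneg.2 hle)]
  have := (norm_inner_le_norm (𝕜 := ℂ) (y (p.2 i)) (Q (y (p.2 i)))).trans
    (mul_le_mul_of_nonneg_left (Q.le_opNorm (y (p.2 i))) (norm_nonneg _))
  calc _ ≤ (p.2 (i + 1) - p.2 i) * (‖y (p.2 i)‖ * (‖Q‖ * ‖y (p.2 i)‖)) :=
        mul_le_mul_of_nonneg_left this (sub_nonneg.2 hle)
    _ = _ := by ring

/-- Two sums over different partitions are compared without passing to a common refinement: the
covariance of two increments depends on the overlap of the intervals only, and the overlaps of an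
interval with the intervals of a partition add up to its length. -/
theorem norm_intervalSum_sub_sq_le (hD : OrthogonalNoise F D Q) {a b δ ω : ℝ} (ha : 0 ≤ a)
    {p q : ℕ × (ℕ → ℝ)} (hp : IsSubdivision a b δ p) (hq : IsSubdivision a b δ q)
    {y : ℝ → H} (hy : ∀ s ∈ Icc a b, y s ∈ F s)
    (hω : ∀ s ∈ Icc a b, ∀ t ∈ Icc a b, |s - t| < δ → ‖y s - y t‖ ≤ ω) :
    ‖intervalSum (fun s t => D s t (y s)) p - intervalSum (fun s t => D s t (y s)) q‖ ^ 2
      ≤ ‖Q‖ * ω ^ 2 * (b - a) := by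
  set m : ℕ → ℕ → ℝ := fun i j => overlap (p.2 i) (p.2 (i + 1)) (q.2 j) (q.2 (j + 1)) with hm
  have hrow : ∀ i ∈ Finset.range p.1, ∑ j ∈ Finset.range q.1, m i j = p.2 (i + 1) - p.2 i := by
    intro i hi
    have hi := Finset.mem_range.1 hi
    exact hq.sum_overlap (hp.mem_Icc hi.le).1 (hp.lt i hi).le (hp.mem_Icc hi).2
  have hcol : ∀ j ∈ Finset.range q.1, ∑ i ∈ Finset.range p.1, m i j = q.2 (j + 1) - q.2 j := by
    intro j hj
    have hj := Finset.mem_range.1 hj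
    rw [← hp.sum_overlap (hq.mem_Icc hj.le).1 (hq.lt j hj).le (hq.mem_Icc hj).2]
    exact Finset.sum_congr rfl fun i _ => overlap_comm _ _ _ _
  set A := intervalSum (fun s t => D s t (y s)) p with hA
  set B := intervalSum (fun s t => D s t (y s)) q with hB
  have hAA : ⟪A, A⟫_ℂ = ∑ i ∈ Finset.range p.1, ∑ j ∈ Finset.range q.1,
      (m i j : ℂ) * ⟪y (p.2 i), Q (y (p.2 i))⟫_ℂ := by
    rw [hA, hD.inner_intervalSum_self ha hp hy]
    refine Finset.sum_congr rfl fun i hi => ?_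
    rw [← Finset.sum_mul, ← Complex.ofReal_sum, hrow i hi]
  have hBB : ⟪B, B⟫_ℂ = ∑ i ∈ Finset.range p.1, ∑ j ∈ Finset.range q.1,
      (m i j : ℂ) * ⟪y (q.2 j), Q (y (q.2 j))⟫_ℂ := by
    rw [hB, hD.inner_intervalSum_self ha hq hy, Finset.sum_comm]
    refine Finset.sum_congr rfl fun i hi => ?_
    rw [← Finset.sum_mul, ← Complex.ofReal_sum, hcol i hi]
  have h0p : ∀ i < p.1, 0 ≤ p.2 i := fun i hi => ha.trans (hp.mem_Icc hi.le).1
  have h0q : ∀ i < q.1, 0 ≤ q.2 i := fun i hi => ha.trans (hq.mem_Icc hi.le).1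
  have hAB : ⟪A, B⟫_ℂ = ∑ i ∈ Finset.range p.1, ∑ j ∈ Finset.range q.1,
      (m i j : ℂ) * ⟪y (p.2 i), Q (y (q.2 j))⟫_ℂ := by
    rw [hA, hB, intervalSum, intervalSum, sum_inner]
    refine Finset.sum_congr rfl fun i hi => ?_
    rw [inner_sum]
    refine Finset.sum_congr rfl fun j hj => ?_
    have hi := Finset.mem_range.1 hi
    have hj := Finset.mem_range.1 hj
    exact hD.inner_eq (h0p i hi) (h0q j hj) (hp.lt i hi).le (hq.lt j hj).le
      (hy _ (hp.mem_Icc hi.le)) (hy _ (hq.mem_Icc hj.le))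
  have hBA : ⟪B, A⟫_ℂ = ∑ i ∈ Finset.range p.1, ∑ j ∈ Finset.range q.1,
      (m i j : ℂ) * ⟪y (q.2 j), Q (y (p.2 i))⟫_ℂ := by
    rw [hA, hB, intervalSum, intervalSum, sum_inner, Finset.sum_comm]
    refine Finset.sum_congr rfl fun i hi => ?_
    rw [inner_sum]
    refine Finset.sum_congr rfl fun j hj => ?_
    have hi := Finset.mem_range.1 hi
    have hj := Finset.mem_range.1 hj
    rw [hm]
    simp only
    rw [overlap_comm]
    exact hD.inner_eq (h0q i hi) (h0p j hj) (hq.lt i hi).le (hp.lt j hj).le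
      (hy _ (hq.mem_Icc hi.le)) (hy _ (hp.mem_Icc hj.le))
  have hall : ⟪A - B, A - B⟫_ℂ = ∑ i ∈ Finset.range p.1, ∑ j ∈ Finset.range q.1,
      (m i j : ℂ) * ⟪y (p.2 i) - y (q.2 j), Q (y (p.2 i) - y (q.2 j))⟫_ℂ := by
    rw [inner_sub_left, inner_sub_right, inner_sub_right, hAA, hAB, hBA, hBB]
    simp only [← Finset.sum_sub_distrib]
    refine Finset.sum_congr rfl fun i _ => Finset.sum_congr rfl fun j _ => ?_
    rw [map_sub, inner_sub_left, inner_sub_right, inner_sub_right]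
    ring
  have hn : ‖A - B‖ ^ 2 = ‖⟪A - B, A - B⟫_ℂ‖ := by
    rw [inner_self_eq_norm_sq_to_K]; simp
  rw [hn, hall]
  have hsum : ‖Q‖ * ω ^ 2 * (b - a)
      = ∑ i ∈ Finset.range p.1, ∑ j ∈ Finset.range q.1, m i j * (‖Q‖ * ω ^ 2) := by
    have := hp.sum_sub id
    simp only [id] at this
    rw [← this, intervalSum, Finset.mul_sum]
    refine Finset.sum_congr rfl fun i hi => ?_
    rw [← Finset.sum_mul, hrow i hi, mul_comm]
  rw [hsum]
  refine (norm_sum_le _ _).trans (Finset.sum_le_sum fun i hi => ?_)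
  refine (norm_sum_le _ _).trans (Finset.sum_le_sum fun j hj => ?_)
  have hi := Finset.mem_range.1 hi
  have hj := Finset.mem_range.1 hj
  rw [norm_mul, Complex.norm_real, Real.norm_of_nonneg (overlap_nonneg _ _ _ _)]
  by_cases h0 : m i j = 0
  · change m i j * _ ≤ m i j * _
    rw [h0, zero_mul, zero_mul]
  · refine mul_le_mul_of_nonneg_left ?_ (overlap_nonneg _ _ _ _)
    have h1 := hω _ (hp.mem_Icc hi.le) _ (hq.mem_Icc hj.le)
      (abs_sub_lt_of_overlap (hp.sub_lt i hi) (hq.sub_lt j hj) h0)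
    refine (norm_inner_le_norm (𝕜 := ℂ) _ _).trans ?_
    calc _ ≤ ‖y (p.2 i) - y (q.2 j)‖ * (‖Q‖ * ‖y (p.2 i) - y (q.2 j)‖) :=
          mul_le_mul_of_nonneg_left (Q.le_opNorm _) (norm_nonneg _)
      _ = ‖Q‖ * ‖y (p.2 i) - y (q.2 j)‖ ^ 2 := by ring
      _ ≤ _ := by gcongr

end OrthogonalNoise

/-! ### Linear stochastic differential equations driven by an orthogonal noise -/

theorem intervalSum_apply (G : ℝ → ℝ → (H →L[ℂ] H)) (p : ℕ × (ℕ → ℝ)) (ξ : H) :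
    intervalSum G p ξ = intervalSum (fun s t => G s t ξ) p := by
  simp [intervalSum]

theorem intervalSum_add {E : Type*} [AddCommMonoid E] (G G' : ℝ → ℝ → E) (p : ℕ × (ℕ → ℝ)) :
    intervalSum (fun s t => G s t + G' s t) p = intervalSum G p + intervalSum G' p :=
  Finset.sum_add_distrib

theorem intervalSum_sub {E : Type*} [AddCommGroup E] (G G' : ℝ → ℝ → E) (p : ℕ × (ℕ → ℝ)) :
    intervalSum (fun s t => G s t - G' s t) p = intervalSum G p - intervalSum G' p :=
  Finset.sum_sub_distrib _ _

/-- An exponential rate `λ` for which the integral equation is a contraction with constant `1 / 2`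
in the norm `sup ‖x s‖ exp (-λ s)`. -/
def rate (Q K : H →L[ℂ] H) : ℝ := 8 * ‖Q‖ + 4 * ‖K‖ + 1

theorem rate_pos (Q K : H →L[ℂ] H) : 0 < rate Q K := by rw [rate]; positivity

theorem sub_mul_exp_le {l : ℝ} (hl : 0 < l) (s t : ℝ) :
    (t - s) * Real.exp (l * s) ≤ Real.exp (l * t) / l - Real.exp (l * s) / l := by
  have h : l * (t - s) + 1 ≤ Real.exp (l * (t - s)) := Real.add_one_le_exp _
  have h2 : Real.exp (l * t) = Real.exp (l * s) * Real.exp (l * (t - s)) := by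
    rw [← Real.exp_add]; ring_nf
  rw [← sub_div, le_div_iff₀ hl, h2]
  nlinarith [Real.exp_pos (l * s)]

theorem tendsto_div_two_pow (C : ℝ) : Tendsto (fun n : ℕ => C / 2 ^ n) atTop (𝓝 0) :=
  tendsto_const_nhds.div_atTop (tendsto_pow_atTop_atTop_of_one_lt one_lt_two)

/-- A bounded function vanishes if every exponential bound for it can be halved. -/
theorem eq_zero_of_halving {E : Type*} [NormedAddCommGroup E] {w : ℝ → E} {T l M₀ : ℝ}
    (hl : 0 < l) (hb : ∀ s ∈ Icc 0 T, ‖w s‖ ≤ M₀)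
    (h : ∀ M, 0 ≤ M → (∀ s ∈ Icc 0 T, ‖w s‖ ≤ M * Real.exp (l * s)) →
      ∀ s ∈ Icc 0 T, ‖w s‖ ≤ M / 2 * Real.exp (l * s)) :
    ∀ s ∈ Icc 0 T, w s = 0 := by
  intro s hs
  have hM : 0 ≤ M₀ := (norm_nonneg _).trans (hb s hs)
  have key : ∀ n : ℕ, ∀ s ∈ Icc 0 T, ‖w s‖ ≤ M₀ / 2 ^ n * Real.exp (l * s) := by
    intro n
    induction n with
    | zero =>
      intro s hs
      refine (hb s hs).trans ?_
      have : 1 ≤ Real.exp (l * s) := Real.one_le_exp (mul_nonneg hl.le hs.1)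
      simpa using le_mul_of_one_le_right hM this
    | succ n ih =>
      have := h _ (by positivity) ih
      intro s hs
      refine (this s hs).trans_eq ?_
      rw [pow_succ]; field_simp
  have hlim : Tendsto (fun n : ℕ => M₀ / 2 ^ n * Real.exp (l * s)) atTop (𝓝 0) := by
    have := (tendsto_div_two_pow M₀).mul_const (Real.exp (l * s))
    simpa using this
  have := ge_of_tendsto' hlim fun n => key n s hs
  exact norm_le_zero_iff.1 this

namespace OrthogonalNoise

variable {F : ℝ → Submodule ℂ H} {D : ℝ → ℝ → (H →L[ℂ] H)} {Q : H →L[ℂ] H}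

theorem shift (hD : OrthogonalNoise F D Q) {t : ℝ} (ht : 0 ≤ t) :
    OrthogonalNoise (fun s => F (s + t)) (fun r s => D (r + t) (s + t)) Q where
  mono := fun _ _ h => hD.mono (by linarith)
  mem := fun r s h0 h1 y hy => hD.mem _ _ (by linarith) (by linarith) y hy
  orth := fun r s h0 h1 y hy z hz => hD.orth _ _ (by linarith) (by linarith) y hy z hz
  add := fun r s u h0 h1 h2 y hy => hD.add _ _ _ (by linarith) (by linarith) (by linarith) y hy
  cov := fun r s h0 h1 y hy z hz => by
    rw [hD.cov _ _ (by linarith) (by linarith) y hy z hz]; simp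

theorem norm_intervalSum_le_const (hD : OrthogonalNoise F D Q) {a b δ M : ℝ} (ha : 0 ≤ a)
    (hab : a ≤ b) {p : ℕ × (ℕ → ℝ)} (hp : IsSubdivision a b δ p) {y : ℝ → H}
    (hy : ∀ s ∈ Icc a b, y s ∈ F s) (hM : ∀ s ∈ Icc a b, ‖y s‖ ≤ M) :
    ‖intervalSum (fun s t => D s t (y s)) p‖ ≤ M * √(‖Q‖ * (b - a)) := by
  have hM0 : 0 ≤ M := (norm_nonneg _).trans (hM a (left_mem_Icc.2 hab))
  have h := hD.norm_intervalSum_sq_le ha hp hy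
  have h2 : intervalSum (fun s t => (t - s) * ‖y s‖ ^ 2) p ≤ M ^ 2 * b - M ^ 2 * a := by
    refine (Real.le_norm_self _).trans
      (hp.norm_intervalSum_le (g := fun s => M ^ 2 * s) fun s t h1 h2 h3 _ => ?_)
    have hs : 0 ≤ t - s := sub_nonneg.2 h2.le
    rw [Real.norm_of_nonneg (by positivity), ← mul_sub, mul_comm]
    exact mul_le_mul_of_nonneg_right
      (pow_le_pow_left₀ (norm_nonneg _) (hM s ⟨h1, h2.le.trans h3⟩) 2) hs
  have hba := sub_nonneg.2 hab
  refine abs_le_of_sq_le_sq' ?_ (by positivity) |>.2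
  refine h.trans ?_
  rw [mul_pow, Real.sq_sqrt (by positivity)]
  calc _ ≤ ‖Q‖ * (M ^ 2 * b - M ^ 2 * a) := by gcongr
    _ = _ := by ring

theorem norm_intervalSum_le_exp (hD : OrthogonalNoise F D Q) (K : H →L[ℂ] H) {a b δ M : ℝ}
    (ha : 0 ≤ a) {p : ℕ × (ℕ → ℝ)} (hp : IsSubdivision a b δ p) {y : ℝ → H}
    (hy : ∀ s ∈ Icc a b, y s ∈ F s) (hM0 : 0 ≤ M)
    (hM : ∀ s ∈ Icc a b, ‖y s‖ ≤ M * Real.exp (rate Q K * s)) :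
    ‖intervalSum (fun s t => D s t (y s)) p‖ ≤ M / 4 * Real.exp (rate Q K * b) := by
  have hl := rate_pos Q K
  have h := hD.norm_intervalSum_sq_le ha hp hy
  set l := rate Q K with hl'
  have hlQ : 8 * ‖Q‖ ≤ l := by rw [hl', rate]; linarith [norm_nonneg K]
  set g : ℝ → ℝ := fun s => M ^ 2 * (Real.exp (2 * l * s) / (2 * l)) with hg
  have h2 : intervalSum (fun s t => (t - s) * ‖y s‖ ^ 2) p ≤ g b - g a := by
    refine (Real.le_norm_self _).trans (hp.norm_intervalSum_le (g := g) fun s t h1 h2 h3 _ => ?_)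
    have hs : 0 ≤ t - s := sub_nonneg.2 h2.le
    rw [Real.norm_of_nonneg (by positivity), hg]
    simp only
    rw [← mul_sub]
    calc (t - s) * ‖y s‖ ^ 2 ≤ (t - s) * (M * Real.exp (l * s)) ^ 2 :=
          mul_le_mul_of_nonneg_left
            (pow_le_pow_left₀ (norm_nonneg _) (hM s ⟨h1, h2.le.trans h3⟩) 2) hs
      _ = M ^ 2 * ((t - s) * Real.exp (2 * l * s)) := by
          rw [mul_pow, ← Real.exp_nat_mul]; push_cast; ring_nf
      _ ≤ _ := mul_le_mul_of_nonneg_left (sub_mul_exp_le (by positivity) s t) (by positivity)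
  have h3 : g b - g a ≤ g b := by
    have : 0 ≤ g a := by positivity
    linarith
  refine abs_le_of_sq_le_sq' ?_ (by positivity) |>.2
  refine h.trans ((mul_le_mul_of_nonneg_left (h2.trans h3) (norm_nonneg _)).trans ?_)
  rw [hg]
  have e : Real.exp (2 * l * b) = Real.exp (l * b) ^ 2 := by
    rw [← Real.exp_nat_mul]; push_cast; ring_nf
  simp only
  rw [e]
  have : ‖Q‖ / (2 * l) ≤ 1 / 16 := by
    rw [div_le_div_iff₀ (by positivity) (by norm_num)]; linarith
  calc ‖Q‖ * (M ^ 2 * (Real.exp (l * b) ^ 2 / (2 * l)))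
      = ‖Q‖ / (2 * l) * (M * Real.exp (l * b)) ^ 2 := by ring
    _ ≤ 1 / 16 * (M * Real.exp (l * b)) ^ 2 := by gcongr
    _ = _ := by ring

end OrthogonalNoise

theorem norm_intervalSum_drift_le (Q K : H →L[ℂ] H) {a b δ M : ℝ}
    {p : ℕ × (ℕ → ℝ)} (hp : IsSubdivision a b δ p) {x : ℝ → (H →L[ℂ] H)} (hM0 : 0 ≤ M)
    (hM : ∀ s ∈ Icc a b, ‖x s‖ ≤ M * Real.exp (rate Q K * s)) :
    ‖intervalSum (fun s t => (t - s) • (K * x s)) p‖ ≤ M / 4 * Real.exp (rate Q K * b) := by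
  have hl := rate_pos Q K
  set l := rate Q K with hl'
  have hlK : 4 * ‖K‖ ≤ l := by rw [hl', rate]; linarith [norm_nonneg Q]
  refine (hp.norm_intervalSum_le (g := fun s => ‖K‖ * M * (Real.exp (l * s) / l))
    fun s t h1 h2 h3 _ => ?_).trans ?_
  · have hs : 0 ≤ t - s := sub_nonneg.2 h2.le
    rw [norm_smul, Real.norm_of_nonneg hs, ← mul_sub]
    calc (t - s) * ‖K * x s‖ ≤ (t - s) * (‖K‖ * (M * Real.exp (l * s))) := by
          refine mul_le_mul_of_nonneg_left ((norm_mul_le _ _).trans ?_) hs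
          exact mul_le_mul_of_nonneg_left (hM s ⟨h1, h2.le.trans h3⟩) (norm_nonneg _)
      _ = ‖K‖ * M * ((t - s) * Real.exp (l * s)) := by ring
      _ ≤ _ := mul_le_mul_of_nonneg_left (sub_mul_exp_le hl s t) (by positivity)
  · have h1 : 0 ≤ ‖K‖ * M * (Real.exp (l * a) / l) := by positivity
    have h2 : ‖K‖ / l ≤ 1 / 4 := by
      rw [div_le_div_iff₀ hl (by norm_num)]; linarith
    have h3 : ‖K‖ * M * (Real.exp (l * b) / l) ≤ M / 4 * Real.exp (l * b) := by
      calc _ = ‖K‖ / l * (M * Real.exp (l * b)) := by ring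
        _ ≤ 1 / 4 * (M * Real.exp (l * b)) := by gcongr
        _ = _ := by ring
    linarith

/-- The increment `dD x + K x dt` over the interval `[s, t]`. -/
def incr (D : ℝ → ℝ → (H →L[ℂ] H)) (K : H →L[ℂ] H) (x : ℝ → (H →L[ℂ] H)) (s t : ℝ) : H →L[ℂ] H :=
  D s t * x s + (t - s) • (K * x s)

theorem incr_sub (D : ℝ → ℝ → (H →L[ℂ] H)) (K : H →L[ℂ] H) (x y : ℝ → (H →L[ℂ] H)) (s t : ℝ) :
    incr D K (fun r => x r - y r) s t = incr D K x s t - incr D K y s t := by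
  simp only [incr, mul_sub, smul_sub]; abel

namespace OrthogonalNoise

variable {F : ℝ → Submodule ℂ H} {D : ℝ → ℝ → (H →L[ℂ] H)} {Q : H →L[ℂ] H}

theorem norm_intervalSum_incr_le_exp (hD : OrthogonalNoise F D Q) (K : H →L[ℂ] H) {a b δ M : ℝ}
    (ha : 0 ≤ a) (hab : a ≤ b) {p : ℕ × (ℕ → ℝ)} (hp : IsSubdivision a b δ p)
    {x : ℝ → (H →L[ℂ] H)} (hx : ∀ s ∈ Icc a b, ∀ ξ, x s ξ ∈ F s)
    (hM : ∀ s ∈ Icc a b, ‖x s‖ ≤ M * Real.exp (rate Q K * s)) :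
    ‖intervalSum (incr D K x) p‖ ≤ M / 2 * Real.exp (rate Q K * b) := by
  have hM0 : 0 ≤ M := by
    have := (norm_nonneg _).trans (hM a (left_mem_Icc.2 hab))
    exact nonneg_of_mul_nonneg_left this (Real.exp_pos _)
  have h1 : ‖intervalSum (fun s t => D s t * x s) p‖ ≤ M / 4 * Real.exp (rate Q K * b) := by
    refine ContinuousLinearMap.opNorm_le_bound _ (by positivity) fun ξ => ?_
    rw [intervalSum_apply]
    refine (hD.norm_intervalSum_le_exp K ha hp (y := fun s => x s ξ) (M := M * ‖ξ‖)
      (fun s hs => hx s hs ξ) (by positivity) fun s hs => ?_).trans_eq (by ring)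
    refine ((x s).le_opNorm ξ).trans ((mul_le_mul_of_nonneg_right (hM s hs)
      (norm_nonneg _)).trans_eq (by ring))
  have h2 := norm_intervalSum_drift_le Q K hp hM0 hM
  have := intervalSum_add (fun s t => D s t * x s) (fun s t => (t - s) • (K * x s)) p
  change ‖intervalSum (fun s t => D s t * x s + (t - s) • (K * x s)) p‖ ≤ _
  rw [this]
  refine (norm_add_le _ _).trans ((add_le_add h1 h2).trans_eq (by ring))

theorem norm_intervalSum_noise_le_const (hD : OrthogonalNoise F D Q) {a b δ M : ℝ}
    (ha : 0 ≤ a) (hab : a ≤ b) {p : ℕ × (ℕ → ℝ)} (hp : IsSubdivision a b δ p)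
    {x : ℝ → (H →L[ℂ] H)} (hx : ∀ s ∈ Icc a b, ∀ ξ, x s ξ ∈ F s)
    (hM : ∀ s ∈ Icc a b, ‖x s‖ ≤ M) :
    ‖intervalSum (fun s t => D s t * x s) p‖ ≤ M * √(‖Q‖ * (b - a)) := by
  have hM0 : 0 ≤ M := (norm_nonneg _).trans (hM a (left_mem_Icc.2 hab))
  refine ContinuousLinearMap.opNorm_le_bound _ (by positivity) fun ξ => ?_
  rw [intervalSum_apply]
  refine (hD.norm_intervalSum_le_const ha hab hp (y := fun s => x s ξ) (M := M * ‖ξ‖)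
    (fun s hs => hx s hs ξ) fun s hs => ?_).trans_eq (by ring)
  exact ((x s).le_opNorm ξ).trans (mul_le_mul_of_nonneg_right (hM s hs) (norm_nonneg _))

theorem norm_intervalSum_incr_le_const (hD : OrthogonalNoise F D Q) (K : H →L[ℂ] H) {a b δ M : ℝ}
    (ha : 0 ≤ a) (hab : a ≤ b) {p : ℕ × (ℕ → ℝ)} (hp : IsSubdivision a b δ p)
    {x : ℝ → (H →L[ℂ] H)} (hx : ∀ s ∈ Icc a b, ∀ ξ, x s ξ ∈ F s)
    (hM : ∀ s ∈ Icc a b, ‖x s‖ ≤ M) :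
    ‖intervalSum (incr D K x) p‖ ≤ M * (√(‖Q‖ * (b - a)) + ‖K‖ * (b - a)) := by
  have h1 := hD.norm_intervalSum_noise_le_const ha hab hp hx hM
  have h2 : ‖intervalSum (fun s t => (t - s) • (K * x s)) p‖ ≤ ‖K‖ * M * b - ‖K‖ * M * a := by
    refine hp.norm_intervalSum_le (g := fun s => ‖K‖ * M * s) fun s t h1 h2 h3 _ => ?_
    have hs : 0 ≤ t - s := sub_nonneg.2 h2.le
    rw [norm_smul, Real.norm_of_nonneg hs, ← mul_sub, mul_comm (‖K‖ * M)]
    refine mul_le_mul_of_nonneg_left ((norm_mul_le _ _).trans ?_) hs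
    exact mul_le_mul_of_nonneg_left (hM s ⟨h1, h2.le.trans h3⟩) (norm_nonneg _)
  have := intervalSum_add (fun s t => D s t * x s) (fun s t => (t - s) • (K * x s)) p
  change ‖intervalSum (fun s t => D s t * x s + (t - s) • (K * x s)) p‖ ≤ _
  rw [this]
  refine (norm_add_le _ _).trans ((add_le_add h1 h2).trans_eq (by ring))

variable [CompleteSpace H]

/-- The Itô sums of a norm continuous adapted process converge in norm. -/
theorem exists_tendsto_noise (hD : OrthogonalNoise F D Q) {a b : ℝ} (ha : 0 ≤ a) (hab : a ≤ b)
    {x : ℝ → (H →L[ℂ] H)} (hx : ∀ s ∈ Icc a b, ∀ ξ, x s ξ ∈ F s)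
    (hc : ContinuousOn x (Icc a b)) :
    ∃ J, Tendsto (intervalSum fun s t => D s t * x s) (mesh a b) (𝓝 J) := by
  have := mesh_neBot hab
  refine cauchy_map_iff_exists_tendsto.1 (Metric.cauchy_iff.2 ⟨inferInstance, fun ε hε => ?_⟩)
  have huc := isCompact_Icc.uniformContinuousOn_of_continuous hc
  rw [Metric.uniformContinuousOn_iff] at huc
  have hba := sub_nonneg.2 hab
  set C := √(‖Q‖ * (b - a)) with hC
  have hC0 : 0 ≤ C := Real.sqrt_nonneg _
  obtain ⟨δ, hδ, h⟩ := huc (ε / (C + 1)) (by positivity)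
  refine ⟨_, image_mem_map (eventually_mesh hδ), ?_⟩
  rintro _ ⟨p, hp, rfl⟩ _ ⟨q, hq, rfl⟩
  have hle : ‖intervalSum (fun s t => D s t * x s) p - intervalSum (fun s t => D s t * x s) q‖
      ≤ ε / (C + 1) * C := by
    refine ContinuousLinearMap.opNorm_le_bound _ (by positivity) fun ξ => ?_
    rw [sub_apply, intervalSum_apply, intervalSum_apply]
    have := hD.norm_intervalSum_sub_sq_le (ω := ε / (C + 1) * ‖ξ‖) ha hp hq (y := fun s => x s ξ)
      (fun s hs => hx s hs ξ) fun s hs t ht hst => by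
        rw [← sub_apply]
        refine ((x s - x t).le_opNorm ξ).trans (mul_le_mul_of_nonneg_right ?_ (norm_nonneg _))
        rw [← dist_eq_norm]
        exact (h s hs t ht hst).le
    refine abs_le_of_sq_le_sq' ?_ (by positivity) |>.2
    refine this.trans_eq ?_
    have hC2 : C ^ 2 = ‖Q‖ * (b - a) := Real.sq_sqrt (by positivity)
    rw [mul_pow, mul_pow, mul_pow, hC2]
    ring
  rw [dist_eq_norm]
  refine hle.trans_lt ?_
  rw [div_mul_eq_mul_div, div_lt_iff₀ (by positivity)]
  nlinarith

theorem exists_tendsto_incr (hD : OrthogonalNoise F D Q) (K : H →L[ℂ] H) {a b : ℝ} (ha : 0 ≤ a)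
    (hab : a ≤ b) {x : ℝ → (H →L[ℂ] H)} (hx : ∀ s ∈ Icc a b, ∀ ξ, x s ξ ∈ F s)
    (hc : ContinuousOn x (Icc a b)) :
    ∃ J, Tendsto (intervalSum (incr D K x)) (mesh a b) (𝓝 J) := by
  obtain ⟨J, hJ⟩ := hD.exists_tendsto_noise ha hab hx hc
  refine ⟨_, (hJ.add (tendsto_riemannSum hab
    ((continuousOn_const (c := K)).mul hc))).congr fun p => ?_⟩
  exact (intervalSum_add _ _ p).symm

end OrthogonalNoise

/-- A filtration `V` of norm closed spaces of operators, adapted to the filtration `F` of subspaces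
and stable under the noise `D` and under `K`. -/
structure AdaptedClass (F : ℝ → Submodule ℂ H) (D : ℝ → ℝ → (H →L[ℂ] H)) (K : H →L[ℂ] H)
    (V : ℝ → Submodule ℂ (H →L[ℂ] H)) : Prop where
  isClosed : ∀ t, IsClosed (V t : Set (H →L[ℂ] H))
  mono : Monotone V
  range : ∀ t, 0 ≤ t → ∀ x ∈ V t, ∀ ξ, x ξ ∈ F t
  noise : ∀ s t, 0 ≤ s → s ≤ t → ∀ x ∈ V s, D s t * x ∈ V t
  drift : ∀ t, 0 ≤ t → ∀ x ∈ V t, K * x ∈ V t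

variable {F : ℝ → Submodule ℂ H} {D : ℝ → ℝ → (H →L[ℂ] H)} {Q K : H →L[ℂ] H}
  {V : ℝ → Submodule ℂ (H →L[ℂ] H)}

/-- The integral `∫ dD x + ∫ K x ds` over `[a, b]`, as the norm limit along partitions, which exists
for norm continuous adapted processes. -/
def sdeIntegral (D : ℝ → ℝ → (H →L[ℂ] H)) (K : H →L[ℂ] H) (x : ℝ → (H →L[ℂ] H)) (a b : ℝ) :
    H →L[ℂ] H := limUnder (mesh a b) (intervalSum (incr D K x))

/-- Norm continuous adapted processes. -/
def IsProcess (V : ℝ → Submodule ℂ (H →L[ℂ] H)) (x : ℝ → (H →L[ℂ] H)) : Prop :=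
  ContinuousOn x (Ici 0) ∧ ∀ t, 0 ≤ t → x t ∈ V t

theorem IsProcess.sub {x y : ℝ → (H →L[ℂ] H)} (hx : IsProcess V x) (hy : IsProcess V y) :
    IsProcess V fun t => x t - y t :=
  ⟨hx.1.sub hy.1, fun t ht => sub_mem (hx.2 t ht) (hy.2 t ht)⟩

section
variable [CompleteSpace H] (hD : OrthogonalNoise F D Q) (hV : AdaptedClass F D K V)
include hD hV

theorem tendsto_sdeIntegral {x : ℝ → (H →L[ℂ] H)} (hx : IsProcess V x) {a b : ℝ} (ha : 0 ≤ a)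
    (hab : a ≤ b) :
    Tendsto (intervalSum (incr D K x)) (mesh a b) (𝓝 (sdeIntegral D K x a b)) := by
  refine tendsto_nhds_limUnder (hD.exists_tendsto_incr K ha hab (fun s hs => ?_)
    (hx.1.mono fun s hs => ha.trans hs.1))
  exact hV.range s (ha.trans hs.1) _ (hx.2 s (ha.trans hs.1))

theorem sdeIntegral_mem {x : ℝ → (H →L[ℂ] H)} (hx : IsProcess V x) {t : ℝ} (ht : 0 ≤ t) :
    sdeIntegral D K x 0 t ∈ V t := by
  have := mesh_neBot ht
  refine (hV.isClosed t).mem_of_tendsto (tendsto_sdeIntegral hD hV hx le_rfl ht) ?_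
  filter_upwards [eventually_mesh one_pos] with p hp
  refine sum_mem fun i hi => ?_
  have hi := Finset.mem_range.1 hi
  have h0 := (hp.mem_Icc hi.le).1
  have h1 := hx.2 _ h0
  refine add_mem ?_ ?_
  · exact hV.mono (hp.mem_Icc hi).2 (hV.noise _ _ h0 (hp.lt i hi).le _ h1)
  · have := hV.drift _ h0 _ h1
    have h2 := (V (p.2 i)).smul_mem ((p.2 (i + 1) - p.2 i : ℝ) : ℂ) this
    rw [Complex.coe_smul] at h2
    exact hV.mono (hp.mem_Icc hi.le).2 h2

theorem norm_sdeIntegral_le {x : ℝ → (H →L[ℂ] H)} (hx : IsProcess V x) {a b M : ℝ} (ha : 0 ≤ a)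
    (hab : a ≤ b) (hM : ∀ s ∈ Icc a b, ‖x s‖ ≤ M) :
    ‖sdeIntegral D K x a b‖ ≤ M * (√(‖Q‖ * (b - a)) + ‖K‖ * (b - a)) := by
  have := mesh_neBot hab
  refine le_of_tendsto (tendsto_sdeIntegral hD hV hx ha hab).norm ?_
  filter_upwards [eventually_mesh one_pos] with p hp
  exact hD.norm_intervalSum_incr_le_const K ha hab hp
    (fun s hs => hV.range s (ha.trans hs.1) _ (hx.2 s (ha.trans hs.1))) hM

/-- The integral operator halves the exponentially weighted norm. -/
theorem norm_sdeIntegral_le_exp {x : ℝ → (H →L[ℂ] H)} (hx : IsProcess V x) {a b M : ℝ} (ha : 0 ≤ a)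
    (hab : a ≤ b) (hM : ∀ s ∈ Icc a b, ‖x s‖ ≤ M * Real.exp (rate Q K * s)) :
    ‖sdeIntegral D K x a b‖ ≤ M / 2 * Real.exp (rate Q K * b) := by
  have := mesh_neBot hab
  refine le_of_tendsto (tendsto_sdeIntegral hD hV hx ha hab).norm ?_
  filter_upwards [eventually_mesh one_pos] with p hp
  exact hD.norm_intervalSum_incr_le_exp K ha hab hp
    (fun s hs => hV.range s (ha.trans hs.1) _ (hx.2 s (ha.trans hs.1))) hM

theorem sdeIntegral_add {x : ℝ → (H →L[ℂ] H)} (hx : IsProcess V x) {a b c : ℝ} (ha : 0 ≤ a)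
    (hab : a ≤ b) (hbc : b ≤ c) :
    sdeIntegral D K x a c = sdeIntegral D K x a b + sdeIntegral D K x b c :=
  tendsto_intervalSum_add hab hbc (tendsto_sdeIntegral hD hV hx ha hab)
    (tendsto_sdeIntegral hD hV hx (ha.trans hab) hbc)
    (tendsto_sdeIntegral hD hV hx ha (hab.trans hbc))

theorem sdeIntegral_sub {x y : ℝ → (H →L[ℂ] H)} (hx : IsProcess V x) (hy : IsProcess V y) {a b : ℝ}
    (ha : 0 ≤ a) (hab : a ≤ b) :
    sdeIntegral D K (fun t => x t - y t) a b = sdeIntegral D K x a b - sdeIntegral D K y a b := by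
  have := mesh_neBot hab
  refine tendsto_nhds_unique (tendsto_sdeIntegral hD hV (hx.sub hy) ha hab)
    (((tendsto_sdeIntegral hD hV hx ha hab).sub (tendsto_sdeIntegral hD hV hy ha hab)).congr
      fun p => ?_)
  rw [← intervalSum_sub]
  exact Finset.sum_congr rfl fun i _ => (incr_sub D K x y _ _).symm

theorem isProcess_sdeIntegral {x : ℝ → (H →L[ℂ] H)} (hx : IsProcess V x) :
    IsProcess V (sdeIntegral D K x 0) := by
  refine ⟨fun t₀ ht₀ => ?_, fun t ht => sdeIntegral_mem hD hV hx ht⟩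
  have ht₀ : 0 ≤ t₀ := ht₀
  obtain ⟨M, hM⟩ := isCompact_Icc.exists_bound_of_continuousOn
    (hx.1.mono (fun s (hs : s ∈ Icc 0 (t₀ + 1)) => hs.1))
  have key : ∀ s ∈ Icc 0 (t₀ + 1), ∀ t ∈ Icc 0 (t₀ + 1), s ≤ t →
      ‖sdeIntegral D K x 0 t - sdeIntegral D K x 0 s‖
        ≤ M * (√(‖Q‖ * |t - s|) + ‖K‖ * |t - s|) := by
    intro s hs t ht hst
    rw [sdeIntegral_add hD hV hx le_rfl hs.1 hst, add_sub_cancel_left,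
      abs_of_nonneg (sub_nonneg.2 hst)]
    exact norm_sdeIntegral_le hD hV hx hs.1 hst fun r hr => hM r ⟨hs.1.trans hr.1, hr.2.trans ht.2⟩
  refine tendsto_iff_norm_sub_tendsto_zero.2 ?_
  refine squeeze_zero' (g := fun t => M * (√(‖Q‖ * |t - t₀|) + ‖K‖ * |t - t₀|))
    (Eventually.of_forall fun t => norm_nonneg _) ?_ ?_
  · have : Iio (t₀ + 1) ∈ 𝓝[Ici 0] t₀ :=
      mem_nhdsWithin_of_mem_nhds (Iio_mem_nhds (by linarith))
    filter_upwards [this, self_mem_nhdsWithin] with t h1 h2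
    have h0 : t₀ ∈ Icc 0 (t₀ + 1) := ⟨ht₀, by linarith⟩
    have h3 : t ∈ Icc 0 (t₀ + 1) := ⟨h2, le_of_lt h1⟩
    rcases le_total t t₀ with h | h
    · rw [norm_sub_rev, abs_sub_comm]; exact key t h3 t₀ h0 h
    · exact key t₀ h0 t h3 h
  · have hcont : Continuous fun t => M * (√(‖Q‖ * |t - t₀|) + ‖K‖ * |t - t₀|) := by fun_prop
    have := hcont.tendsto t₀
    simp only [sub_self, abs_zero, mul_zero, Real.sqrt_zero, add_zero] at this
    exact this.mono_left nhdsWithin_le_nhds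

/-- Existence of a norm continuous adapted solution by Picard iteration. -/
theorem exists_sde_solution {x₀ : H →L[ℂ] H} (hx₀ : x₀ ∈ V 0) :
    ∃ u : ℝ → (H →L[ℂ] H), IsProcess V u ∧
      ∀ t, 0 ≤ t → u t = x₀ + sdeIntegral D K u 0 t := by
  have hconst : IsProcess V fun _ => x₀ := ⟨continuousOn_const, fun t ht => hV.mono ht hx₀⟩
  have hstep : ∀ x, IsProcess V x → IsProcess V fun t => x₀ + sdeIntegral D K x 0 t := by
    intro x hx
    have h := isProcess_sdeIntegral hD hV hx
    exact ⟨hconst.1.add h.1, fun t ht => add_mem (hconst.2 t ht) (h.2 t ht)⟩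
  let X : ℕ → ℝ → (H →L[ℂ] H) := fun n =>
    Nat.rec (fun _ => x₀) (fun _ x t => x₀ + sdeIntegral D K x 0 t) n
  have hX : ∀ n, IsProcess V (X n) := by
    intro n
    induction n with
    | zero => exact hconst
    | succ n ih => exact hstep _ ih
  set l := rate Q K with hl
  have hl0 : 0 < l := rate_pos Q K
  have hdiff : ∀ n t, 0 ≤ t → ‖X n t - X (n + 1) t‖ ≤ ‖x₀‖ / 2 / 2 ^ n * Real.exp (l * t) := by
    intro n
    induction n with
    | zero =>
      intro t ht
      have e : X 0 t - X 1 t = -sdeIntegral D K (fun _ => x₀) 0 t := by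
        change x₀ - (x₀ + _) = _; abel
      rw [zero_add, e, norm_neg, pow_zero, div_one]
      refine norm_sdeIntegral_le_exp hD hV hconst le_rfl ht fun s hs => ?_
      exact le_mul_of_one_le_right (norm_nonneg _) (Real.one_le_exp (mul_nonneg hl0.le hs.1))
    | succ n ih =>
      intro t ht
      have e : X (n + 1) t - X (n + 1 + 1) t
          = sdeIntegral D K (fun t => X n t - X (n + 1) t) 0 t := by
        rw [sdeIntegral_sub hD hV (hX n) (hX (n + 1)) le_rfl ht]
        exact add_sub_add_left_eq_sub _ _ _
      rw [e]
      refine (norm_sdeIntegral_le_exp hD hV ((hX n).sub (hX (n + 1))) le_rfl ht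
        fun s hs => ih s hs.1).trans_eq ?_
      rw [pow_succ, ← hl]; ring
  have hdist : ∀ t, 0 ≤ t → ∀ n, dist (X n t) (X (n + 1) t)
      ≤ ‖x₀‖ * Real.exp (l * t) / 2 / 2 ^ n := by
    intro t ht n
    rw [dist_eq_norm]
    refine (hdiff n t ht).trans_eq (by ring)
  have hex : ∀ t, ∃ y, 0 ≤ t → Tendsto (fun n => X n t) atTop (𝓝 y) := by
    intro t
    by_cases ht : 0 ≤ t
    · obtain ⟨y, hy⟩ := cauchySeq_tendsto_of_complete (cauchySeq_of_le_geometric_two (hdist t ht))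
      exact ⟨y, fun _ => hy⟩
    · exact ⟨0, fun h => absurd h ht⟩
  choose u hu using hex
  have hrate : ∀ t, 0 ≤ t → ∀ n, dist (X n t) (u t) ≤ ‖x₀‖ * Real.exp (l * t) / 2 ^ n :=
    fun t ht n => dist_le_of_le_geometric_two_of_tendsto (hdist t ht) (hu t ht) n
  have hcont : ContinuousOn u (Ici 0) := by
    intro t₀ ht₀
    have ht₀ : 0 ≤ t₀ := ht₀
    have hunif : TendstoUniformlyOn X u atTop (Icc 0 (t₀ + 1)) := by
      rw [Metric.tendstoUniformlyOn_iff]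
      intro ε hε
      have := tendsto_div_two_pow (‖x₀‖ * Real.exp (l * (t₀ + 1)))
      filter_upwards [this.eventually (gt_mem_nhds hε)] with n hn t ht
      rw [dist_comm]
      refine (hrate t ht.1 n).trans_lt (lt_of_le_of_lt ?_ hn)
      have : l * t ≤ l * (t₀ + 1) := mul_le_mul_of_nonneg_left ht.2 hl0.le
      gcongr
    have h1 : ContinuousOn u (Icc 0 (t₀ + 1)) :=
      hunif.continuousOn (Frequently.of_forall fun n => (hX n).1.mono fun s hs => hs.1)
    refine (h1 t₀ ⟨ht₀, by linarith⟩).mono_of_mem_nhdsWithin ?_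
    have : Iio (t₀ + 1) ∈ 𝓝[Ici 0] t₀ :=
      mem_nhdsWithin_of_mem_nhds (Iio_mem_nhds (by linarith))
    filter_upwards [this, self_mem_nhdsWithin] with t h1 h2
    exact ⟨h2, le_of_lt h1⟩
  have huP : IsProcess V u := ⟨hcont, fun t ht =>
    (hV.isClosed t).mem_of_tendsto (hu t ht) (Eventually.of_forall fun n => (hX n).2 t ht)⟩
  refine ⟨u, huP, fun t ht => ?_⟩
  refine tendsto_nhds_unique ((tendsto_add_atTop_iff_nat 1).2 (hu t ht)) ?_
  refine tendsto_iff_norm_sub_tendsto_zero.2 ?_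
  refine squeeze_zero (g := fun n : ℕ => ‖x₀‖ / 2 ^ n / 2 * Real.exp (l * t))
    (fun n => norm_nonneg _) (fun n => ?_) ?_
  · have e : X (n + 1) t - (x₀ + sdeIntegral D K u 0 t)
        = sdeIntegral D K (fun t => X n t - u t) 0 t := by
      rw [sdeIntegral_sub hD hV (hX n) huP le_rfl ht]
      exact add_sub_add_left_eq_sub _ _ _
    rw [e]
    refine norm_sdeIntegral_le_exp hD hV ((hX n).sub huP) le_rfl ht fun s hs => ?_
    rw [← dist_eq_norm]
    refine (hrate s hs.1 n).trans_eq (by ring)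
  · have := (((tendsto_div_two_pow ‖x₀‖).div_const 2).mul_const
      (Real.exp (l * t)))
    simpa using this

end

/-- A bounded process that solves the homogeneous equation along partitions vanishes. -/
theorem eq_zero_of_tendsto_incr (hD : OrthogonalNoise F D Q) {w : ℝ → (H →L[ℂ] H)} {T M₀ : ℝ}
    (hw : ∀ s ∈ Icc 0 T, ∀ ξ, w s ξ ∈ F s) (hb : ∀ s ∈ Icc 0 T, ‖w s‖ ≤ M₀)
    (h : ∀ s ∈ Icc 0 T, Tendsto (intervalSum (incr D K w)) (mesh 0 s) (𝓝 (w s))) :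
    ∀ s ∈ Icc 0 T, w s = 0 := by
  refine eq_zero_of_halving (rate_pos Q K) hb fun M hM hMb s hs => ?_
  have := mesh_neBot hs.1
  refine le_of_tendsto (h s hs).norm ?_
  filter_upwards [eventually_mesh one_pos] with p hp
  exact hD.norm_intervalSum_incr_le_exp K le_rfl hs.1 hp
    (fun r hr => hw r ⟨hr.1, hr.2.trans hs.2⟩) fun r hr => hMb r ⟨hr.1, hr.2.trans hs.2⟩

end Noise

/-! ### Strong closures -/

section strong

variable {H : Type*} [NormedAddCommGroup H] [InnerProductSpace ℂ H]

theorem mem_of_mem_stopClosure {X : Set (H →L[ℂ] H)} {C : Set (H → H)} (hC : IsClosed C)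
    (h : ∀ x ∈ X, (x : H → H) ∈ C) {x : H →L[ℂ] H} (hx : x ∈ stopClosure X) : (x : H → H) ∈ C :=
  closure_minimal (by rintro _ ⟨y, hy, rfl⟩; exact h y hy) hC hx

theorem subset_stopClosure (X : Set (H →L[ℂ] H)) : X ⊆ stopClosure X :=
  fun _ hx => subset_closure (mem_image_of_mem _ hx)

theorem stopClosure_mono {X Y : Set (H →L[ℂ] H)} (h : X ⊆ Y) : stopClosure X ⊆ stopClosure Y :=
  fun _ hx => closure_mono (image_mono h) hx

theorem mem_stopClosure_of_tendsto {X : Set (H →L[ℂ] H)} {ι : Type*} {l : Filter ι} [l.NeBot]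
    {y : ι → (H →L[ℂ] H)} (hy : ∀ i, y i ∈ stopClosure X) {x : H →L[ℂ] H}
    (h : ∀ ξ, Tendsto (fun i => y i ξ) l (𝓝 (x ξ))) : x ∈ stopClosure X :=
  isClosed_closure.mem_of_tendsto (tendsto_pi_nhds.2 h) (Eventually.of_forall hy)

theorem mul_left_mem_stopClosure {X Y : Set (H →L[ℂ] H)} {w : H →L[ℂ] H}
    (h : ∀ x ∈ X, w * x ∈ stopClosure Y) {x : H →L[ℂ] H} (hx : x ∈ stopClosure X) :
    w * x ∈ stopClosure Y := by
  have hC : IsClosed ((fun f : H → H => fun ξ => w (f ξ)) ⁻¹'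
      closure ((fun y : H →L[ℂ] H => (y : H → H)) '' Y)) :=
    isClosed_closure.preimage (by fun_prop)
  exact mem_of_mem_stopClosure hC h hx

theorem mul_right_mem_stopClosure {X Y : Set (H →L[ℂ] H)} {w : H →L[ℂ] H}
    (h : ∀ x ∈ X, x * w ∈ stopClosure Y) {x : H →L[ℂ] H} (hx : x ∈ stopClosure X) :
    x * w ∈ stopClosure Y := by
  have hC : IsClosed ((fun f : H → H => fun ξ => f (w ξ)) ⁻¹'
      closure ((fun y : H →L[ℂ] H => (y : H → H)) '' Y)) :=
    isClosed_closure.preimage (by fun_prop)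
  exact mem_of_mem_stopClosure hC h hx

theorem exists_bound_of_tendsto [CompleteSpace H] {x : ℕ → (H →L[ℂ] H)} {y : H → H}
    (h : ∀ ξ, Tendsto (fun n => x n ξ) atTop (𝓝 (y ξ))) : ∃ C, ∀ n, ‖x n‖ ≤ C := by
  refine banach_steinhaus fun ξ => ?_
  obtain ⟨C, hC⟩ := (h ξ).norm.bddAbove_range
  exact ⟨C, fun n => hC ⟨n, rfl⟩⟩

theorem tendsto_zero_of_dense {E E' : Type*} [NormedAddCommGroup E] [NormedSpace ℂ E]
    [NormedAddCommGroup E'] [NormedSpace ℂ E'] {ι : Type*} {l : Filter ι} {f : ι → E →L[ℂ] E'}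
    {C : ℝ} (hC : ∀ i, ‖f i‖ ≤ C) {s : Set E} (hs : Dense s)
    (h : ∀ y ∈ s, Tendsto (fun i => f i y) l (𝓝 0)) (y : E) :
    Tendsto (fun i => f i y) l (𝓝 0) := by
  rw [Metric.tendsto_nhds]
  intro ε hε
  obtain ⟨z, hz, hyz⟩ := Metric.dense_iff.1 hs y (ε / (2 * (|C| + 1))) (by positivity)
  filter_upwards [Metric.tendsto_nhds.1 (h z hyz) (ε / 2) (by positivity)] with i hi
  rw [dist_zero_right] at hi ⊢
  have h1 : ‖f i (y - z)‖ ≤ (|C| + 1) * (ε / (2 * (|C| + 1))) := by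
    refine ((f i).le_opNorm _).trans ?_
    have h2 : ‖y - z‖ ≤ ε / (2 * (|C| + 1)) := by
      rw [← dist_eq_norm, dist_comm]; exact (Metric.mem_ball.1 hz).le
    have h3 : ‖f i‖ ≤ |C| + 1 := (hC i).trans ((le_abs_self C).trans (by linarith))
    gcongr
  have h4 : (|C| + 1) * (ε / (2 * (|C| + 1))) = ε / 2 := by field_simp
  calc ‖f i y‖ = ‖f i (y - z) + f i z‖ := by rw [← map_add, sub_add_cancel]
    _ ≤ _ := norm_add_le _ _
    _ < ε := by linarith

end strong

/-- The square root of `V⋆ V`, with its commutation properties. -/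
theorem exists_sqrt {E F : Type*} [NormedAddCommGroup E] [InnerProductSpace ℂ E] [CompleteSpace E]
    [NormedAddCommGroup F] [InnerProductSpace ℂ F] [CompleteSpace F] (V : E →L[ℂ] F) :
    ∃ W : E →L[ℂ] E, (∀ ξ η, ⟪W ξ, W η⟫_ℂ = ⟪V ξ, V η⟫_ℂ) ∧ (∀ ξ η, ⟪W ξ, η⟫_ℂ = ⟪ξ, W η⟫_ℂ) ∧
      ∀ X : E →L[ℂ] E, Commute (ContinuousLinearMap.adjoint V ∘L V) X → X * W = W * X := by
  set T : E →L[ℂ] E := ContinuousLinearMap.adjoint V ∘L V with hT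
  have hT0 : 0 ≤ T := by
    rw [ContinuousLinearMap.nonneg_iff_isPositive]
    exact ContinuousLinearMap.isPositive_adjoint_comp_self V
  have hTin : ∀ ξ η, ⟪ξ, T η⟫_ℂ = ⟪V ξ, V η⟫_ℂ := fun ξ η => by
    rw [hT, ContinuousLinearMap.comp_apply, ContinuousLinearMap.adjoint_inner_right]
  have hsa : IsSelfAdjoint (CFC.sqrt T) := (CFC.sqrt_nonneg T).isSelfAdjoint
  have hW : ∀ ξ η, ⟪CFC.sqrt T ξ, η⟫_ℂ = ⟪ξ, CFC.sqrt T η⟫_ℂ := by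
    intro ξ η
    have := ContinuousLinearMap.adjoint_inner_right (CFC.sqrt T) ξ η
    rw [← this, ← ContinuousLinearMap.star_eq_adjoint, hsa.star_eq]
  refine ⟨CFC.sqrt T, fun ξ η => ?_, hW, fun X hX => (hX.cfcₙ_nnreal NNReal.sqrt).symm⟩
  rw [hW, ← hTin]
  exact congrArg _ (DFunLike.congr_fun (CFC.sqrt_mul_sqrt_self T hT0) η)

theorem mul_app {H : Type*} [NormedAddCommGroup H] [InnerProductSpace ℂ H] (a b : H →L[ℂ] H)
    (ξ : H) : (a * b) ξ = a (b ξ) := rfl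

namespace ContinuousBernoulliShift

variable {H : Type*} [NormedAddCommGroup H] [InnerProductSpace ℂ H] [CompleteSpace H]
variable (B : ContinuousBernoulliShift H)

/-! ### Cyclic subspaces -/

/-- The closure of `N Ω`. -/
def orb (N : VonNeumannAlgebra H) : Submodule ℂ H :=
  (LinearMap.range (orbitMap N B.Ω)).topologicalClosure

/-- The orthogonal projection onto the closure of `N Ω`. -/
def proj (N : VonNeumannAlgebra H) : H →L[ℂ] H :=
  (LinearMap.range (orbitMap N B.Ω)).topologicalClosure.starProjection

variable {B} {N : VonNeumannAlgebra H}

theorem isClosed_orb (N : VonNeumannAlgebra H) : IsClosed (B.orb N : Set H) :=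
  Submodule.isClosed_topologicalClosure _

theorem apply_Ω_mem_orb {a : H →L[ℂ] H} (ha : a ∈ N) : a B.Ω ∈ B.orb N :=
  Submodule.le_topologicalClosure _ ⟨⟨a, ha⟩, rfl⟩

theorem orb_le {W : Submodule ℂ H} (hW : IsClosed (W : Set H)) (h : ∀ a ∈ N, a B.Ω ∈ W) :
    B.orb N ≤ W := by
  refine Submodule.topologicalClosure_minimal _ ?_ hW
  rintro _ ⟨a, rfl⟩
  exact h a a.2

theorem orb_mono {M N : VonNeumannAlgebra H} (h : M ≤ N) : B.orb M ≤ B.orb N :=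
  orb_le (isClosed_orb N) fun _ ha => apply_Ω_mem_orb (h ha)

theorem apply_mem_orb {a : H →L[ℂ] H} (ha : a ∈ N) {ξ : H} (hξ : ξ ∈ B.orb N) :
    a ξ ∈ B.orb N := by
  have : B.orb N ≤ (B.orb N).comap (a : H →ₗ[ℂ] H) :=
    orb_le ((isClosed_orb N).preimage a.continuous) fun b hb =>
      apply_Ω_mem_orb (a := a * b) (mul_mem ha hb)
  exact this hξ

theorem Ω_mem_orb : B.Ω ∈ B.orb N := apply_Ω_mem_orb (a := 1) (one_mem N)

theorem proj_eq_self_iff {ξ : H} : B.proj N ξ = ξ ↔ ξ ∈ B.orb N :=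
  Submodule.starProjection_eq_self_iff

theorem proj_apply_mem (ξ : H) : B.proj N ξ ∈ B.orb N :=
  Submodule.starProjection_apply_mem (LinearMap.range (orbitMap N B.Ω)).topologicalClosure ξ

theorem star_proj : star (B.proj N) = B.proj N :=
  isStarProjection_starProjection.isSelfAdjoint

theorem inner_proj_left (ξ η : H) : ⟪B.proj N ξ, η⟫_ℂ = ⟪ξ, B.proj N η⟫_ℂ := by
  rw [← ContinuousLinearMap.adjoint_inner_right, ← ContinuousLinearMap.star_eq_adjoint, star_proj]

theorem proj_mul_proj : B.proj N * B.proj N = B.proj N :=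
  ContinuousLinearMap.ext fun ξ => proj_eq_self_iff.2 (proj_apply_mem ξ)

theorem mul_proj_comm {a : H →L[ℂ] H} (ha : a ∈ N) : a * B.proj N = B.proj N * a := by
  have h : ∀ b ∈ N, B.proj N * (b * B.proj N) = b * B.proj N := fun b hb =>
    ContinuousLinearMap.ext fun ξ => proj_eq_self_iff.2 (apply_mem_orb hb (proj_apply_mem ξ))
  have h1 := h a ha
  have h2 := congrArg star (h (star a) (star_mem ha))
  simp only [star_mul, star_star, star_proj] at h2
  rw [← h1, ← mul_assoc, h2]

theorem proj_mem_commutant : B.proj N ∈ N.commutant :=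
  VonNeumannAlgebra.mem_commutant_iff.2 fun _ ha => mul_proj_comm ha

theorem proj_Ω : B.proj N B.Ω = B.Ω := proj_eq_self_iff.2 Ω_mem_orb

variable (B) in
theorem e₀_eq : B.e₀ = B.proj B.A₀ := rfl

theorem eq_zero_of_apply_Ω {a : H →L[ℂ] H} (ha : a ∈ B.A) (h : a B.Ω = 0) : a = 0 := by
  have : (⟨a, ha⟩ : B.A.toStarSubalgebra) = 0 := B.separating (by
    rw [map_zero]; exact h)
  exact congrArg Subtype.val this

/-- `Ω` is cyclic for the commutant of `A₀`, as it separates `A₀`. -/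
theorem orb_commutant : B.orb B.A₀.commutant = ⊤ := by
  have h1 : B.proj B.A₀.commutant ∈ B.A₀ := by
    have := proj_mem_commutant (B := B) (N := B.A₀.commutant)
    rwa [VonNeumannAlgebra.commutant_commutant] at this
  -- `1 - proj` belongs to `A₀` and annihilates the separating vector.
  have h2 : (1 : H →L[ℂ] H) - B.proj B.A₀.commutant = 0 := by
    refine eq_zero_of_apply_Ω (sub_mem (one_mem _) (B.A₀_le h1)) ?_
    rw [sub_apply, proj_Ω]; simp
  refine eq_top_iff.2 fun ξ _ => proj_eq_self_iff.1 ?_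
  rw [← sub_eq_zero.1 h2]; rfl

theorem denseRange_commutant : DenseRange (orbitMap B.A₀.commutant B.Ω) := by
  have h := orb_commutant (B := B)
  intro ξ
  have hξ : ξ ∈ B.orb B.A₀.commutant := by rw [h]; trivial
  exact hξ

theorem dense_commutant :
    Dense ((fun r : H →L[ℂ] H => r B.Ω) '' (B.A₀.commutant : Set (H →L[ℂ] H))) := by
  refine Dense.mono ?_ (denseRange_commutant (B := B))
  rintro _ ⟨r, rfl⟩
  exact ⟨r, r.2, rfl⟩

theorem ext_commutant {a b : H →L[ℂ] H} (h : ∀ r ∈ B.A₀.commutant, a (r B.Ω) = b (r B.Ω)) :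
    a = b :=
  ContinuousLinearMap.ext fun ξ => congrFun
    ((denseRange_commutant (B := B)).equalizer a.continuous b.continuous
      (funext fun r => h r r.2)) ξ

theorem commutant_comm {a r : H →L[ℂ] H} (ha : a ∈ B.A₀) (hr : r ∈ B.A₀.commutant) (ξ : H) :
    a (r ξ) = r (a ξ) :=
  DFunLike.congr_fun (VonNeumannAlgebra.mem_commutant_iff.1 hr a ha) ξ

theorem e₀_comm {a : H →L[ℂ] H} (ha : a ∈ B.A₀) : a * B.e₀ = B.e₀ * a := mul_proj_comm ha

theorem e₀_comm_apply {a : H →L[ℂ] H} (ha : a ∈ B.A₀) (ξ : H) : a (B.e₀ ξ) = B.e₀ (a ξ) :=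
  DFunLike.congr_fun (e₀_comm ha) ξ

theorem e₀_mul_e₀ : B.e₀ * B.e₀ = B.e₀ := proj_mul_proj

theorem e₀_e₀ (ξ : H) : B.e₀ (B.e₀ ξ) = B.e₀ ξ := DFunLike.congr_fun e₀_mul_e₀ ξ

theorem star_e₀ : star B.e₀ = B.e₀ := star_proj

theorem e₀_Ω : B.e₀ B.Ω = B.Ω := proj_Ω

theorem inner_e₀_left (ξ η : H) : ⟪B.e₀ ξ, η⟫_ℂ = ⟪ξ, B.e₀ η⟫_ℂ := inner_proj_left ξ η

theorem ext_A₀ {a b : H →L[ℂ] H} (ha : a ∈ B.A₀) (hb : b ∈ B.A₀)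
    (h : a * B.e₀ = b * B.e₀) : a = b := by
  refine sub_eq_zero.1 (eq_zero_of_apply_Ω (B.A₀_le (sub_mem ha hb)) ?_)
  have := DFunLike.congr_fun h B.Ω
  simp only [mul_app, e₀_Ω] at this
  rw [sub_apply, this, sub_self]

theorem inner_star (a : H →L[ℂ] H) (ξ η : H) : ⟪star a ξ, η⟫_ℂ = ⟪ξ, a η⟫_ℂ :=
  ContinuousLinearMap.adjoint_inner_left a η ξ

theorem inner_star_right (a : H →L[ℂ] H) (ξ η : H) : ⟪ξ, star a η⟫_ℂ = ⟪a ξ, η⟫_ℂ :=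
  ContinuousLinearMap.adjoint_inner_right a ξ η

/-! ### The reduced algebra `A₀ e₀` -/

variable (B) in
/-- The operators `z = e₀ z e₀` that commute with the compression of the commutant of `A₀` by
`e₀`. By the theorem on reduced von Neumann algebras they are the elements of `A₀ e₀`. -/
structure IsReduced (z : H →L[ℂ] H) : Prop where
  right : z * B.e₀ = z
  left : B.e₀ * z = z
  comm : ∀ r ∈ B.A₀.commutant, z * (B.e₀ * r * B.e₀) = B.e₀ * r * B.e₀ * z

/-- The square root of `e₀ r⋆ r e₀` commutes with `z`, and its norm at vectors of `e₀ H` is that of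
`r`. -/
theorem IsReduced.norm_apply_le {z : H →L[ℂ] H} (hz : B.IsReduced z) {r : H →L[ℂ] H}
    (hr : r ∈ B.A₀.commutant) : ‖r (z B.Ω)‖ ≤ ‖z‖ * ‖r B.Ω‖ := by
  obtain ⟨W, hW, -, hWc⟩ := exists_sqrt (r * B.e₀)
  have hnorm : ∀ ξ, ‖W ξ‖ = ‖r (B.e₀ ξ)‖ := by
    intro ξ
    have := hW ξ ξ
    rw [inner_self_eq_norm_sq_to_K, inner_self_eq_norm_sq_to_K] at this
    have h2 : ‖W ξ‖ ^ 2 = ‖(r * B.e₀) ξ‖ ^ 2 := by exact_mod_cast this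
    exact (sq_eq_sq₀ (norm_nonneg _) (norm_nonneg _)).1 h2
  have hcz : z * W = W * z := by
    refine hWc z ?_
    have h1 := hz.comm _ (mul_mem (star_mem hr) hr)
    have e : B.e₀ * (star r * r) * B.e₀ = star (r * B.e₀) * (r * B.e₀) := by
      rw [star_mul, star_e₀]; simp only [mul_assoc]
    rw [e] at h1
    exact h1.symm
  have hΩ : W (z B.Ω) = z (W B.Ω) := (DFunLike.congr_fun hcz B.Ω).symm
  have h1 : B.e₀ (z B.Ω) = z B.Ω := DFunLike.congr_fun hz.left B.Ω
  calc ‖r (z B.Ω)‖ = ‖W (z B.Ω)‖ := by rw [hnorm, h1]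
    _ = ‖z (W B.Ω)‖ := by rw [hΩ]
    _ ≤ ‖z‖ * ‖W B.Ω‖ := z.le_opNorm _
    _ = _ := by rw [hnorm, e₀_Ω]

/-- The lift of `z` is the operator `r Ω ↦ r (z Ω)`, for `r` in the commutant of `A₀`; it is bounded
by `IsReduced.norm_apply_le`, and it commutes with the commutant. -/
theorem IsReduced.exists_lift {z : H →L[ℂ] H} (hz : B.IsReduced z) :
    ∃ a ∈ B.A₀, a * B.e₀ = z := by
  set f : B.A₀.commutant.toStarSubalgebra →ₗ[ℂ] H := orbitMap B.A₀.commutant (z B.Ω) with hf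
  set a := f.extendOfNorm (orbitMap B.A₀.commutant B.Ω) with ha
  have hap : ∀ r ∈ B.A₀.commutant, a (r B.Ω) = r (z B.Ω) := fun r hr =>
    LinearMap.extendOfNorm_eq denseRange_commutant ⟨‖z‖, fun s => hz.norm_apply_le s.2⟩ ⟨r, hr⟩
  have hmem : a ∈ B.A₀ := by
    rw [← VonNeumannAlgebra.commutant_commutant B.A₀, VonNeumannAlgebra.mem_commutant_iff]
    intro s hs
    refine ext_commutant (B := B) fun r hr => ?_
    change s (a (r B.Ω)) = a (s (r B.Ω))
    rw [hap r hr]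
    exact (hap (s * r) (mul_mem hs hr)).symm
  refine ⟨a, hmem, ext_commutant (B := B) fun r hr => ?_⟩
  change a (B.e₀ (r B.Ω)) = z (r B.Ω)
  have h1 : B.e₀ (z B.Ω) = z B.Ω := DFunLike.congr_fun hz.left B.Ω
  have h2 := DFunLike.congr_fun (hz.comm r hr) B.Ω
  simp only [mul_app, e₀_Ω, h1] at h2
  rw [e₀_comm_apply hmem, hap r hr, ← h2]
  exact DFunLike.congr_fun hz.right _

theorem isReduced_mul_e₀ {a : H →L[ℂ] H} (ha : a ∈ B.A₀) : B.IsReduced (a * B.e₀) where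
  right := by rw [mul_assoc, e₀_mul_e₀]
  left := by rw [← mul_assoc, ← e₀_comm ha, mul_assoc, e₀_mul_e₀]
  comm := fun r hr => by
    have h := VonNeumannAlgebra.mem_commutant_iff.1 hr a ha
    calc a * B.e₀ * (B.e₀ * r * B.e₀) = a * (B.e₀ * B.e₀) * r * B.e₀ := by simp only [mul_assoc]
      _ = (a * B.e₀) * r * B.e₀ := by rw [e₀_mul_e₀]
      _ = B.e₀ * (a * r) * B.e₀ := by rw [e₀_comm ha]; simp only [mul_assoc]
      _ = B.e₀ * r * (a * B.e₀) := by rw [h]; simp only [mul_assoc]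
      _ = B.e₀ * r * (B.e₀ * (a * B.e₀)) := by
        rw [← mul_assoc B.e₀ a, ← e₀_comm ha, mul_assoc a, e₀_mul_e₀]
      _ = _ := by simp only [mul_assoc]

/-- The compression `a ↦ a e₀` of `A₀` is isometric. -/
theorem norm_mul_e₀ {a : H →L[ℂ] H} (ha : a ∈ B.A₀) : ‖a * B.e₀‖ = ‖a‖ := by
  apply le_antisymm
  · refine (norm_mul_le _ _).trans (mul_le_of_le_one_right (norm_nonneg _) ?_)
    exact Submodule.starProjection_norm_le _
  · refine ContinuousLinearMap.opNorm_le_bound _ (norm_nonneg _) fun ξ => ?_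
    have hc : IsClosed {ξ : H | ‖a ξ‖ ≤ ‖a * B.e₀‖ * ‖ξ‖} :=
      isClosed_le (by fun_prop) (by fun_prop)
    refine closure_minimal ?_ hc (dense_commutant (B := B) ξ)
    rintro _ ⟨r, hr, rfl⟩
    have := (isReduced_mul_e₀ ha).norm_apply_le hr
    simp only [mul_app, e₀_Ω] at this
    change ‖a (r B.Ω)‖ ≤ _
    rwa [commutant_comm ha hr]

/-- On bounded families in `A₀`, convergence at `Ω` in the weak topology implies convergence in the
weak operator topology, as `Ω` is cyclic for the commutant. -/
theorem tendsto_inner_of_tendsto_Ω {ι : Type*} {l : Filter ι} {a : ι → (H →L[ℂ] H)}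
    {b : H →L[ℂ] H} {C : ℝ} (ha : ∀ i, a i ∈ B.A₀) (hb : b ∈ B.A₀) (hC : ∀ i, ‖a i‖ ≤ C)
    (h : ∀ η, Tendsto (fun i => ⟪η, a i B.Ω⟫_ℂ) l (𝓝 ⟪η, b B.Ω⟫_ℂ)) (ξ η : H) :
    Tendsto (fun i => ⟪ξ, a i η⟫_ℂ) l (𝓝 ⟪ξ, b η⟫_ℂ) := by
  have key := tendsto_zero_of_dense (l := l) (f := fun i => innerSL ℂ ξ ∘L (a i - b))
    (C := ‖ξ‖ * (C + ‖b‖)) (fun i => ?_) (dense_commutant (B := B)) ?_ η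
  · have := key.add_const ⟪ξ, b η⟫_ℂ
    rw [zero_add] at this
    refine this.congr fun i => ?_
    simp
  · refine (ContinuousLinearMap.opNorm_comp_le _ _).trans ?_
    rw [innerSL_apply_norm]
    have h1 : ‖a i - b‖ ≤ C + ‖b‖ := (norm_sub_le _ _).trans (add_le_add_left (hC i) _)
    gcongr
  · rintro _ ⟨r, hr, rfl⟩
    have h1 := (h (star r ξ)).sub_const ⟪star r ξ, b B.Ω⟫_ℂ
    rw [sub_self] at h1
    refine h1.congr fun i => ?_
    change _ = ⟪ξ, (a i - b) (r B.Ω)⟫_ℂ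
    rw [sub_apply, commutant_comm (ha i) hr, commutant_comm hb hr, inner_sub_right,
      inner_star, inner_star]

/-! ### Positivity of matrices over `A₀` -/

/-- The inclusion of the `j`-th summand of `Hⁿ`. -/
def inclL {n : ℕ} (j : Fin n) : H →L[ℂ] (PiLp 2 fun _ : Fin n => H) :=
  ContinuousLinearMap.adjoint (PiLp.proj 2 (fun _ : Fin n => H) j)

theorem inclL_apply {n : ℕ} (i j : Fin n) (x : H) : inclL j x i = if i = j then x else 0 := by
  have hs : inclL j x = PiLp.single 2 (β := fun _ : Fin n => H) j x := by
    refine ext_inner_right ℂ fun y => ?_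
    have h1 : ⟪inclL j x, y⟫_ℂ = ⟪x, y j⟫_ℂ := ContinuousLinearMap.adjoint_inner_left _ _ _
    rw [h1, PiLp.inner_apply, Finset.sum_eq_single j]
    · rw [PiLp.single_eq_same]
    · intro i _ hi
      rw [PiLp.single_eq_of_ne 2 hi, inner_zero_left]
    · simp
  rw [hs]
  split_ifs with hij
  · subst hij; exact PiLp.single_eq_same 2 (β := fun _ : Fin n => H) i x
  · exact PiLp.single_eq_of_ne 2 (β := fun _ : Fin n => H) hij x

/-- The operator on `Hⁿ` that acts by `a` on every summand. -/
def diagL (n : ℕ) (a : H →L[ℂ] H) :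
    (PiLp 2 fun _ : Fin n => H) →L[ℂ] (PiLp 2 fun _ : Fin n => H) :=
  ∑ k, inclL k ∘L a ∘L PiLp.proj 2 (fun _ : Fin n => H) k

theorem diagL_apply {n : ℕ} (a : H →L[ℂ] H) (y : PiLp 2 fun _ : Fin n => H) (k : Fin n) :
    diagL n a y k = a (y k) := by
  simp only [diagL, sum_apply, ContinuousLinearMap.comp_apply]
  have : ∀ i, (∑ j : Fin n, inclL j (a (y j)) : PiLp 2 fun _ : Fin n => H) i
      = ∑ j : Fin n, inclL j (a (y j)) i := fun i => by
    rw [WithLp.ofLp_sum, Finset.sum_apply]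
  refine (this k).trans ?_
  simp only [inclL_apply]
  simp

/-- For vectors `r i Ω`, with `r i` in the commutant of `A₀`, a matrix coefficient of a matrix over
`A₀` is a sum of matrix coefficients at vectors of `e₀ H`: move the `r i` to one side and take the
square root of the matrix `e₀ (r i)⋆ (r j) e₀`, which commutes with `A₀`. The matrix acts on a
Hilbert space `E` with coordinate maps `π`, inclusions `ι` and diagonal operators `Δ a`, which is
`Hⁿ` in the application. -/
theorem exists_reduced_vectors_aux {E : Type*} [NormedAddCommGroup E] [InnerProductSpace ℂ E]
    [CompleteSpace E] {n : ℕ} (π : Fin n → (E →L[ℂ] H)) (ι : Fin n → H → E)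
    (Δ : (H →L[ℂ] H) → (E →L[ℂ] E)) (hin : ∀ x y, ⟪x, y⟫_ℂ = ∑ k, ⟪π k x, π k y⟫_ℂ)
    (hι : ∀ i j x, π i (ι j x) = if i = j then x else 0)
    (hΔ : ∀ a k y, π k (Δ a y) = a (π k y)) {r : Fin n → (H →L[ℂ] H)}
    (hr : ∀ i, r i ∈ B.A₀.commutant) : ∃ w : Fin n → Fin n → H, (∀ k i, B.e₀ (w k i) = w k i) ∧
      ∀ a ∈ B.A₀, ∀ i j, ⟪r i B.Ω, a (r j B.Ω)⟫_ℂ = ∑ k, ⟪w k i, a (w k j)⟫_ℂ := by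
  have hΔs : ∀ a x y, ⟪x, Δ a y⟫_ℂ = ⟪Δ (star a) x, y⟫_ℂ := by
    intro a x y
    rw [hin, hin]
    refine Finset.sum_congr rfl fun k _ => ?_
    rw [hΔ, hΔ, inner_star]
  obtain ⟨V, hV⟩ : ∃ V : E →L[ℂ] H, ∀ y, V y = ∑ j, r j (B.e₀ (π j y)) :=
    ⟨∑ j, (r j * B.e₀) ∘L π j, fun y => by simp only [sum_apply]; rfl⟩
  obtain ⟨W, hWV, -, hWc⟩ := exists_sqrt V
  have hTin : ∀ x y, ⟪x, (ContinuousLinearMap.adjoint V ∘L V) y⟫_ℂ = ⟪V x, V y⟫_ℂ := fun x y =>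
    ContinuousLinearMap.adjoint_inner_right V x (V y)
  have hint : ∀ a ∈ B.A₀, ∀ y, V (Δ a y) = a (V y) := by
    intro a ha y
    rw [hV, hV, map_sum]
    refine Finset.sum_congr rfl fun j _ => ?_
    rw [hΔ, ← e₀_comm_apply ha, ← commutant_comm ha (hr j)]
  have hcommA : ∀ a ∈ B.A₀, Commute (ContinuousLinearMap.adjoint V ∘L V) (Δ a) := by
    intro a ha
    refine ContinuousLinearMap.ext fun y => ext_inner_left ℂ fun x => ?_
    rw [mul_app, mul_app, hTin, hint a ha, hΔs, hTin, hint _ (star_mem ha), inner_star]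
  have hVe : ∀ y, V (Δ B.e₀ y) = V y := by
    intro y
    rw [hV, hV]
    refine Finset.sum_congr rfl fun j _ => ?_
    rw [hΔ, e₀_e₀]
  have hcommE : Commute (ContinuousLinearMap.adjoint V ∘L V) (Δ B.e₀) := by
    refine ContinuousLinearMap.ext fun y => ext_inner_left ℂ fun x => ?_
    rw [mul_app, mul_app, hTin, hVe, hΔs, star_e₀, hTin, hVe]
  have hWe : ∀ y, W (Δ B.e₀ y) = W y := by
    intro y
    have h0 : V (Δ B.e₀ y - y) = 0 := by rw [map_sub, hVe, sub_self]
    have h1 : ⟪W (Δ B.e₀ y - y), W (Δ B.e₀ y - y)⟫_ℂ = 0 := by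
      rw [hWV, h0, inner_zero_left]
    rw [inner_self_eq_zero, map_sub, sub_eq_zero] at h1
    exact h1
  have hVι : ∀ j, V (ι j B.Ω) = r j B.Ω := by
    intro j
    rw [hV, Finset.sum_eq_single j]
    · rw [hι, if_pos rfl, e₀_Ω]
    · intro i _ hij
      rw [hι, if_neg hij, map_zero, map_zero]
    · simp
  refine ⟨fun k i => π k (W (ι i B.Ω)), fun k i => ?_, fun a ha i j => ?_⟩
  · have := DFunLike.congr_fun (hWc _ hcommE) (ι i B.Ω)
    rw [mul_app, mul_app, hWe] at this
    rw [← hΔ, this]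
  · have h1 : a (r j B.Ω) = V (Δ a (ι j B.Ω)) := by rw [hint a ha, hVι]
    have h2 := DFunLike.congr_fun (hWc _ (hcommA a ha)) (ι j B.Ω)
    rw [mul_app, mul_app] at h2
    rw [h1, ← hVι i, ← hWV, ← h2, hin]
    refine Finset.sum_congr rfl fun k _ => ?_
    rw [hΔ]

theorem exists_reduced_vectors {n : ℕ} {r : Fin n → (H →L[ℂ] H)}
    (hr : ∀ i, r i ∈ B.A₀.commutant) : ∃ w : Fin n → Fin n → H, (∀ k i, B.e₀ (w k i) = w k i) ∧
      ∀ a ∈ B.A₀, ∀ i j, ⟪r i B.Ω, a (r j B.Ω)⟫_ℂ = ∑ k, ⟪w k i, a (w k j)⟫_ℂ :=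
  exists_reduced_vectors_aux (E := PiLp 2 fun _ : Fin n => H)
    (fun i => PiLp.proj 2 (fun _ : Fin n => H) i) (fun j x => inclL j x) (diagL n)
    (fun x y => PiLp.inner_apply x y) inclL_apply (fun a k y => diagL_apply a y k) hr

/-- A matrix over `A₀` that is positive on the closure of `A₀ Ω` is positive. -/
theorem matrixPos_of_reduced {n : ℕ} {M : Fin n → Fin n → (H →L[ℂ] H)}
    (hM : ∀ i j, M i j ∈ B.A₀)
    (h : ∀ ξ : Fin n → H, (∀ i, B.e₀ (ξ i) = ξ i) →
      ∃ r : ℝ, 0 ≤ r ∧ ∑ i, ∑ j, ⟪ξ i, M i j (ξ j)⟫_ℂ = (r : ℂ)) : MatrixPos M := by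
  have hset : ∀ z : ℂ, (∃ r : ℝ, 0 ≤ r ∧ z = (r : ℂ)) ↔ (0 ≤ z.re ∧ z.im = 0) := by
    intro z
    constructor
    · rintro ⟨r, hr, rfl⟩; exact ⟨hr, rfl⟩
    · rintro ⟨h1, h2⟩; exact ⟨z.re, h1, Complex.ext rfl h2⟩
  have hclosed : IsClosed {ξ : Fin n → H | ∃ r : ℝ, 0 ≤ r ∧
      ∑ i, ∑ j, ⟪ξ i, M i j (ξ j)⟫_ℂ = (r : ℂ)} := by
    simp only [hset]
    have hc : Continuous fun ξ : Fin n → H => ∑ i, ∑ j, ⟪ξ i, M i j (ξ j)⟫_ℂ := by fun_prop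
    exact (isClosed_le continuous_const (Complex.continuous_re.comp hc)).inter
      (isClosed_eq (Complex.continuous_im.comp hc) continuous_const)
  have hdense : Dense (univ.pi fun _ : Fin n =>
      ((fun r : H →L[ℂ] H => r B.Ω) '' (B.A₀.commutant : Set (H →L[ℂ] H)))) :=
    dense_pi _ fun _ _ => dense_commutant
  intro ξ
  refine closure_minimal ?_ hclosed (hdense ξ)
  intro ζ hζ
  have hζ' : ∀ i, ∃ r ∈ B.A₀.commutant, r B.Ω = ζ i := fun i => hζ i trivial
  choose r hr hrζ using hζ'
  obtain ⟨w, hw, hwr⟩ := exists_reduced_vectors hr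
  choose ρ hρ0 hρ using fun k => h (w k) (hw k)
  refine ⟨∑ k, ρ k, Finset.sum_nonneg fun k _ => hρ0 k, ?_⟩
  rw [Complex.ofReal_sum]
  calc ∑ i, ∑ j, ⟪ζ i, M i j (ζ j)⟫_ℂ
      = ∑ i, ∑ j, ∑ k, ⟪w k i, M i j (w k j)⟫_ℂ := by
        refine Finset.sum_congr rfl fun i _ => Finset.sum_congr rfl fun j _ => ?_
        rw [← hrζ i, ← hrζ j, hwr _ (hM i j)]
    _ = ∑ i, ∑ k, ∑ j, ⟪w k i, M i j (w k j)⟫_ℂ :=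
        Finset.sum_congr rfl fun i _ => Finset.sum_comm
    _ = ∑ k, ∑ i, ∑ j, ⟪w k i, M i j (w k j)⟫_ℂ := Finset.sum_comm
    _ = _ := Finset.sum_congr rfl fun k _ => hρ k

/-! ### Conditional expectations -/

theorem inner_eq_on_orb {N : VonNeumannAlgebra H} {x y : H →L[ℂ] H}
    (h : ∀ a ∈ N, ∀ b ∈ N, ⟪a B.Ω, x (b B.Ω)⟫_ℂ = ⟪a B.Ω, y (b B.Ω)⟫_ℂ) {ξ η : H}
    (hξ : ξ ∈ B.orb N) (hη : η ∈ B.orb N) : ⟪ξ, x η⟫_ℂ = ⟪ξ, y η⟫_ℂ := by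
  have h1 : ∀ b ∈ N, ∀ ξ ∈ B.orb N, ⟪ξ, (x - y) (b B.Ω)⟫_ℂ = 0 := by
    intro b hb ξ hξ
    have : B.orb N ≤ (ℂ ∙ ((x - y) (b B.Ω)))ᗮ := by
      refine orb_le (Submodule.isClosed_orthogonal _) fun a ha => ?_
      rw [Submodule.mem_orthogonal_singleton_iff_inner_left, sub_apply, inner_sub_right, h a ha b hb,
        sub_self]
    exact Submodule.mem_orthogonal_singleton_iff_inner_left.1 (this hξ)
  have h2 : B.orb N ≤ LinearMap.ker ((innerSL ℂ ξ ∘L (x - y)) : H →ₗ[ℂ] ℂ) := by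
    refine orb_le (ContinuousLinearMap.isClosed_ker (innerSL ℂ ξ ∘L (x - y))) fun b hb => ?_
    exact h1 b hb ξ hξ
  have h3 : ⟪ξ, (x - y) η⟫_ℂ = 0 := h2 hη
  rwa [sub_apply, inner_sub_right, sub_eq_zero] at h3

theorem condExp_inner {N : VonNeumannAlgebra H}
    {E : B.A.toStarSubalgebra →ₗ[ℂ] B.A.toStarSubalgebra}
    (hE : IsCondExp B.A B.Ω N E) (hN : N ≤ B.A) (x : B.A.toStarSubalgebra) {ξ η : H}
    (hξ : ξ ∈ B.orb N) (hη : η ∈ B.orb N) :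
    ⟪ξ, (x : H →L[ℂ] H) η⟫_ℂ = ⟪ξ, (E x : H →L[ℂ] H) η⟫_ℂ := by
  refine inner_eq_on_orb (fun a ha b hb => ?_) hξ hη
  have h := hE.state (star ⟨a, hN ha⟩ * x * ⟨b, hN hb⟩)
  rw [hE.bimodule _ _ _ (star_mem ha) hb] at h
  have e : ∀ y : B.A.toStarSubalgebra, ⟪a B.Ω, (y : H →L[ℂ] H) (b B.Ω)⟫_ℂ
      = ⟪B.Ω, ((star ⟨a, hN ha⟩ * y * ⟨b, hN hb⟩ : B.A.toStarSubalgebra) : H →L[ℂ] H) B.Ω⟫_ℂ := by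
    intro y
    exact (inner_star_right a _ _).symm
  rw [e, e, h]

theorem inner_E₀ (x : B.A.toStarSubalgebra) {ξ η : H} (hξ : ξ ∈ B.orb B.A₀)
    (hη : η ∈ B.orb B.A₀) : ⟪ξ, (x : H →L[ℂ] H) η⟫_ℂ = ⟪ξ, (B.E₀ x : H →L[ℂ] H) η⟫_ℂ :=
  condExp_inner B.condExp₀ B.A₀_le x hξ hη

theorem E₀_mem (x : B.A.toStarSubalgebra) : (B.E₀ x : H →L[ℂ] H) ∈ B.A₀ := B.condExp₀.mem x

/-- The projection `e₀` implements the conditional expectation. -/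
theorem e₀_mul_mul_e₀ (x : B.A.toStarSubalgebra) :
    B.e₀ * (x : H →L[ℂ] H) * B.e₀ = (B.E₀ x : H →L[ℂ] H) * B.e₀ := by
  refine ContinuousLinearMap.ext fun η => ext_inner_left ℂ fun ξ => ?_
  have h1 : (B.E₀ x : H →L[ℂ] H) * B.e₀ = B.e₀ * ((B.E₀ x : H →L[ℂ] H) * B.e₀) :=
    (isReduced_mul_e₀ (E₀_mem x)).left.symm
  rw [h1, mul_assoc, mul_app, mul_app, mul_app, mul_app, ← inner_e₀_left, ← inner_e₀_left]
  exact inner_E₀ x (proj_apply_mem ξ) (proj_apply_mem η)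

/-- Elements of `N` are determined by their inner products at `Ω`, as `Ω` is separating. -/
theorem eq_of_inner_Ω {N : VonNeumannAlgebra H} (hN : N ≤ B.A) {a b : H →L[ℂ] H} (ha : a ∈ N)
    (hb : b ∈ N) (h : ∀ c ∈ N, ⟪c B.Ω, a B.Ω⟫_ℂ = ⟪c B.Ω, b B.Ω⟫_ℂ) : a = b := by
  refine sub_eq_zero.1 (eq_zero_of_apply_Ω (hN (sub_mem ha hb)) ?_)
  have := h (a - b) (sub_mem ha hb)
  rw [← sub_eq_zero, ← inner_sub_right, ← sub_apply] at this
  exact inner_self_eq_zero.1 this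

/-- `N` is independent of `M` over `A₀`: elements of `N` act on the closure of `M Ω`, up to
compression, like their conditional expectations onto `A₀`. -/
def IsIndep (B : ContinuousBernoulliShift H) (N M : VonNeumannAlgebra H) : Prop :=
  ∀ x : B.A.toStarSubalgebra, (x : H →L[ℂ] H) ∈ N → ∀ ξ ∈ B.orb M, ∀ η ∈ B.orb M,
    ⟪ξ, (x : H →L[ℂ] H) η⟫_ℂ = ⟪ξ, (B.E₀ x : H →L[ℂ] H) η⟫_ℂ

/-- The conditional expectations onto `A_J` and onto `A₀` agree on `A_I`, as their inner products
with elements of `A_J` do. -/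
theorem isIndep_of_disjoint {I J : Set ℝ} (hI : I.OrdConnected) (hJ : J.OrdConnected)
    (hIJ : Disjoint I J) : B.IsIndep (B.alg I) (B.alg J) := by
  intro x hx ξ hξ η hη
  obtain ⟨E, hE⟩ := B.alg_condExp J hJ
  have hle := B.alg_le J hJ
  have h0 := B.A₀_le_alg J hJ
  have key : (E x : H →L[ℂ] H) = B.E₀ x := by
    refine eq_of_inner_Ω hle (hE.mem x) (h0 (E₀_mem x)) fun c hc => ?_
    rw [← condExp_inner hE hle x (apply_Ω_mem_orb hc) Ω_mem_orb]
    set c' : B.A.toStarSubalgebra := ⟨c, hle hc⟩ with hc'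
    have e : ∀ y : B.A.toStarSubalgebra, ⟪c B.Ω, (y : H →L[ℂ] H) B.Ω⟫_ℂ
        = ⟪B.Ω, (B.E₀ (star c' * y) : H →L[ℂ] H) B.Ω⟫_ℂ := by
      intro y
      rw [B.condExp₀.state]
      exact (inner_star_right c _ _).symm
    have hi := B.indep J I hJ hI hIJ.symm (star c') x (star_mem hc) hx
    have hb := B.condExp₀.bimodule 1 (star c') (B.E₀ x) (one_mem _) (E₀_mem x)
    rw [one_mul, one_mul] at hb
    rw [e, e, hi, hb]
  rw [condExp_inner hE hle x hξ hη, key]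

/-- The conditional expectation is invariant under the shift, which fixes `A₀` and the state. -/
theorem E₀_S (t : ℝ) (x : B.A.toStarSubalgebra) : B.E₀ (B.S t x) = B.E₀ x := by
  refine Subtype.ext (eq_of_inner_Ω B.A₀_le (E₀_mem _) (E₀_mem _) fun c hc => ?_)
  rw [← inner_E₀ _ (apply_Ω_mem_orb hc) Ω_mem_orb, ← inner_E₀ _ (apply_Ω_mem_orb hc) Ω_mem_orb]
  set c' : B.A.toStarSubalgebra := ⟨c, B.A₀_le hc⟩ with hc'
  have hfix : B.S t c' = c' := (B.fixed c').2 hc t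
  have e : ∀ y : B.A.toStarSubalgebra, ⟪c B.Ω, (y : H →L[ℂ] H) B.Ω⟫_ℂ
      = ⟪B.Ω, ((star c' * y : B.A.toStarSubalgebra) : H →L[ℂ] H) B.Ω⟫_ℂ := fun y =>
    (inner_star_right c _ _).symm
  have h1 : B.S t (star c' * x) = star c' * B.S t x := by rw [map_mul, map_star, hfix]
  rw [e, e, ← h1, B.S_state]

/-- Independence extends from disjoint intervals to intervals with a common endpoint, by shifting
one of them slightly and using the weak continuity of the shift. -/
theorem isIndep_adjacent (s t : ℝ) : B.IsIndep (B.alg (Icc s t)) (B.alg (Iic s)) := by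
  intro x hx ξ hξ η hη
  have hev : ∀ ε ∈ Ioi (0 : ℝ), ⟪ξ, (B.S ε x : H →L[ℂ] H) η⟫_ℂ
      = ⟪ξ, (B.E₀ x : H →L[ℂ] H) η⟫_ℂ := by
    intro ε hε
    have hε : 0 < ε := hε
    have hm := (B.covariant ε (Icc s t) ordConnected_Icc x).1 hx
    rw [image_add_const_Icc] at hm
    have hd : Disjoint (Icc (s + ε) (t + ε)) (Iic s) := by
      rw [Set.disjoint_left]
      intro r hr hr'
      have := hr.1
      have : r ≤ s := hr'
      linarith
    rw [isIndep_of_disjoint ordConnected_Icc ordConnected_Iic hd _ hm ξ hξ η hη, E₀_S]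
  have h1 : Tendsto (fun ε => ⟪ξ, (B.S ε x : H →L[ℂ] H) η⟫_ℂ) (𝓝[>] 0)
      (𝓝 ⟪ξ, (x : H →L[ℂ] H) η⟫_ℂ) := by
    have := ((B.S_cont x ξ η).tendsto 0).mono_left (nhdsWithin_le_nhds (s := Ioi 0))
    rwa [B.S_zero] at this
  refine tendsto_nhds_unique h1 (tendsto_const_nhds.congr' ?_)
  filter_upwards [self_mem_nhdsWithin] with ε hε
  exact (hev ε hε).symm

theorem IsIndep.mono {N M N' M' : VonNeumannAlgebra H} (h : B.IsIndep N M) (hN : N' ≤ N)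
    (hM : M' ≤ M) : B.IsIndep N' M' := fun x hx ξ hξ η hη =>
  h x (hN hx) ξ (orb_mono hM hξ) η (orb_mono hM hη)

/-! ### The unitary implementation of the shift -/

theorem ext_Ω {a b : H →L[ℂ] H} (h : ∀ x : B.A.toStarSubalgebra,
    a ((x : H →L[ℂ] H) B.Ω) = b ((x : H →L[ℂ] H) B.Ω)) : a = b :=
  ContinuousLinearMap.ext fun ξ => congrFun
    (B.cyclic.equalizer a.continuous b.continuous (funext h)) ξ

theorem U_mul (t : ℝ) (a : B.A.toStarSubalgebra) :
    B.U t * (a : H →L[ℂ] H) = (B.S t a : H →L[ℂ] H) * B.U t := by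
  refine ext_Ω (B := B) fun x => ?_
  rw [mul_app, mul_app, U_apply]
  have := B.U_apply t (a * x)
  rw [map_mul] at this
  exact this

theorem U_add (s t : ℝ) : B.U (s + t) = B.U s * B.U t := by
  refine ext_Ω (B := B) fun x => ?_
  rw [mul_app, U_apply, U_apply, U_apply, B.S_add]

theorem U_zero : B.U 0 = 1 := by
  refine ext_Ω (B := B) fun x => ?_
  rw [U_apply, B.S_zero]; rfl

theorem U_mul_U_neg (t : ℝ) : B.U t * B.U (-t) = 1 := by
  rw [← U_add, add_neg_cancel, U_zero]

theorem U_neg_mul_U (t : ℝ) : B.U (-t) * B.U t = 1 := by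
  rw [← U_add, neg_add_cancel, U_zero]

theorem norm_U_apply (t : ℝ) (ξ : H) : ‖B.U t ξ‖ = ‖ξ‖ := by
  have := DenseRange.equalizer B.cyclic (g := fun ξ => ‖B.U t ξ‖) (h := fun ξ => ‖ξ‖)
    (by fun_prop) (by fun_prop) (funext fun x => by
      change ‖B.U t ((x : H →L[ℂ] H) B.Ω)‖ = ‖(x : H →L[ℂ] H) B.Ω‖
      rw [U_apply, norm_orbit_S])
  exact congrFun this ξ

theorem inner_U (t : ℝ) (ξ η : H) : ⟪B.U t ξ, B.U t η⟫_ℂ = ⟪ξ, η⟫_ℂ :=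
  LinearIsometry.inner_map_map (⟨B.U t, norm_U_apply t⟩ : H →ₗᵢ[ℂ] H) ξ η

theorem star_U_mul_U (t : ℝ) : star (B.U t) * B.U t = 1 := by
  refine ContinuousLinearMap.ext fun η => ext_inner_left ℂ fun ξ => ?_
  rw [mul_app, inner_star_right, inner_U]; rfl

theorem star_U (t : ℝ) : star (B.U t) = B.U (-t) := by
  calc star (B.U t) = star (B.U t) * (B.U t * B.U (-t)) := by rw [U_mul_U_neg, mul_one]
    _ = _ := by rw [← mul_assoc, star_U_mul_U, one_mul]

theorem U_comm {a : H →L[ℂ] H} (ha : a ∈ B.A₀) (t : ℝ) : B.U t * a = a * B.U t := by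
  have := U_mul t (⟨a, B.A₀_le ha⟩ : B.A.toStarSubalgebra)
  rwa [(B.fixed ⟨a, B.A₀_le ha⟩).2 ha t] at this

theorem U_Ω (t : ℝ) : B.U t B.Ω = B.Ω := by
  have := B.U_apply t 1
  rw [map_one] at this
  exact this

theorem U_mul_e₀ (t : ℝ) : B.U t * B.e₀ = B.e₀ := by
  refine ContinuousLinearMap.ext fun ξ => ?_
  have : B.orb B.A₀ ≤ LinearMap.eqLocus (B.U t : H →ₗ[ℂ] H) LinearMap.id := by
    refine orb_le (isClosed_eq (B.U t).continuous continuous_id) fun a ha => ?_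
    have := DFunLike.congr_fun (U_comm ha t) B.Ω
    rw [mul_app, mul_app, U_Ω] at this
    exact this
  exact this (proj_apply_mem (N := B.A₀) ξ)

theorem e₀_mul_U (t : ℝ) : B.e₀ * B.U t = B.e₀ := by
  have := congrArg star (U_mul_e₀ (B := B) (-t))
  rwa [star_mul, star_e₀, star_U, neg_neg] at this

theorem U_mem_orb (t : ℝ) {I : Set ℝ} (hI : I.OrdConnected) {ξ : H} (hξ : ξ ∈ B.orb (B.alg I)) :
    B.U t ξ ∈ B.orb (B.alg ((fun r => r + t) '' I)) := by
  have : B.orb (B.alg I) ≤ (B.orb (B.alg ((fun r => r + t) '' I))).comap (B.U t : H →ₗ[ℂ] H) := by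
    refine orb_le ((isClosed_orb _).preimage (B.U t).continuous) fun a ha => ?_
    have h1 := B.U_apply t ⟨a, B.alg_le I hI ha⟩
    change B.U t (a B.Ω) ∈ B.orb (B.alg ((fun r => r + t) '' I))
    have h2 := apply_Ω_mem_orb (B := B) ((B.covariant t I hI ⟨a, B.alg_le I hI ha⟩).1 ha)
    rw [← h1] at h2
    exact h2
  exact this hξ

theorem U_mul_proj (s t : ℝ) :
    B.U t * B.proj (B.alg (Iic s)) = B.proj (B.alg (Iic (s + t))) * B.U t := by
  have h : ∀ r u : ℝ, B.proj (B.alg (Iic (r + u))) * (B.U u * B.proj (B.alg (Iic r)))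
      = B.U u * B.proj (B.alg (Iic r)) := by
    intro r u
    refine ContinuousLinearMap.ext fun ξ =>
      proj_eq_self_iff (B := B) (N := B.alg (Iic (r + u))).2 ?_
    have := U_mem_orb u ordConnected_Iic (proj_apply_mem (B := B) (N := B.alg (Iic r)) ξ)
    rwa [image_add_const_Iic] at this
  have h2 := congrArg star (h (s + t) (-t))
  rw [add_neg_cancel_right] at h2
  simp only [star_mul, star_proj, star_U, neg_neg] at h2
  rw [← h s t, ← mul_assoc, h2]

/-! ### The Hilbert bimodules -/

theorem mul_e₀_mem_bimod {N : VonNeumannAlgebra H} {a : H →L[ℂ] H} (ha : a ∈ N) :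
    a * B.e₀ ∈ B.bimod N := subset_stopClosure _ (mem_image_of_mem _ ha)

variable (B) in
/-- The Hilbert bimodule of `N` as a linear subspace. -/
def bimodSubmodule (N : VonNeumannAlgebra H) : Submodule ℂ (H →L[ℂ] H) where
  carrier := B.bimod N
  zero_mem' := by
    have := mul_e₀_mem_bimod (B := B) (zero_mem N)
    rwa [zero_mul] at this
  add_mem' := by
    intro x y hx hy
    refine map_mem_closure₂ (f := fun f g : H → H => f + g) (by fun_prop) hx hy ?_
    rintro _ ⟨_, ⟨a, ha, rfl⟩, rfl⟩ _ ⟨_, ⟨b, hb, rfl⟩, rfl⟩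
    exact ⟨_, ⟨a + b, add_mem ha hb, rfl⟩,
      congrArg (fun y : H →L[ℂ] H => (y : H → H)) (add_mul a b B.e₀)⟩
  smul_mem' := by
    intro c x hx
    refine map_mem_closure (f := fun f : H → H => c • f) (by fun_prop) hx ?_
    rintro _ ⟨_, ⟨a, ha, rfl⟩, rfl⟩
    exact ⟨_, ⟨c • a, N.toStarSubalgebra.smul_mem ha c, rfl⟩,
      congrArg (fun y : H →L[ℂ] H => (y : H → H)) (smul_mul_assoc c a B.e₀)⟩

theorem isClosed_bimodSubmodule (N : VonNeumannAlgebra H) :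
    IsClosed (B.bimodSubmodule N : Set (H →L[ℂ] H)) :=
  isClosed_closure.preimage (f := fun y : H →L[ℂ] H => (y : H → H))
    (continuous_pi fun _ => by fun_prop)

theorem bimod_mono {M N : VonNeumannAlgebra H} (h : M ≤ N) : B.bimod M ⊆ B.bimod N :=
  stopClosure_mono (image_mono h)

theorem mul_mem_bimod {N : VonNeumannAlgebra H} {a x : H →L[ℂ] H} (ha : a ∈ N)
    (hx : x ∈ B.bimod N) : a * x ∈ B.bimod N := by
  refine mul_left_mem_stopClosure ?_ hx
  rintro _ ⟨b, hb, rfl⟩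
  change a * (b * B.e₀) ∈ _
  rw [← mul_assoc]
  exact mul_e₀_mem_bimod (mul_mem ha hb)

theorem bimod_mul_mem {N : VonNeumannAlgebra H} (hN : B.A₀ ≤ N) {a x : H →L[ℂ] H} (ha : a ∈ B.A₀)
    (hx : x ∈ B.bimod N) : x * a ∈ B.bimod N := by
  refine mul_right_mem_stopClosure ?_ hx
  rintro _ ⟨b, hb, rfl⟩
  change b * B.e₀ * a ∈ _
  rw [mul_assoc, ← e₀_comm ha, ← mul_assoc]
  exact mul_e₀_mem_bimod (mul_mem hb (hN ha))

theorem bimod_mul_e₀ {N : VonNeumannAlgebra H} {x : H →L[ℂ] H} (hx : x ∈ B.bimod N) :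
    x * B.e₀ = x := by
  refine ContinuousLinearMap.ext fun ξ => ?_
  have hC : IsClosed {f : H → H | f (B.e₀ ξ) = f ξ} := isClosed_eq (by fun_prop) (by fun_prop)
  refine mem_of_mem_stopClosure hC ?_ hx
  rintro _ ⟨b, hb, rfl⟩
  change b (B.e₀ (B.e₀ ξ)) = b (B.e₀ ξ)
  rw [e₀_e₀]

theorem bimod_apply_mem {N : VonNeumannAlgebra H} (hN : B.A₀ ≤ N) {x : H →L[ℂ] H}
    (hx : x ∈ B.bimod N) (ξ : H) : x ξ ∈ B.orb N := by
  have hC : IsClosed {f : H → H | f ξ ∈ B.orb N} :=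
    (isClosed_orb N).preimage (f := fun f : H → H => f ξ) (by fun_prop)
  refine mem_of_mem_stopClosure hC ?_ hx
  rintro _ ⟨b, hb, rfl⟩
  exact apply_mem_orb hb (orb_mono hN (proj_apply_mem ξ))

theorem e₀_mem_bimod (N : VonNeumannAlgebra H) : B.e₀ ∈ B.bimod N := by
  have := mul_e₀_mem_bimod (B := B) (one_mem N)
  rwa [one_mul] at this

theorem U_mul_mem_bimod (t : ℝ) {I : Set ℝ} (hI : I.OrdConnected) {x : H →L[ℂ] H}
    (hx : x ∈ B.bimod (B.alg I)) : B.U t * x ∈ B.bimod (B.alg ((fun r => r + t) '' I)) := by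
  refine mul_left_mem_stopClosure ?_ hx
  rintro _ ⟨b, hb, rfl⟩
  change B.U t * (b * B.e₀) ∈ _
  have h1 := U_mul t (⟨b, B.alg_le I hI hb⟩ : B.A.toStarSubalgebra)
  rw [← mul_assoc, h1, mul_assoc, U_mul_e₀]
  exact mul_e₀_mem_bimod ((B.covariant t I hI ⟨b, B.alg_le I hI hb⟩).1 hb)

/-! ### The `A₀`-valued inner product -/

theorem bimod_mul_e₀_apply {N : VonNeumannAlgebra H} {x : H →L[ℂ] H} (hx : x ∈ B.bimod N) (ξ : H) :
    x (B.e₀ ξ) = x ξ := DFunLike.congr_fun (bimod_mul_e₀ hx) ξ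

theorem star_mul_eq_E₀ (a b : B.A.toStarSubalgebra) :
    star ((a : H →L[ℂ] H) * B.e₀) * ((b : H →L[ℂ] H) * B.e₀)
      = (B.E₀ (star a * b) : H →L[ℂ] H) * B.e₀ := by
  rw [← e₀_mul_mul_e₀, star_mul, star_e₀]
  change _ = B.e₀ * (star (a : H →L[ℂ] H) * (b : H →L[ℂ] H)) * B.e₀
  simp only [mul_assoc]

/-- The inner product of two elements of the bimodule belongs to the reduced algebra. -/
theorem isReduced_ip {x y : H →L[ℂ] H} (hx : x ∈ B.bimod B.A) (hy : y ∈ B.bimod B.A) :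
    B.IsReduced (star x * y) where
  right := by rw [mul_assoc, bimod_mul_e₀ hy]
  left := by
    have := congrArg star (bimod_mul_e₀ hx)
    rw [star_mul, star_e₀] at this
    rw [← mul_assoc, this]
  comm := fun r hr => by
    set q := B.e₀ * r * B.e₀ with hq
    refine ContinuousLinearMap.ext fun η => ext_inner_left ℂ fun ξ => ?_
    suffices h : ⟪x ξ, y (q η)⟫_ℂ = ⟪x (star q ξ), y η⟫_ℂ by
      simp only [mul_app]
      rw [inner_star_right, h, ← inner_star q, inner_star_right]
    have hC : ∀ f : H → H, IsClosed {g : H → H | ⟪f ξ, g (q η)⟫_ℂ = ⟪f (star q ξ), g η⟫_ℂ} :=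
      fun f => isClosed_eq (by fun_prop) (by fun_prop)
    have hC' : ∀ g : H → H, IsClosed {f : H → H | ⟪f ξ, g (q η)⟫_ℂ = ⟪f (star q ξ), g η⟫_ℂ} :=
      fun g => isClosed_eq (by fun_prop) (by fun_prop)
    refine mem_of_mem_stopClosure (hC x) ?_ hy
    rintro _ ⟨b, hb, rfl⟩
    refine mem_of_mem_stopClosure (hC' _) ?_ hx
    rintro _ ⟨a, ha, rfl⟩
    have h1 := (isReduced_mul_e₀ (E₀_mem (B := B) (star ⟨a, ha⟩ * ⟨b, hb⟩))).comm r hr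
    rw [← star_mul_eq_E₀] at h1
    have h2 : ⟪ξ, star (a * B.e₀) ((b * B.e₀) (q η))⟫_ℂ
        = ⟪ξ, q (star (a * B.e₀) ((b * B.e₀) η))⟫_ℂ := congrArg (fun w => ⟪ξ, w η⟫_ℂ) h1
    rw [inner_star_right, ← inner_star q, inner_star_right] at h2
    exact h2

open Classical in
variable (B) in
/-- The element `a` of `A₀` with `a e₀ = z`, for `z` in the reduced algebra (zero for other
operators). -/
def lift (z : H →L[ℂ] H) : H →L[ℂ] H :=
  if h : ∃ a ∈ B.A₀, a * B.e₀ = z then h.choose else 0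

theorem lift_mem (z : H →L[ℂ] H) : B.lift z ∈ B.A₀ := by
  unfold lift
  split_ifs with h
  · exact h.choose_spec.1
  · exact zero_mem _

theorem IsReduced.lift_mul_e₀ {z : H →L[ℂ] H} (hz : B.IsReduced z) : B.lift z * B.e₀ = z := by
  unfold lift
  rw [dif_pos hz.exists_lift]
  exact hz.exists_lift.choose_spec.2

theorem lift_eq {a z : H →L[ℂ] H} (ha : a ∈ B.A₀) (h : a * B.e₀ = z) : B.lift z = a :=
  ext_A₀ (lift_mem z) ha (by rw [← h, (isReduced_mul_e₀ ha).lift_mul_e₀])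

theorem lift_zero : B.lift (0 : H →L[ℂ] H) = 0 := lift_eq (zero_mem _) (zero_mul _)

theorem IsReduced.norm_lift {z : H →L[ℂ] H} (hz : B.IsReduced z) : ‖B.lift z‖ = ‖z‖ := by
  rw [← norm_mul_e₀ (lift_mem z), hz.lift_mul_e₀]

theorem IsReduced.lift_Ω {z : H →L[ℂ] H} (hz : B.IsReduced z) : B.lift z B.Ω = z B.Ω := by
  have := DFunLike.congr_fun hz.lift_mul_e₀ B.Ω
  rwa [mul_app, e₀_Ω] at this

/-- Positivity in `A₀` can be tested on `e₀ H`. -/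
theorem nonneg_of_reduced {a : H →L[ℂ] H} (ha : a ∈ B.A₀)
    (h : ∀ ξ, ∃ r : ℝ, 0 ≤ r ∧ ⟪B.e₀ ξ, a (B.e₀ ξ)⟫_ℂ = (r : ℂ)) : 0 ≤ a := by
  have hp : MatrixPos (fun _ _ : Fin 1 => a) := by
    refine matrixPos_of_reduced (B := B) (fun _ _ => ha) fun ξ hξ => ?_
    obtain ⟨r, hr, h1⟩ := h (ξ 0)
    rw [hξ 0] at h1
    exact ⟨r, hr, by simpa using h1⟩
  rw [ContinuousLinearMap.nonneg_iff_isPositive, ContinuousLinearMap.isPositive_iff_complex]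
  intro ξ
  obtain ⟨r, hr, h1⟩ := hp fun _ => ξ
  have h2 : ⟪ξ, a ξ⟫_ℂ = (r : ℂ) := by simpa using h1
  have h3 : ⟪a ξ, ξ⟫_ℂ = (r : ℂ) := by rw [← inner_conj_symm, h2, Complex.conj_ofReal]
  rw [h3]
  exact ⟨by simp, by simpa using hr⟩

theorem lift_star_mul_self_nonneg {x : H →L[ℂ] H} (hx : x ∈ B.bimod B.A) :
    0 ≤ B.lift (star x * x) := by
  refine nonneg_of_reduced (lift_mem _) fun ξ => ⟨‖x ξ‖ ^ 2, by positivity, ?_⟩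
  rw [← mul_app (B.lift (star x * x)), (isReduced_ip hx hx).lift_mul_e₀, mul_app, inner_star_right,
    bimod_mul_e₀_apply hx, inner_self_eq_norm_sq_to_K]
  simp

/-! ### Bounded approximation in the bimodules -/

/-- The resolvent `(1 + T)⁻¹` of a positive operator. -/
theorem exists_resolvent {T : H →L[ℂ] H} (hT : 0 ≤ T) :
    ∃ R : H →L[ℂ] H, R * (1 + T) = 1 ∧ (1 + T) * R = 1 ∧ star R = R ∧ ‖R‖ ≤ 1 ∧ ‖R * T * R‖ ≤ 1 ∧
      ∀ X, Commute T X → Commute R X := by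
  have hspec : ∀ t ∈ spectrum ℝ T, 0 ≤ t := fun t ht => spectrum_nonneg_of_nonneg hT ht
  have hsa : IsSelfAdjoint T := hT.isSelfAdjoint
  have hc : ContinuousOn (fun t : ℝ => 1 / (1 + t)) (spectrum ℝ T) := by
    refine continuousOn_const.div (by fun_prop) fun t ht => ?_
    have := hspec t ht
    positivity
  have h1T : cfc (fun t : ℝ => 1 + t) T = 1 + T := by
    rw [cfc_add .., cfc_const_one .., cfc_id' ..]
  have hone : cfc (fun t : ℝ => 1 / (1 + t) * (1 + t)) T = 1 := by
    rw [← cfc_const_one ℝ T]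
    refine cfc_congr fun t ht => ?_
    have := hspec t ht
    have : 1 + t ≠ 0 := by positivity
    field_simp
  have hR1 : cfc (fun t : ℝ => 1 / (1 + t)) T * (1 + T) = 1 := by
    have h := cfc_mul (fun t : ℝ => 1 / (1 + t)) (fun t => 1 + t) T hc (by fun_prop)
    rw [hone, h1T] at h
    exact h.symm
  have hcomm : ∀ X, Commute T X → Commute (cfc (fun t : ℝ => 1 / (1 + t)) T) X :=
    fun X hX => hX.cfc_real _
  refine ⟨cfc (fun t : ℝ => 1 / (1 + t)) T, hR1, ?_, ?_, ?_, ?_, hcomm⟩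
  · rw [← (hcomm _ ((Commute.one_right T).add_right (Commute.refl T))).eq, hR1]
  · exact (cfc_predicate _ T : IsSelfAdjoint _).star_eq
  · refine norm_cfc_le zero_le_one fun t ht => ?_
    have := hspec t ht
    rw [Real.norm_of_nonneg (by positivity), div_le_one (by positivity)]
    linarith
  · have : cfc (fun t : ℝ => 1 / (1 + t) * t * (1 / (1 + t))) T
        = cfc (fun t : ℝ => 1 / (1 + t)) T * T * cfc (fun t : ℝ => 1 / (1 + t)) T := by
      rw [cfc_mul (fun t : ℝ => 1 / (1 + t) * t) _ T (hc.mul continuousOn_id) hc,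
        cfc_mul _ (fun t : ℝ => t) T hc continuousOn_id, cfc_id' ..]
    rw [← this]
    refine norm_cfc_le zero_le_one fun t ht => ?_
    have := hspec t ht
    rw [Real.norm_of_nonneg (by positivity)]
    have h1 : 1 / (1 + t) * t * (1 / (1 + t)) = t / (1 + t) ^ 2 := by field_simp
    rw [h1, div_le_one (by positivity)]
    nlinarith

/-- For `0 ≤ a ≤ 1` the operator `g = (1 + (1 - a) ^ (1 / 2))⁻¹` solves `2 g = 1 + g a g`. The
operator `h` is the inverse of both sides. -/
theorem exists_half_angle [Nontrivial H] {a : H →L[ℂ] H} (ha : 0 ≤ a) (h1 : ‖a‖ ≤ 1) :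
    ∃ g h : H →L[ℂ] H, star g = g ∧ (1 + g * a * g) * h = 1 ∧ (2 : ℝ) • (g * h) = 1 ∧
      (∀ X, Commute a X → Commute g X) ∧ ∀ X, Commute a X → Commute h X := by
  have hsa : IsSelfAdjoint a := ha.isSelfAdjoint
  have hspec : ∀ t ∈ spectrum ℝ a, t ≤ 1 := fun t ht =>
    (Real.le_norm_self t).trans ((spectrum.norm_le_norm_of_mem ht).trans h1)
  set f : ℝ → ℝ := fun t => 1 / (1 + √(1 - t)) with hf
  set k : ℝ → ℝ := fun t => (1 + √(1 - t)) / 2 with hk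
  have hpos : ∀ t : ℝ, 0 < 1 + √(1 - t) := fun t => by positivity
  have hfc : Continuous f := continuous_const.div (by fun_prop) fun t => (hpos t).ne'
  have hkc : Continuous k := by fun_prop
  refine ⟨cfc f a, cfc k a, (cfc_predicate f a : IsSelfAdjoint _).star_eq, ?_, ?_,
    fun X hX => hX.cfc_real _, fun X hX => hX.cfc_real _⟩
  · have e1 : cfc (fun t => f t * t * f t) a = cfc f a * a * cfc f a := by
      rw [cfc_mul (fun t => f t * t) f a (by fun_prop) hfc.continuousOn,
        cfc_mul f (fun t => t) a hfc.continuousOn (by fun_prop), cfc_id' ..]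
    have e2 : cfc (fun t => 1 + f t * t * f t) a = 1 + cfc f a * a * cfc f a := by
      rw [cfc_add a (fun _ => 1) (fun t => f t * t * f t) (by fun_prop) (by fun_prop),
        cfc_const_one .., e1]
    rw [← e2, ← cfc_mul _ _ a (by fun_prop) hkc.continuousOn, ← cfc_const_one ℝ a]
    refine cfc_congr fun t ht => ?_
    have hs : √(1 - t) ^ 2 = 1 - t := Real.sq_sqrt (sub_nonneg.2 (hspec t ht))
    have h0 := (hpos t).ne'
    simp only [hf, hk]
    field_simp
    nlinarith
  · rw [← cfc_mul f k a hfc.continuousOn hkc.continuousOn, ← cfc_smul (2 : ℝ) (fun t => f t * k t) a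
      (by fun_prop), ← cfc_const_one ℝ a]
    refine cfc_congr fun t ht => ?_
    have h0 := (hpos t).ne'
    simp only [hf, hk, smul_eq_mul]
    field_simp

theorem mem_of_commute {N : VonNeumannAlgebra H} {a X : H →L[ℂ] H} (ha : a ∈ N)
    (h : ∀ Y, Commute a Y → Commute X Y) : X ∈ N := by
  rw [← VonNeumannAlgebra.commutant_commutant N, VonNeumannAlgebra.mem_commutant_iff]
  intro r hr
  exact (h r (VonNeumannAlgebra.mem_commutant_iff.1 hr a ha)).eq.symm

/-- By the Hahn–Banach theorem an element of the strong closure of `N e₀` can be approximated at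
given vectors together with its adjoint. -/
theorem exists_near_star {N : VonNeumannAlgebra H} {z : H →L[ℂ] H} (hz : z ∈ B.bimod N) (w v : H)
    {ε : ℝ} (hε : 0 < ε) : ∃ b ∈ N, ‖(b * B.e₀) w - z w‖ < ε ∧
      ‖star (b * B.e₀) v - star z v‖ < ε := by
  set S : Set (H × H) := (fun b : H →L[ℂ] H => ((b * B.e₀) w, star (b * B.e₀) v)) '' N with hS
  suffices h : (z w, star z v) ∈ closure S by
    obtain ⟨_, ⟨b, hb, rfl⟩, hd⟩ := Metric.mem_closure_iff.1 h ε hε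
    rw [Prod.dist_eq, max_lt_iff, dist_comm, dist_comm (star z v), dist_eq_norm, dist_eq_norm] at hd
    exact ⟨b, hb, hd⟩
  by_contra hcon
  have hconv : Convex ℝ S := by
    rintro _ ⟨b, hb, rfl⟩ _ ⟨b', hb', rfl⟩ s t _ _ _
    refine ⟨(s : ℂ) • b + (t : ℂ) • b', add_mem (N.toStarSubalgebra.smul_mem hb _)
      (N.toStarSubalgebra.smul_mem hb' _), ?_⟩
    simp [add_mul]
  obtain ⟨f, u, hfu, huf⟩ := geometric_hahn_banach_closed_point hconv.closure isClosed_closure hcon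
  -- A functional that is bounded above on a real linear space vanishes there.
  have hf0 : ∀ b ∈ N, f ((b * B.e₀) w, star (b * B.e₀) v) = 0 := by
    intro b hb
    by_contra hne
    have h2 : ∀ r : ℝ, ((((r : ℂ) • b) * B.e₀) w, star (((r : ℂ) • b) * B.e₀) v)
        = r • ((b * B.e₀) w, star (b * B.e₀) v) := by
      intro r
      simp [Complex.coe_smul]
    have h1 : f _ < u := hfu _ (subset_closure
      (mem_image_of_mem _ (N.toStarSubalgebra.smul_mem hb
        (((u / f ((b * B.e₀) w, star (b * B.e₀) v) : ℝ) : ℂ)))))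
    have h3 := h2 (u / f ((b * B.e₀) w, star (b * B.e₀) v))
    have h4 := congrArg f h3
    rw [map_smul, smul_eq_mul, div_mul_cancel₀ _ hne] at h4
    exact h1.ne h4
  have hu0 : 0 < u := by
    have h1 : f _ < u := hfu _ (subset_closure (mem_image_of_mem _ (zero_mem N)))
    exact (hf0 0 (zero_mem N)).symm.trans_lt h1
  -- By the Riesz representation of the second component of `f`, the pairing of `f` with
  -- `(y w, y⋆ v)` is strongly continuous in `y`, so it vanishes at `z` as well.
  let g : H →L[ℝ] ℝ := f ∘L ContinuousLinearMap.inr ℝ H H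
  obtain ⟨η, hη⟩ : ∃ η : H, ∀ ζ, g ζ = (⟪η, ζ⟫_ℂ).re := by
    let G : StrongDual ℂ H := StrongDual.extendRCLike (𝕜 := ℂ) g
    refine ⟨(InnerProductSpace.toDual ℂ H).symm G, fun ζ => ?_⟩
    rw [InnerProductSpace.toDual_symm_apply]
    exact (StrongDual.re_extendRCLike_apply (𝕜 := ℂ) g ζ).symm
  have hC : IsClosed {φ : H → H | f (φ w, 0) + (⟪φ η, v⟫_ℂ).re = 0} := by
    refine isClosed_eq (Continuous.add (f.continuous.comp (by fun_prop)) ?_) continuous_const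
    exact Complex.continuous_re.comp (by fun_prop)
  have hsplit : ∀ y : H →L[ℂ] H, f (y w, star y v) = f (y w, 0) + (⟪y η, v⟫_ℂ).re := by
    intro y
    have e : (y w, star y v) = (y w, (0 : H)) + ((0 : H), star y v) := by simp
    rw [e, map_add, ← inner_star_right, ← hη]
    rfl
  have hz0 : f (z w, 0) + (⟪z η, v⟫_ℂ).re = 0 := by
    refine mem_of_mem_stopClosure hC ?_ hz
    rintro _ ⟨b, hb, rfl⟩
    change f ((b * B.e₀) w, 0) + (⟪(b * B.e₀) η, v⟫_ℂ).re = 0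
    rw [← hsplit]
    exact hf0 b hb
  rw [hsplit, hz0] at huf
  linarith

/-- The Kaplansky density theorem for the bimodule of `N`, at the vector `Ω`: write
`x = 2 z (1 + z⋆ z)⁻¹` and replace `z` by an approximation in `N e₀`. -/
theorem exists_bounded_near {N : VonNeumannAlgebra H} (hN : N ≤ B.A) (h0 : B.A₀ ≤ N)
    {x : H →L[ℂ] H} (hx : x ∈ B.bimod N) (hx1 : ‖x‖ ≤ 1) {ε : ℝ} (hε : 0 < ε) :
    ∃ b ∈ N, ‖b * B.e₀‖ ≤ 2 ∧ ‖b B.Ω - x B.Ω‖ < ε := by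
  have : Nontrivial H := ⟨B.Ω, 0, fun h => by simpa [h] using B.norm_Ω⟩
  have hxA := bimod_mono hN hx
  have hred := isReduced_ip hxA hxA
  set a := B.lift (star x * x) with ha
  have haA : a ∈ B.A₀ := lift_mem _
  have hae : a * B.e₀ = star x * x := hred.lift_mul_e₀
  have ha1 : ‖a‖ ≤ 1 := by
    rw [ha, hred.norm_lift, CStarRing.norm_star_mul_self]
    exact mul_le_one₀ hx1 (norm_nonneg _) hx1
  obtain ⟨g, h, hgs, hgh, hgh2, hgc, hhc⟩ := exists_half_angle (lift_star_mul_self_nonneg hxA) ha1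
  have hg : g ∈ B.A₀ := mem_of_commute haA hgc
  have hh : h ∈ B.A₀ := mem_of_commute haA hhc
  set z := x * g with hz
  have hzN : z ∈ B.bimod N := bimod_mul_mem h0 hg hx
  -- `z = x g` satisfies `x = 2 z (1 + z⋆ z)⁻¹`, and `w = (1 + z⋆ z)⁻¹ Ω`.
  set w := h B.Ω with hw
  have hew : B.e₀ w = w := by rw [hw, ← e₀_comm_apply hh, e₀_Ω]
  have hzz : star z * z = g * a * g * B.e₀ := by
    rw [hz, star_mul, hgs]
    calc g * star x * (x * g) = g * (star x * x) * g := by simp only [mul_assoc]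
      _ = g * a * (B.e₀ * g) := by rw [← hae]; simp only [mul_assoc]
      _ = _ := by rw [← e₀_comm hg]; simp only [mul_assoc]
  have hwΩ : w + star z (z w) = B.Ω := by
    rw [← mul_app (star z), hzz, mul_app, hew]
    have := DFunLike.congr_fun hgh B.Ω
    rw [mul_app, add_apply] at this
    exact this
  have hxΩ : x B.Ω = (2 : ℝ) • z w := by
    have h2 : (2 : ℝ) • (g (h B.Ω)) = B.Ω := DFunLike.congr_fun hgh2 B.Ω
    rw [hz, mul_app, hw]
    conv_lhs => rw [← h2]
    rw [← Complex.coe_smul, ← Complex.coe_smul, map_smul]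
  obtain ⟨b, hb, hb1, hb2⟩ := exists_near_star hzN w (z w) (show 0 < ε / 5 by positivity)
  set y := b * B.e₀ with hy
  set p : H →L[ℂ] H := (B.E₀ (star ⟨b, hN hb⟩ * ⟨b, hN hb⟩) : H →L[ℂ] H) with hp
  have hpA : p ∈ B.A₀ := E₀_mem _
  have hp0 : 0 ≤ p := by
    rw [ContinuousLinearMap.nonneg_iff_isPositive]
    exact B.condExp₀.pos _
  have hyy : star y * y = p * B.e₀ := star_mul_eq_E₀ ⟨b, hN hb⟩ ⟨b, hN hb⟩
  -- The approximation is `2 y (1 + y⋆ y)⁻¹ = 2 y k`, with `k` the resolvent of `p` in `A₀`, so that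
  -- it belongs to `N e₀`. The resolvent `Y` of `y y⋆` serves for the estimate, by `y k = Y y`.
  obtain ⟨k, -, hk1, hks, -, hkpk, hkc⟩ := exists_resolvent hp0
  have hk : k ∈ B.A₀ := mem_of_commute hpA hkc
  obtain ⟨Y, hY1, -, -, hYn, -, -⟩ := exists_resolvent (star_mul_self_nonneg (star y))
  rw [star_star] at hY1
  have hyk : y * k = Y * y := by
    have h1 : (1 + y * star y) * (y * k) = y := by
      calc (1 + y * star y) * (y * k) = y * k + y * (star y * y) * k := by
            rw [add_mul, one_mul]; simp only [mul_assoc]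
        _ = y * k + b * (B.e₀ * p) * (B.e₀ * k) := by rw [hyy, hy]; simp only [mul_assoc]
        _ = y * k + b * B.e₀ * p * k := by
            rw [← e₀_comm hpA, ← e₀_comm hk]
            have : B.e₀ * (k * B.e₀) = k * B.e₀ := by
              rw [← mul_assoc, ← e₀_comm hk, mul_assoc, e₀_mul_e₀]
            calc _ = y * k + b * p * (B.e₀ * (k * B.e₀)) := by simp only [mul_assoc]
              _ = y * k + b * (p * B.e₀) * k := by
                rw [this, e₀_comm hk]; simp only [mul_assoc]
              _ = _ := by rw [e₀_comm hpA]; simp only [mul_assoc]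
        _ = y * ((1 + p) * k) := by rw [add_mul, one_mul, mul_add, ← mul_assoc y p k]
        _ = y := by rw [hk1, mul_one]
    calc y * k = Y * (1 + y * star y) * (y * k) := by rw [hY1, one_mul]
      _ = _ := by rw [mul_assoc, h1]
  have hykn : ‖y * k‖ ≤ 1 := by
    have h1 : star (y * k) * (y * k) = k * p * k * B.e₀ := by
      rw [star_mul, hks]
      calc k * star y * (y * k) = k * (star y * y) * k := by simp only [mul_assoc]
        _ = k * p * (B.e₀ * k) := by rw [hyy]; simp only [mul_assoc]
        _ = _ := by rw [← e₀_comm hk]; simp only [mul_assoc]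
    have h2 : ‖y * k‖ * ‖y * k‖ ≤ 1 := by
      rw [← CStarRing.norm_star_mul_self, h1,
        norm_mul_e₀ (mul_mem (mul_mem hk hpA) hk)]
      exact hkpk
    nlinarith [norm_nonneg (y * k)]
  have hbk : b * k * B.e₀ = y * k := by rw [mul_assoc, e₀_comm hk, ← mul_assoc]
  refine ⟨(2 : ℂ) • (b * k), N.toStarSubalgebra.smul_mem (mul_mem hb (h0 hk)) _, ?_, ?_⟩
  · rw [smul_mul_assoc, hbk, norm_smul]
    simpa using hykn
  · -- Only the errors of `y` at `w` and of `y⋆` at `z w` enter.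
    have hkey : (y * k) B.Ω - z w = Y (y w - z w) - (Y * y) (star y (z w) - star z (z w)) := by
      have e1 : Y (z w + y (star y (z w))) = z w := DFunLike.congr_fun hY1 (z w)
      have e2 : (y * k) B.Ω = Y (y w) + Y (y (star z (z w))) := by
        rw [hyk, ← hwΩ, map_add]
        rfl
      have e3 : Y (y w - z w) = Y (y w) - Y (z w) := map_sub ..
      have e4 : (Y * y) (star y (z w) - star z (z w))
          = Y (y (star y (z w))) - Y (y (star z (z w))) := map_sub ..
      have e5 : Y (z w) = z w - Y (y (star y (z w))) := by
        rw [eq_sub_iff_add_eq, ← map_add, e1]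
      rw [e2, e3, e4, e5]
      abel
    have hn : ‖(y * k) B.Ω - z w‖ ≤ ε / 5 + ε / 5 := by
      rw [hkey]
      refine (norm_sub_le _ _).trans (add_le_add ?_ ?_)
      · exact (Y.le_of_opNorm_le hYn _).trans (by rw [one_mul]; exact hb1.le)
      · rw [← hyk]
        exact ((y * k).le_of_opNorm_le hykn _).trans (by rw [one_mul]; exact hb2.le)
    have e : ((2 : ℂ) • (b * k)) B.Ω - x B.Ω = (2 : ℂ) • ((y * k) B.Ω - z w) := by
      have : (b * k) B.Ω = (y * k) B.Ω := by
        rw [← hbk]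
        change (b * k) B.Ω = (b * k) (B.e₀ B.Ω)
        rw [e₀_Ω]
      rw [smul_apply, this, hxΩ, smul_sub, ← Complex.coe_smul]
      simp
    rw [e, norm_smul]
    simp only [Complex.norm_ofNat]
    linarith

/-- On bounded sets of the bimodule, convergence to zero at `Ω` makes the lifted squares converge to
zero weakly. -/
theorem tendsto_zero_of_tendsto_Ω {ι : Type*} {l : Filter ι} {T : ι → (H →L[ℂ] H)} {C : ℝ}
    (hT : ∀ i, T i ∈ B.bimod B.A) (hC : ∀ i, ‖T i‖ ≤ C)
    (h : Tendsto (fun i => T i B.Ω) l (𝓝 0)) (ξ η : H) :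
    Tendsto (fun i => ⟪ξ, B.lift (star (T i) * T i) η⟫_ℂ) l (𝓝 0) := by
  have key := tendsto_inner_of_tendsto_Ω (B := B) (l := l) (a := fun i => B.lift (star (T i) * T i))
    (b := 0) (C := |C| * |C|) (fun i => lift_mem _) (zero_mem _) (fun i => ?_) (fun ζ => ?_) ξ η
  · simpa using key
  · rw [(isReduced_ip (hT i) (hT i)).norm_lift, CStarRing.norm_star_mul_self]
    have := (hC i).trans (le_abs_self C)
    gcongr
  · rw [zero_apply, inner_zero_right]
    refine squeeze_zero_norm (a := fun i => ‖ζ‖ * (|C| * ‖T i B.Ω‖)) (fun i => ?_) ?_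
    · rw [(isReduced_ip (hT i) (hT i)).lift_Ω, mul_app]
      refine (norm_inner_le_norm _ _).trans (mul_le_mul_of_nonneg_left ?_ (norm_nonneg _))
      refine ((star (T i)).le_opNorm _).trans ?_
      rw [norm_star]
      exact mul_le_mul_of_nonneg_right ((hC i).trans (le_abs_self C)) (norm_nonneg _)
    · simpa using (h.norm.const_mul |C|).const_mul ‖ζ‖

/-- Elements of the bimodule of `N` are strong limits of sequences in `N e₀`. Boundedness of the
sequence makes convergence at `Ω` sufficient. -/
theorem exists_bounded_seq {N : VonNeumannAlgebra H} (hN : N ≤ B.A) (h0 : B.A₀ ≤ N)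
    {x : H →L[ℂ] H} (hx : x ∈ B.bimod N) :
    ∃ b : ℕ → (H →L[ℂ] H), (∀ n, b n ∈ N) ∧
      ∀ ξ, Tendsto (fun n => (b n * B.e₀) ξ) atTop (𝓝 (x ξ)) := by
  set m : ℝ := ‖x‖ + 1
  have hm0 : 0 < m := by positivity
  have hx' : ((m⁻¹ : ℝ) : ℂ) • x ∈ B.bimod N := (B.bimodSubmodule N).smul_mem _ hx
  have hx1 : ‖((m⁻¹ : ℝ) : ℂ) • x‖ ≤ 1 := by
    rw [norm_smul, Complex.norm_real, Real.norm_of_nonneg (by positivity), inv_mul_le_one₀ hm0]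
    linarith
  choose d hd hd2 hdn using fun n : ℕ =>
    exists_bounded_near hN h0 hx' hx1 (show (0 : ℝ) < 1 / (n + 1) by positivity)
  have hmC : (m : ℂ) ≠ 0 := by exact_mod_cast hm0.ne'
  have hxm : x = (m : ℂ) • (((m⁻¹ : ℝ) : ℂ) • x) := by
    rw [smul_smul, ← Complex.ofReal_mul, mul_inv_cancel₀ hm0.ne', Complex.ofReal_one, one_smul]
  set x' := ((m⁻¹ : ℝ) : ℂ) • x with hx'def
  refine ⟨fun n => (m : ℂ) • d n, fun n => N.toStarSubalgebra.smul_mem (hd n) _, fun ξ => ?_⟩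
  set T : ℕ → (H →L[ℂ] H) := fun n => d n * B.e₀ - x' with hT
  have hTm : ∀ n, T n ∈ B.bimod B.A := fun n =>
    (B.bimodSubmodule B.A).sub_mem (mul_e₀_mem_bimod (hN (hd n))) (bimod_mono hN hx')
  have hTC : ∀ n, ‖T n‖ ≤ 3 := fun n => (norm_sub_le _ _).trans (by linarith [hd2 n])
  have hTΩ : Tendsto (fun n => T n B.Ω) atTop (𝓝 0) := by
    refine squeeze_zero_norm (fun n => ?_) tendsto_one_div_add_atTop_nhds_zero_nat
    rw [hT]
    simp only [sub_apply, mul_app, e₀_Ω]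
    exact (hdn n).le
  have hTξ : Tendsto (fun n => T n ξ) atTop (𝓝 0) := by
    have h1 := tendsto_zero_of_tendsto_Ω hTm hTC hTΩ ξ (B.e₀ ξ)
    have h2 : ∀ n, ⟪ξ, B.lift (star (T n) * T n) (B.e₀ ξ)⟫_ℂ = ((‖T n ξ‖ ^ 2 : ℝ) : ℂ) := by
      intro n
      rw [← mul_app (B.lift _), (isReduced_ip (hTm n) (hTm n)).lift_mul_e₀, mul_app,
        inner_star_right, inner_self_eq_norm_sq_to_K]
      simp
    simp only [h2] at h1
    have h3 : Tendsto (fun n => ‖T n ξ‖ ^ 2) atTop (𝓝 0) := by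
      simpa only [Function.comp_def, Complex.ofReal_re, Complex.zero_re] using
        (Complex.continuous_re.tendsto 0).comp h1
    have h4 := h3.sqrt
    simp only [Real.sqrt_sq (norm_nonneg _), Real.sqrt_zero] at h4
    exact tendsto_zero_iff_norm_tendsto_zero.2 h4
  have := (hTξ.const_smul (m : ℂ)).add_const (x ξ)
  rw [smul_zero, zero_add] at this
  refine this.congr fun n => ?_
  rw [hxm]
  simp [hT, smul_sub]

/-! ### Products of independent elements -/

/-- A pair of algebras containing `A₀` for which products `x y` with `x` in the bimodule of `N` and
`y` in the bimodule of `M` can be formed. -/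
structure IsIndepPair (B : ContinuousBernoulliShift H) (N M : VonNeumannAlgebra H) : Prop where
  le : N ≤ B.A
  le_left : B.A₀ ≤ N
  le_right : B.A₀ ≤ M
  indep : B.IsIndep N M

variable (B) in
/-- Left multiplication by `x` in the bimodule of `N`, as an operator on the closure of `M Ω`
(extended by zero to the orthogonal complement), for `N` independent of `M`. -/
def leftMul (N M : VonNeumannAlgebra H) (x : H →L[ℂ] H) : H →L[ℂ] H :=
  B.indepMul N x (B.proj M)

variable {N M : VonNeumannAlgebra H} {x x' y z z' : H →L[ℂ] H}

theorem IsIndepPair.mono (h : B.IsIndepPair N M) {N' M' : VonNeumannAlgebra H} (hN : N' ≤ N)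
    (hM : M' ≤ M) (hN0 : B.A₀ ≤ N') (hM0 : B.A₀ ≤ M') : B.IsIndepPair N' M' :=
  ⟨hN.trans h.le, hN0, hM0, h.indep.mono hN hM⟩

theorem lift_star_mul (a b : B.A.toStarSubalgebra) :
    B.lift (star ((a : H →L[ℂ] H) * B.e₀) * ((b : H →L[ℂ] H) * B.e₀)) = B.E₀ (star a * b) :=
  lift_eq (E₀_mem _) (star_mul_eq_E₀ a b).symm

theorem IsIndep.inner_apply (h : B.IsIndep N M) (hN : N ≤ B.A) {a b : H →L[ℂ] H} (ha : a ∈ N)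
    (hb : b ∈ N) {ξ η : H} (hξ : ξ ∈ B.orb M) (hη : η ∈ B.orb M) :
    ⟪a ξ, b η⟫_ℂ = ⟪ξ, B.lift (star (a * B.e₀) * (b * B.e₀)) η⟫_ℂ := by
  have h1 := lift_star_mul (B := B) ⟨a, hN ha⟩ ⟨b, hN hb⟩
  have h2 := h (star ⟨a, hN ha⟩ * ⟨b, hN hb⟩) (mul_mem (star_mem ha) hb) ξ hξ η hη
  rw [← h1] at h2
  rw [← h2, ← inner_star_right]
  rfl

theorem tendsto_zero_of_inner_self {E : Type*} [NormedAddCommGroup E] [InnerProductSpace ℂ E]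
    {ι : Type*} {l : Filter ι} {f : ι → E} {g : ι → ℂ}
    (hg : Tendsto g l (𝓝 0)) (h : ∀ i, ⟪f i, f i⟫_ℂ = g i) : Tendsto f l (𝓝 0) := by
  have h1 : Tendsto (fun i => ‖f i‖ ^ 2) l (𝓝 0) := by
    have h2 := (Complex.continuous_re.tendsto 0).comp hg
    refine h2.congr fun i => ?_
    rw [Function.comp_apply, ← h, inner_self_eq_norm_sq_to_K]
    norm_cast
  have h4 := h1.sqrt
  simp only [Real.sqrt_sq (norm_nonneg _), Real.sqrt_zero] at h4
  exact tendsto_zero_iff_norm_tendsto_zero.2 h4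

/-- On bounded sets of the bimodule of `N`, convergence at `Ω` implies convergence on `M Ω`. -/
theorem IsIndepPair.tendsto_apply (h : B.IsIndepPair N M) {ι : Type*} {l : Filter ι}
    {b : ι → (H →L[ℂ] H)} {C : ℝ} (hb : ∀ i, b i ∈ N) (hC : ∀ i, ‖b i * B.e₀‖ ≤ C)
    (h0 : Tendsto (fun i => b i B.Ω) l (𝓝 0)) {η : H} (hη : η ∈ B.orb M) :
    Tendsto (fun i => b i η) l (𝓝 0) := by
  refine tendsto_zero_of_inner_self (tendsto_zero_of_tendsto_Ω (B := B) (l := l)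
    (T := fun i => b i * B.e₀)
    (fun i => mul_e₀_mem_bimod (h.le (hb i))) hC ?_ η η) fun i =>
    h.indep.inner_apply h.le (hb i) (hb i) hη hη
  refine h0.congr fun i => ?_
  rw [mul_app, e₀_Ω]

theorem IsProd.mul_right {N : VonNeumannAlgebra H} (h : B.IsProd N x y z) (w : H →L[ℂ] H) :
    B.IsProd N x (y * w) (z * w) := by
  obtain ⟨b, hb, h1, h2⟩ := h
  exact ⟨b, hb, h1, fun ξ => h2 (w ξ)⟩

/-- The product with the projection onto `M Ω` exists: a bounded approximating sequence is Cauchy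
pointwise, by `IsIndepPair.tendsto_apply`. -/
theorem IsIndepPair.exists_isProd (h : B.IsIndepPair N M) (hx : x ∈ B.bimod N) :
    ∃ z, B.IsProd N x (B.proj M) z := by
  obtain ⟨b, hb, hbx⟩ := exists_bounded_seq h.le h.le_left hx
  obtain ⟨C, hC⟩ := exists_bound_of_tendsto hbx
  have hconv : ∀ ξ, ∃ η, Tendsto (fun n => (b n * B.proj M) ξ) atTop (𝓝 η) := by
    intro ξ
    refine cauchySeq_tendsto_of_complete ?_
    rw [CauchySeq, cauchy_map_iff' , tendsto_uniformity_iff_dist_tendsto_zero]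
    have hb1 : Tendsto (fun n => b n B.Ω) atTop (𝓝 (x B.Ω)) := by
      refine (hbx B.Ω).congr fun n => ?_
      rw [mul_app, e₀_Ω]
    have := h.tendsto_apply (l := atTop ×ˢ atTop) (b := fun p : ℕ × ℕ => b p.1 - b p.2)
      (C := C + C) (fun p => sub_mem (hb _) (hb _)) (fun p => ?_) ?_ (proj_apply_mem (B := B) ξ)
    · refine this.norm.congr' ?_ |>.trans (by rw [norm_zero])
      filter_upwards with p
      rw [dist_eq_norm]
      rfl
    · rw [sub_mul]
      exact (norm_sub_le _ _).trans (add_le_add (hC _) (hC _))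
    · have := (hb1.comp tendsto_fst).sub (hb1.comp (tendsto_snd (f := (atTop : Filter ℕ))
        (g := (atTop : Filter ℕ))))
      rw [sub_self] at this
      exact this
  choose z hz using hconv
  exact ⟨continuousLinearMapOfTendsto (fun n => b n * B.proj M) (tendsto_pi_nhds.2 hz), b, hb, hbx,
    hz⟩

/-- The inner product formula for products, by passing to the limit in the independence relation. -/
theorem IsIndepPair.inner_isProd (h : B.IsIndepPair N M) (hx : x ∈ B.bimod N)
    (hx' : x' ∈ B.bimod N) (hz : B.IsProd N x (B.proj M) z) (hz' : B.IsProd N x' (B.proj M) z')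
    (ξ η : H) :
    ⟪z ξ, z' η⟫_ℂ = ⟪B.proj M ξ, B.lift (star x * x') (B.proj M η)⟫_ℂ := by
  obtain ⟨b, hb, hbx, hbz⟩ := hz
  obtain ⟨b', hb', hbx', hbz'⟩ := hz'
  obtain ⟨C, hC⟩ := exists_bound_of_tendsto hbx
  obtain ⟨C', hC'⟩ := exists_bound_of_tendsto hbx'
  refine tendsto_nhds_unique ((hbz ξ).inner (hbz' η)) ?_
  have e : ∀ n, ⟪(b n * B.proj M) ξ, (b' n * B.proj M) η⟫_ℂ
      = ⟪B.proj M ξ, B.lift (star (b n * B.e₀) * (b' n * B.e₀)) (B.proj M η)⟫_ℂ := fun n =>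
    h.indep.inner_apply h.le (hb n) (hb' n) (proj_apply_mem ξ) (proj_apply_mem η)
  simp only [e]
  have hred := fun n => isReduced_ip (B := B) (mul_e₀_mem_bimod (h.le (hb n)))
    (mul_e₀_mem_bimod (h.le (hb' n)))
  refine tendsto_inner_of_tendsto_Ω (B := B) (C := C * C') (fun n => lift_mem _) (lift_mem _)
    (fun n => ?_) (fun ζ => ?_) _ _
  · rw [(hred n).norm_lift]
    refine (norm_mul_le _ _).trans ?_
    rw [norm_star]
    exact mul_le_mul (hC n) (hC' n) (norm_nonneg _) ((norm_nonneg _).trans (hC n))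
  · rw [(isReduced_ip (bimod_mono h.le hx) (bimod_mono h.le hx')).lift_Ω, mul_app, inner_star_right]
    refine ((hbx ζ).inner (hbx' B.Ω)).congr fun n => ?_
    rw [(hred n).lift_Ω, mul_app (star _), inner_star_right]

theorem IsIndepPair.isProd_unique (h : B.IsIndepPair N M) (hx : x ∈ B.bimod N)
    (hz : B.IsProd N x (B.proj M) z) (hz' : B.IsProd N x (B.proj M) z') : z = z' := by
  refine ContinuousLinearMap.ext fun ξ => sub_eq_zero.1 (inner_self_eq_zero (𝕜 := ℂ).1 ?_)
  rw [inner_sub_left, inner_sub_right, inner_sub_right, h.inner_isProd hx hx hz hz,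
    h.inner_isProd hx hx hz hz', h.inner_isProd hx hx hz' hz, h.inner_isProd hx hx hz' hz']
  simp

theorem IsIndepPair.isProd_leftMul (h : B.IsIndepPair N M) (hx : x ∈ B.bimod N) :
    B.IsProd N x (B.proj M) (B.leftMul N M x) := by
  unfold leftMul indepMul
  rw [dif_pos (h.exists_isProd hx)]
  exact (h.exists_isProd hx).choose_spec

theorem IsIndepPair.eq_leftMul (h : B.IsIndepPair N M) (hx : x ∈ B.bimod N)
    (hz : B.IsProd N x (B.proj M) z) : B.leftMul N M x = z :=
  h.isProd_unique hx (h.isProd_leftMul hx) hz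

theorem IsIndepPair.inner_leftMul (h : B.IsIndepPair N M) (hx : x ∈ B.bimod N)
    (hx' : x' ∈ B.bimod N) (ξ η : H) : ⟪B.leftMul N M x ξ, B.leftMul N M x' η⟫_ℂ
      = ⟪B.proj M ξ, B.lift (star x * x') (B.proj M η)⟫_ℂ :=
  h.inner_isProd hx hx' (h.isProd_leftMul hx) (h.isProd_leftMul hx') ξ η

theorem IsIndepPair.leftMul_mul_proj (h : B.IsIndepPair N M) (hx : x ∈ B.bimod N) :
    B.leftMul N M x * B.proj M = B.leftMul N M x := by
  refine (h.eq_leftMul hx ?_).symm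
  have := (h.isProd_leftMul hx).mul_right (B.proj M)
  rwa [proj_mul_proj] at this

/-- The product with an element of the bimodule of `M`, or more generally with an operator whose
range lies in the closure of `M Ω`. -/
theorem IsIndepPair.indepMul_eq (h : B.IsIndepPair N M) (hx : x ∈ B.bimod N)
    (hy : B.proj M * y = y) : B.indepMul N x y = B.leftMul N M x * y := by
  have h1 : B.IsProd N x y (B.leftMul N M x * y) := by
    have := (h.isProd_leftMul hx).mul_right y
    rwa [hy] at this
  have h2 : ∃ z, B.IsProd N x y z := ⟨_, h1⟩
  have h3 : B.IsProd N x y (B.indepMul N x y) := by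
    unfold indepMul
    rw [dif_pos h2]
    exact h2.choose_spec
  obtain ⟨b, hb, hbx, hby⟩ := h1
  obtain ⟨d, hd, hdx, hdy⟩ := h3
  obtain ⟨C, hC⟩ := exists_bound_of_tendsto hbx
  obtain ⟨C', hC'⟩ := exists_bound_of_tendsto hdx
  refine ContinuousLinearMap.ext fun ξ => sub_eq_zero.1 ?_
  have hyξ : y ξ ∈ B.orb M := proj_eq_self_iff.1 (DFunLike.congr_fun hy ξ)
  have h4 := h.tendsto_apply (l := atTop) (b := fun n => d n - b n) (C := C' + C)
    (fun n => sub_mem (hd n) (hb n)) (fun n => ?_) ?_ hyξ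
  · exact tendsto_nhds_unique ((hdy ξ).sub (hby ξ)) h4
  · rw [sub_mul]
    exact (norm_sub_le _ _).trans (add_le_add (hC' _) (hC _))
  · have := (hdx B.Ω).sub (hbx B.Ω)
    simp only [mul_app, e₀_Ω, sub_self] at this
    exact this

theorem IsIndepPair.leftMul_sub (h : B.IsIndepPair N M) (hx : x ∈ B.bimod N)
    (hx' : x' ∈ B.bimod N) :
    B.leftMul N M (x - x') = B.leftMul N M x - B.leftMul N M x' := by
  refine h.eq_leftMul ((B.bimodSubmodule N).sub_mem hx hx') ?_
  obtain ⟨b, hb, hbx, hbz⟩ := h.isProd_leftMul hx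
  obtain ⟨b', hb', hbx', hbz'⟩ := h.isProd_leftMul hx'
  exact ⟨fun n => b n - b' n, fun n => sub_mem (hb n) (hb' n),
    fun ξ => (hbx ξ).sub (hbx' ξ), fun ξ => (hbz ξ).sub (hbz' ξ)⟩

theorem IsIndepPair.leftMul_add (h : B.IsIndepPair N M) (hx : x ∈ B.bimod N)
    (hx' : x' ∈ B.bimod N) :
    B.leftMul N M (x + x') = B.leftMul N M x + B.leftMul N M x' := by
  refine h.eq_leftMul ((B.bimodSubmodule N).add_mem hx hx') ?_
  obtain ⟨b, hb, hbx, hbz⟩ := h.isProd_leftMul hx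
  obtain ⟨b', hb', hbx', hbz'⟩ := h.isProd_leftMul hx'
  exact ⟨fun n => b n + b' n, fun n => add_mem (hb n) (hb' n),
    fun ξ => (hbx ξ).add (hbx' ξ), fun ξ => (hbz ξ).add (hbz' ξ)⟩

theorem IsIndepPair.leftMul_smul (h : B.IsIndepPair N M) (hx : x ∈ B.bimod N) (r : ℂ) :
    B.leftMul N M (r • x) = r • B.leftMul N M x := by
  refine h.eq_leftMul ((B.bimodSubmodule N).smul_mem r hx) ?_
  obtain ⟨b, hb, hbx, hbz⟩ := h.isProd_leftMul hx
  exact ⟨fun n => r • b n, fun n => N.toStarSubalgebra.smul_mem (hb n) r,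
    fun ξ => (hbx ξ).const_smul r, fun ξ => (hbz ξ).const_smul r⟩

theorem IsIndepPair.leftMul_mul (h : B.IsIndepPair N M) {a : H →L[ℂ] H} (ha : a ∈ N)
    (hx : x ∈ B.bimod N) : B.leftMul N M (a * x) = a * B.leftMul N M x := by
  refine h.eq_leftMul (mul_mem_bimod ha hx) ?_
  obtain ⟨b, hb, hbx, hbz⟩ := h.isProd_leftMul hx
  exact ⟨fun n => a * b n, fun n => mul_mem ha (hb n),
    fun ξ => (a.continuous.tendsto _).comp (hbx ξ), fun ξ => (a.continuous.tendsto _).comp (hbz ξ)⟩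

theorem IsIndepPair.leftMul_e₀ (h : B.IsIndepPair N M) : B.leftMul N M B.e₀ = B.proj M :=
  h.eq_leftMul (e₀_mem_bimod N) ⟨fun _ => 1, fun _ => one_mem N, fun ξ => by
    simp only [one_mul]; exact tendsto_const_nhds, fun ξ => by
    simp only [one_mul]; exact tendsto_const_nhds⟩

theorem proj_mul_of_le {M M' : VonNeumannAlgebra H} (h : M ≤ M') :
    B.proj M' * B.proj M = B.proj M :=
  ContinuousLinearMap.ext fun ξ => proj_eq_self_iff.2 (orb_mono h (proj_apply_mem ξ))

theorem proj_mul_bimod {M : VonNeumannAlgebra H} (h : B.A₀ ≤ M) (hy : y ∈ B.bimod M) :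
    B.proj M * y = y :=
  ContinuousLinearMap.ext fun ξ => proj_eq_self_iff.2 (bimod_apply_mem h hy ξ)

theorem IsIndepPair.leftMul_mul_e₀ (h : B.IsIndepPair N M) (hx : x ∈ B.bimod N) :
    B.leftMul N M x * B.e₀ = x := by
  obtain ⟨b, hb, hbx, hbz⟩ := (h.isProd_leftMul hx).mul_right B.e₀
  rw [e₀_eq, proj_mul_of_le h.le_right, ← e₀_eq] at hbz
  exact ContinuousLinearMap.ext fun ξ => tendsto_nhds_unique (hbz ξ) (hbx ξ)

/-- Left multiplication does not depend on the algebras, up to restriction to a smaller past. -/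
theorem IsIndepPair.leftMul_mono (h : B.IsIndepPair N M) {N' M' : VonNeumannAlgebra H}
    (h' : B.IsIndepPair N' M') (hN : N' ≤ N) (hM : M' ≤ M) (hx : x ∈ B.bimod N') :
    B.leftMul N' M' x = B.leftMul N M x * B.proj M' := by
  have h1 : B.IsIndepPair N M' := h.mono le_rfl hM h.le_left h'.le_right
  have hxN := bimod_mono hN hx
  have e1 : B.leftMul N M' x = B.leftMul N M x * B.proj M' := by
    refine h1.eq_leftMul hxN ?_
    have := (h.isProd_leftMul hxN).mul_right (B.proj M')
    rwa [proj_mul_of_le hM] at this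
  rw [← e1]
  obtain ⟨b, hb, hbx, hbz⟩ := h'.isProd_leftMul hx
  exact (h1.eq_leftMul hxN ⟨b, fun n => hN (hb n), hbx, hbz⟩).symm

theorem IsIndepPair.leftMul_mul_mem_bimod (h : B.IsIndepPair N M) {W : VonNeumannAlgebra H}
    (hN : N ≤ W) (hx : x ∈ B.bimod N) (hM : B.proj M * y = y) (hy : y ∈ B.bimod W) :
    B.leftMul N M x * y ∈ B.bimod W := by
  obtain ⟨b, hb, -, hbz⟩ := (h.isProd_leftMul hx).mul_right y
  rw [hM] at hbz
  exact mem_stopClosure_of_tendsto (fun n => mul_mem_bimod (hN (hb n)) hy) hbz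

theorem IsIndepPair.leftMul_apply_mem (h : B.IsIndepPair N M) {W : VonNeumannAlgebra H}
    (hN : N ≤ W) (hM : M ≤ W) (hx : x ∈ B.bimod N) (ξ : H) : B.leftMul N M x ξ ∈ B.orb W := by
  obtain ⟨b, hb, -, hbz⟩ := h.isProd_leftMul hx
  exact (isClosed_orb W).mem_of_tendsto (hbz ξ) (Eventually.of_forall fun n =>
    apply_mem_orb (hN (hb n)) (orb_mono hM (proj_apply_mem ξ)))

/-- Elements with vanishing conditional expectation are orthogonal to the past. -/
theorem IsIndepPair.inner_leftMul_of_centred (h : B.IsIndepPair N M) (hx : x ∈ B.bimod N)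
    (h0 : B.e₀ * x = 0) {ξ : H} (hξ : ξ ∈ B.orb M) (η : H) : ⟪ξ, B.leftMul N M x η⟫_ℂ = 0 := by
  have h1 := h.inner_leftMul (e₀_mem_bimod N) hx ξ η
  rw [h.leftMul_e₀, proj_eq_self_iff.2 hξ, star_e₀, h0, lift_zero] at h1
  rw [h1, zero_apply, inner_zero_right]

theorem IsIndepPair.norm_leftMul_mul (h : B.IsIndepPair N M) (hx : x ∈ B.bimod N)
    (y : H →L[ℂ] H) : ‖B.leftMul N M x * y‖ ≤ ‖x‖ * ‖y‖ := by
  have hxA := bimod_mono h.le hx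
  have h1 : ∀ ξ, ‖B.leftMul N M x ξ‖ ≤ ‖x‖ * ‖ξ‖ := by
    intro ξ
    have h2 : ‖B.leftMul N M x ξ‖ ^ 2 ≤ (‖x‖ * ‖ξ‖) ^ 2 := by
      have h3 : ‖B.leftMul N M x ξ‖ ^ 2
          = ‖⟪B.leftMul N M x ξ, B.leftMul N M x ξ⟫_ℂ‖ := by
        rw [inner_self_eq_norm_sq_to_K]; simp
      have h4 : ‖B.proj M ξ‖ ≤ ‖ξ‖ := Submodule.norm_starProjection_apply_le _ ξ
      rw [h3, h.inner_leftMul hx hx]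
      refine (norm_inner_le_norm _ _).trans ?_
      have h5 := (B.lift (star x * x)).le_opNorm (B.proj M ξ)
      rw [(isReduced_ip hxA hxA).norm_lift, CStarRing.norm_star_mul_self] at h5
      calc ‖B.proj M ξ‖ * ‖B.lift (star x * x) (B.proj M ξ)‖
          ≤ ‖ξ‖ * (‖x‖ * ‖x‖ * ‖ξ‖) := by gcongr; exact h5.trans (by gcongr)
        _ = _ := by ring
    exact (pow_le_pow_iff_left₀ (norm_nonneg _) (by positivity) two_ne_zero).1 h2
  exact (norm_mul_le _ _).trans (mul_le_mul_of_nonneg_right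
    (ContinuousLinearMap.opNorm_le_bound _ (norm_nonneg _) h1) (norm_nonneg _))

/-- Left multiplication is strongly continuous on bounded sets. -/
theorem IsIndepPair.tendsto_leftMul (h : B.IsIndepPair N M) {w : ℕ → (H →L[ℂ] H)}
    (hw : ∀ n, w n ∈ B.bimod N) (hx : x ∈ B.bimod N)
    (hwx : ∀ ξ, Tendsto (fun n => w n ξ) atTop (𝓝 (x ξ))) (ξ : H) :
    Tendsto (fun n => B.leftMul N M (w n) ξ) atTop (𝓝 (B.leftMul N M x ξ)) := by
  obtain ⟨C, hC⟩ := exists_bound_of_tendsto hwx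
  have hm : ∀ n, w n - x ∈ B.bimod N := fun n => (B.bimodSubmodule N).sub_mem (hw n) hx
  have h1 : Tendsto (fun n => B.leftMul N M (w n - x) ξ) atTop (𝓝 0) := by
    refine tendsto_zero_of_inner_self (tendsto_zero_of_tendsto_Ω (B := B) (l := atTop)
      (T := fun n => w n - x) (C := C + ‖x‖) (fun n => bimod_mono h.le (hm n))
      (fun n => (norm_sub_le _ _).trans (add_le_add_left (hC n) _)) ?_
      (B.proj M ξ) (B.proj M ξ)) fun n => h.inner_leftMul (hm n) (hm n) ξ ξ
    have := (hwx B.Ω).sub_const (x B.Ω)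
    rw [sub_self] at this
    exact this
  have h2 := h1.add_const (B.leftMul N M x ξ)
  rw [zero_add] at h2
  refine h2.congr fun n => ?_
  rw [h.leftMul_sub (hw n) hx, sub_apply, sub_add_cancel]

/-- Associativity of the product for three successive algebras. -/
theorem IsIndepPair.leftMul_leftMul {N' M' W : VonNeumannAlgebra H} (h : B.IsIndepPair N M)
    (h' : B.IsIndepPair N' M') (hW : B.IsIndepPair W M) (hN : N ≤ M') (hM : M ≤ M') (hNW : N ≤ W)
    (hNW' : N' ≤ W) (hx : x ∈ B.bimod N') (hy : y ∈ B.bimod N) :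
    B.leftMul W M (B.leftMul N' M' x * y) = B.leftMul N' M' x * B.leftMul N M y := by
  have hyM : B.proj M' * y = y := proj_mul_bimod h'.le_right (bimod_mono hN hy)
  have hmem := h'.leftMul_mul_mem_bimod hNW' hx hyM (bimod_mono hNW hy)
  have hWN : B.leftMul W M y = B.leftMul N M y := by
    rw [hW.leftMul_mono h hNW le_rfl hy, hW.leftMul_mul_proj (bimod_mono hNW hy)]
  have hran : B.proj M' * B.leftMul N M y = B.leftMul N M y :=
    ContinuousLinearMap.ext fun ξ => proj_eq_self_iff.2 (h.leftMul_apply_mem hN hM hy ξ)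
  obtain ⟨b, hb, -, hbz⟩ := h'.isProd_leftMul hx
  refine ContinuousLinearMap.ext fun ξ => ?_
  have h1 : ∀ η, Tendsto (fun n => (b n * y) η) atTop (𝓝 ((B.leftMul N' M' x * y) η)) := by
    intro η
    refine (hbz (y η)).congr fun n => ?_
    rw [mul_app, ← mul_app (B.proj M'), hyM, mul_app]
  have h2 := hW.tendsto_leftMul (fun n => mul_mem_bimod (hNW' (hb n)) (bimod_mono hNW hy)) hmem h1 ξ
  refine tendsto_nhds_unique h2 ((hbz (B.leftMul N M y ξ)).congr fun n => ?_)
  rw [hW.leftMul_mul (hNW' (hb n)) (bimod_mono hNW hy), hWN, mul_app, mul_app,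
    ← mul_app (B.proj M'), hran]

/-! ### Intervals -/

theorem isIndepPair_Icc_Iic (s t : ℝ) : B.IsIndepPair (B.alg (Icc s t)) (B.alg (Iic s)) :=
  ⟨B.alg_le _ ordConnected_Icc, B.A₀_le_alg _ ordConnected_Icc, B.A₀_le_alg _ ordConnected_Iic,
    isIndep_adjacent s t⟩

theorem alg_Icc_mono {s t s' t' : ℝ} (hs : s' ≤ s) (ht : t ≤ t') :
    B.alg (Icc s t) ≤ B.alg (Icc s' t') :=
  B.alg_mono _ _ ordConnected_Icc ordConnected_Icc (Icc_subset_Icc hs ht)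

theorem alg_Iic_mono {s t : ℝ} (h : s ≤ t) : B.alg (Iic s) ≤ B.alg (Iic t) :=
  B.alg_mono _ _ ordConnected_Iic ordConnected_Iic (Iic_subset_Iic.2 h)

theorem alg_Icc_le_Iic (s t : ℝ) : B.alg (Icc s t) ≤ B.alg (Iic t) :=
  B.alg_mono _ _ ordConnected_Icc ordConnected_Iic Icc_subset_Iic_self

theorem U_mul_mem_Icc {s t : ℝ} (r : ℝ) (hx : x ∈ B.bimod (B.alg (Icc s t))) :
    B.U r * x ∈ B.bimod (B.alg (Icc (s + r) (t + r))) := by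
  have := U_mul_mem_bimod r ordConnected_Icc hx
  rwa [image_add_const_Icc] at this

theorem U_mul_leftMul (r s t : ℝ) (hx : x ∈ B.bimod (B.alg (Icc s t))) :
    B.U r * B.leftMul (B.alg (Icc s t)) (B.alg (Iic s)) x
      = B.leftMul (B.alg (Icc (s + r) (t + r))) (B.alg (Iic (s + r))) (B.U r * x) * B.U r := by
  have hA := B.alg_le (Icc s t) ordConnected_Icc
  obtain ⟨b, hb, hbx, hbz⟩ := (isIndepPair_Icc_Iic s t).isProd_leftMul hx
  have hS : ∀ n ξ, (B.S r ⟨b n, hA (hb n)⟩ : H →L[ℂ] H) (B.U r ξ) = B.U r (b n ξ) := fun n ξ =>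
    (DFunLike.congr_fun (U_mul r ⟨b n, hA (hb n)⟩) ξ).symm
  have key := (isIndepPair_Icc_Iic (s + r) (t + r)).eq_leftMul (U_mul_mem_Icc r hx)
    (z := B.U r * B.leftMul (B.alg (Icc s t)) (B.alg (Iic s)) x * B.U (-r))
    ⟨fun n => B.S r ⟨b n, hA (hb n)⟩, fun n => ?_, fun ξ => ?_, fun ξ => ?_⟩
  · rw [key, mul_assoc _ (B.U (-r)), U_neg_mul_U, mul_one]
  · have := (B.covariant r _ ordConnected_Icc ⟨b n, hA (hb n)⟩).1 (hb n)
    rwa [image_add_const_Icc] at this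
  · refine (((B.U r).continuous.tendsto _).comp (hbx ξ)).congr fun n => ?_
    rw [Function.comp_apply, mul_app, ← hS, mul_app, ← mul_app (B.U r), U_mul_e₀]
  · refine (((B.U r).continuous.tendsto _).comp (hbz (B.U (-r) ξ))).congr fun n => ?_
    have h1 := DFunLike.congr_fun (U_mul_proj (B := B) s r) (B.U (-r) ξ)
    have h2 : B.U r (B.U (-r) ξ) = ξ := DFunLike.congr_fun (U_mul_U_neg r) ξ
    rw [mul_app, mul_app, h2] at h1
    rw [Function.comp_apply, mul_app, ← hS, mul_app, h1]

end ContinuousBernoulliShift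

/-! ### The noise of an additive cocycle -/

/-- Cauchy's functional equation on the half line. -/
theorem eq_smul_of_additive {E : Type*} [NormedAddCommGroup E] [NormedSpace ℝ E] {f : ℝ → E}
    (hf : ContinuousOn f (Ici 0)) (h : ∀ s t, 0 ≤ s → 0 ≤ t → f (s + t) = f s + f t) {t : ℝ}
    (ht : 0 ≤ t) : f t = t • f 1 := by
  have h0 : f 0 = 0 := by simpa using h 0 0 le_rfl le_rfl
  have hp : ∀ s : ℝ, (0 : ℝ) ≤ max s 0 := fun s => le_max_right _ _
  let g : ℝ →+ E :=
    { toFun := fun s => f (max s 0) - f (max (-s) 0)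
      map_zero' := by simp
      map_add' := by
        intro s t
        have e : max (s + t) 0 + (max (-s) 0 + max (-t) 0)
            = max (-(s + t)) 0 + (max s 0 + max t 0) := by
          have key : ∀ x : ℝ, max x 0 = x + max (-x) 0 := by
            intro x
            rcases le_total x 0 with h1 | h1
            · rw [max_eq_right h1, max_eq_left (neg_nonneg.2 h1), add_neg_cancel]
            · rw [max_eq_left h1, max_eq_right (neg_nonpos.2 h1), add_zero]
          rw [key (s + t), key s, key t]
          ring
        have e2 := congrArg f e
        rw [h _ _ (hp _) (add_nonneg (hp _) (hp _)), h _ _ (hp _) (hp _),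
          h _ _ (hp _) (add_nonneg (hp _) (hp _)), h _ _ (hp _) (hp _)] at e2
        rw [sub_add_sub_comm, sub_eq_sub_iff_add_eq_add, e2, add_comm] }
  have hg : Continuous g := by
    have hc : ∀ v : ℝ → ℝ, Continuous v → Continuous fun s => f (max (v s) 0) := fun v hv =>
      hf.comp_continuous (by fun_prop) fun s => hp _
    exact (hc _ continuous_id).sub (hc _ continuous_neg)
  have h1 : ∀ s, 0 ≤ s → g s = f s := by
    intro s hs
    change f (max s 0) - f (max (-s) 0) = f s
    rw [max_eq_left hs, max_eq_right (by linarith), h0, sub_zero]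
  have h2 := (g.toRealLinearMap hg).map_smul t 1
  rw [smul_eq_mul, mul_one] at h2
  rw [← h1 t ht, ← h1 1 zero_le_one]
  exact h2

namespace ContinuousBernoulliShift

variable {H : Type*} [NormedAddCommGroup H] [InnerProductSpace ℂ H] [CompleteSpace H]
variable {B : ContinuousBernoulliShift H}

variable (B) in
/-- Left multiplication by the increment `c t - c s` on the closure of the past `A_{(-∞, s]} Ω`. -/
def noise (c : ℝ → (H →L[ℂ] H)) (s t : ℝ) : H →L[ℂ] H :=
  B.leftMul (B.alg (Icc s t)) (B.alg (Iic s)) (c t - c s)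

namespace IsCentredAdditiveCocycle

variable {c : ℝ → (H →L[ℂ] H)} (hc : B.IsCentredAdditiveCocycle c)
include hc

theorem zero : c 0 = 0 := by
  have := hc.cocycle 0 0 le_rfl le_rfl
  rw [add_zero, U_zero, one_mul] at this
  simpa using this

theorem sub_eq {s t : ℝ} (hs : 0 ≤ s) (hst : s ≤ t) : c t - c s = B.U s * c (t - s) := by
  have := hc.cocycle (t - s) s (sub_nonneg.2 hst) hs
  rw [add_sub_cancel] at this
  rw [this, add_sub_cancel_left]

theorem sub_mem {s t : ℝ} (hs : 0 ≤ s) (hst : s ≤ t) : c t - c s ∈ B.bimod (B.alg (Icc s t)) := by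
  have := U_mul_mem_Icc s (hc.adapted (t - s) (sub_nonneg.2 hst))
  rwa [zero_add, sub_add_cancel, ← hc.sub_eq hs hst] at this

theorem e₀_mul_sub {s t : ℝ} (hs : 0 ≤ s) (hst : s ≤ t) : B.e₀ * (c t - c s) = 0 := by
  rw [mul_sub, hc.centred t (hs.trans hst), hc.centred s hs, sub_zero]

theorem U_mul_sub {s t r : ℝ} (hs : 0 ≤ s) (ht : 0 ≤ t) (hr : 0 ≤ r) :
    B.U r * (c t - c s) = c (t + r) - c (s + r) := by
  rw [add_comm t, add_comm s, hc.cocycle t r ht hr, hc.cocycle s r hs hr, mul_sub]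
  abel

/-- Increments are orthogonal to the past, also with coefficients from `A₀`. -/
theorem past_mul_increment {a : H →L[ℂ] H} (ha : a ∈ B.A₀) {s t : ℝ} (hs : 0 ≤ s) (ht : 0 ≤ t) :
    star (c t) * (a * (B.U t * c s)) = 0 := by
  have hp := isIndepPair_Icc_Iic (B := B) t (t + s)
  have h1 := hc.sub_mem ht (le_add_of_nonneg_right hs : t ≤ t + s)
  have h2 := hc.sub_eq ht (le_add_of_nonneg_right hs : t ≤ t + s)
  rw [add_sub_cancel_left] at h2
  rw [h2] at h1
  have h3 := mul_mem_bimod (hp.le_left ha) h1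
  have h4 : B.e₀ * (a * (B.U t * c s)) = 0 := by
    rw [← mul_assoc, ← e₀_comm ha, mul_assoc, ← mul_assoc B.e₀, e₀_mul_U, hc.centred s hs, mul_zero]
  refine ContinuousLinearMap.ext fun η => ext_inner_left ℂ fun ξ => ?_
  rw [mul_app (star (c t)), inner_star_right, ← hp.leftMul_mul_e₀ h3, mul_app (B.leftMul _ _ _),
    hp.inner_leftMul_of_centred h3 h4, zero_apply, inner_zero_right]
  exact orb_mono (alg_Icc_le_Iic 0 t)
    (bimod_apply_mem (B.A₀_le_alg _ ordConnected_Icc) (hc.adapted t ht) ξ)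

/-- The covariance of `c t` is linear in `t`, as increments over adjacent intervals are orthogonal
and the covariance is invariant under the shift. -/
theorem covariance {a : H →L[ℂ] H} (ha : a ∈ B.A₀) {t : ℝ} (ht : 0 ≤ t) :
    star (c t) * (a * c t) = t • (star (c 1) * (a * c 1)) := by
  refine eq_smul_of_additive (f := fun t => star (c t) * (a * c t)) ?_ (fun s t hs ht => ?_) ht
  · exact hc.cont.star.mul (continuousOn_const.mul hc.cont)
  · have h1 := hc.past_mul_increment ha ht hs
    have h2 := congrArg star (hc.past_mul_increment (star_mem ha) ht hs)
    simp only [star_mul, star_star, star_zero, mul_assoc] at h2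
    have h3 : star (c t) * (star (B.U s) * (a * (B.U s * c t))) = star (c t) * (a * c t) := by
      rw [← mul_assoc a, ← U_comm ha, mul_assoc, ← mul_assoc (star (B.U s)), star_U_mul_U, one_mul]
    rw [hc.cocycle t s ht hs, star_add, star_mul, add_mul, mul_add, mul_add, mul_add, h1]
    simp only [mul_assoc]
    rw [h2, h3]
    abel

theorem lift_sub {s t : ℝ} (hs : 0 ≤ s) (hst : s ≤ t) :
    B.lift (star (c t - c s) * (c t - c s)) = ((t - s : ℝ) : ℂ) • B.lift (star (c 1) * c 1) := by
  have h1A := bimod_mono (B.alg_le _ ordConnected_Icc) (hc.adapted 1 zero_le_one)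
  refine lift_eq (B.A₀.toStarSubalgebra.smul_mem (lift_mem _) _) ?_
  have h2 := hc.covariance (one_mem B.A₀) (sub_nonneg.2 hst)
  rw [one_mul, one_mul] at h2
  rw [smul_mul_assoc, (isReduced_ip h1A h1A).lift_mul_e₀, hc.sub_eq hs hst, star_mul, mul_assoc,
    ← mul_assoc (star (B.U s)), star_U_mul_U, one_mul, h2, Complex.coe_smul]

theorem noise_mul {s t : ℝ} (hs : 0 ≤ s) (hst : s ≤ t) {x : H →L[ℂ] H}
    (hx : B.proj (B.alg (Iic s)) * x = x) :
    B.indepMul (B.alg (Icc s t)) (c t - c s) x = B.noise c s t * x :=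
  (isIndepPair_Icc_Iic s t).indepMul_eq (hc.sub_mem hs hst) hx

/-- Additivity uses that the increments over `[r, s]` and `[s, t]` act on the past of `r` in the
same way when regarded as elements of the bimodule for `[r, t]`. -/
theorem orthogonalNoise : OrthogonalNoise (fun s => B.orb (B.alg (Iic s))) (B.noise c)
    (B.lift (star (c 1) * c 1)) where
  mono := fun _ _ h => orb_mono (alg_Iic_mono h)
  mem := fun s t hs hst y _ => (isIndepPair_Icc_Iic s t).leftMul_apply_mem (alg_Icc_le_Iic s t)
    (alg_Iic_mono hst) (hc.sub_mem hs hst) y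
  orth := fun s t hs hst y _ z hz => (isIndepPair_Icc_Iic s t).inner_leftMul_of_centred
    (hc.sub_mem hs hst) (hc.e₀_mul_sub hs hst) hz y
  add := by
    intro r s t hr hrs hst y hy
    have hyp := proj_eq_self_iff.2 hy
    have hrt := isIndepPair_Icc_Iic (B := B) r t
    have hs := hr.trans hrs
    have h1 := hc.sub_mem hr hrs
    have h2 := hc.sub_mem hs hst
    have e : c t - c r = (c s - c r) + (c t - c s) := by abel
    have l1 := alg_Icc_mono (B := B) (le_refl r) hst
    have l2 := alg_Icc_mono (B := B) hrs (le_refl t)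
    have hst' : B.IsIndepPair (B.alg (Icc s t)) (B.alg (Iic r)) :=
      hrt.mono l2 le_rfl (B.A₀_le_alg _ ordConnected_Icc) hrt.le_right
    have k1 := hrt.leftMul_mono (isIndepPair_Icc_Iic r s) l1 le_rfl h1
    have k2 := hrt.leftMul_mono hst' l2 le_rfl h2
    have k3 := (isIndepPair_Icc_Iic s t).leftMul_mono hst' le_rfl (alg_Iic_mono hrs) h2
    have k4 := DFunLike.congr_fun (k3.symm.trans k2) y
    have k5 := DFunLike.congr_fun k1 y
    rw [mul_app, mul_app, hyp] at k4
    rw [mul_app, hyp] at k5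
    rw [noise, noise, noise, k4, k5, e, hrt.leftMul_add (bimod_mono l1 h1) (bimod_mono l2 h2),
      add_apply]
  cov := by
    intro s t hs hst y hy z hz
    have h1 := hc.sub_mem hs hst
    rw [noise, (isIndepPair_Icc_Iic s t).inner_leftMul h1 h1, proj_eq_self_iff.2 hy,
      proj_eq_self_iff.2 hz, hc.lift_sub hs hst, smul_apply, inner_smul_right]

theorem adaptedClass {K : H →L[ℂ] H} (hK : K ∈ B.A₀) :
    AdaptedClass (fun s => B.orb (B.alg (Iic s))) (B.noise c) K
      (fun t => B.bimodSubmodule (B.alg (Icc 0 t))) where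
  isClosed := fun _ => isClosed_bimodSubmodule _
  mono := fun _ _ h => bimod_mono (alg_Icc_mono le_rfl h)
  range := fun t _ _ hx ξ => orb_mono (alg_Icc_le_Iic 0 t)
    (bimod_apply_mem (B.A₀_le_alg _ ordConnected_Icc) hx ξ)
  noise := fun s t hs hst _ hx => (isIndepPair_Icc_Iic s t).leftMul_mul_mem_bimod
    (alg_Icc_mono hs le_rfl) (hc.sub_mem hs hst)
    (proj_mul_bimod (B.A₀_le_alg _ ordConnected_Iic) (bimod_mono (alg_Icc_le_Iic 0 s) hx))
    (bimod_mono (alg_Icc_mono le_rfl hst) hx)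
  drift := fun _ _ _ hx => mul_mem_bimod (B.A₀_le_alg _ ordConnected_Icc hK) hx

theorem e₀_mul_noise {s t : ℝ} (hs : 0 ≤ s) (hst : s ≤ t) : B.e₀ * B.noise c s t = 0 := by
  refine ContinuousLinearMap.ext fun η => ext_inner_left ℂ fun ξ => ?_
  rw [mul_app, ← inner_e₀_left, noise, (isIndepPair_Icc_Iic s t).inner_leftMul_of_centred
    (hc.sub_mem hs hst) (hc.e₀_mul_sub hs hst), zero_apply, inner_zero_right]
  exact orb_mono (B.A₀_le_alg _ ordConnected_Iic) (proj_apply_mem (N := B.A₀) ξ)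

theorem noise_mul_e₀ {s t : ℝ} (hs : 0 ≤ s) (hst : s ≤ t) : B.noise c s t * B.e₀ = c t - c s :=
  (isIndepPair_Icc_Iic s t).leftMul_mul_e₀ (hc.sub_mem hs hst)

theorem U_mul_noise {s t r : ℝ} (hs : 0 ≤ s) (hst : s ≤ t) (hr : 0 ≤ r) :
    B.U r * B.noise c s t = B.noise c (s + r) (t + r) * B.U r := by
  rw [noise, U_mul_leftMul r s t (hc.sub_mem hs hst), hc.U_mul_sub hs (hs.trans hst) hr, noise]

/-- Multiplying first `y` and then a later increment into the past of `r` is the same as multiplying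
their product, shifted by `r`. -/
theorem leftMul_noise {s t r : ℝ} (hs : 0 ≤ s) (hst : s ≤ t) (hr : 0 ≤ r) {y : H →L[ℂ] H}
    (hy : y ∈ B.bimod (B.alg (Icc 0 s))) :
    B.leftMul (B.alg (Icc r (t + r))) (B.alg (Iic r)) (B.U r * (B.noise c s t * y))
      = B.noise c (s + r) (t + r)
        * B.leftMul (B.alg (Icc r (s + r))) (B.alg (Iic r)) (B.U r * y) := by
  have hyr := U_mul_mem_Icc r hy
  rw [zero_add] at hyr
  rw [← mul_assoc, hc.U_mul_noise hs hst hr, mul_assoc]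
  refine IsIndepPair.leftMul_leftMul (isIndepPair_Icc_Iic r (s + r))
    (isIndepPair_Icc_Iic (s + r) (t + r)) (isIndepPair_Icc_Iic r (t + r)) (alg_Icc_le_Iic _ _)
    (alg_Iic_mono (by linarith)) (alg_Icc_mono le_rfl (by linarith))
    (alg_Icc_mono (by linarith) le_rfl) (hc.sub_mem (by linarith) (by linarith)) hyr

end IsCentredAdditiveCocycle

end ContinuousBernoulliShift

/-! ### Piecewise continuous families -/

/-- A function with one-sided limits is bounded on bounded intervals. -/
theorem exists_bound_of_one_sided_limits {E : Type*} [SeminormedAddCommGroup E] {f : ℝ → E}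
    (hr : ∀ t, 0 ≤ t → ∃ l, Tendsto f (𝓝[>] t) (𝓝 l))
    (hl : ∀ t, 0 < t → ∃ l, Tendsto f (𝓝[<] t) (𝓝 l)) (T : ℝ) :
    ∃ C, ∀ s ∈ Icc 0 T, ‖f s‖ ≤ C := by
  have hlim : ∀ {F : Filter ℝ} {l : E}, Tendsto f F (𝓝 l) → ∀ᶠ r in F, ‖f r‖ ≤ ‖l‖ + 1 :=
    fun {F l} h => (h.norm.eventually_lt_const (lt_add_one ‖l‖)).mono fun r hr => hr.le
  refine isCompact_Icc.induction_on (p := fun s => ∃ C, ∀ r ∈ s, ‖f r‖ ≤ C) ⟨0, by simp⟩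
    (fun s t hst ⟨C, hC⟩ => ⟨C, fun r hr => hC r (hst hr)⟩) ?_ ?_
  · rintro s t ⟨C, hC⟩ ⟨C', hC'⟩
    refine ⟨max C C', fun r hr => ?_⟩
    rcases hr with hr | hr
    · exact (hC r hr).trans (le_max_left _ _)
    · exact (hC' r hr).trans (le_max_right _ _)
  · intro t ht
    obtain ⟨l, hl1⟩ := hr t ht.1
    obtain ⟨C, hC⟩ : ∃ C, ∀ᶠ r in 𝓝[<] t, r ∈ Icc 0 T → ‖f r‖ ≤ C := by
      rcases ht.1.eq_or_lt with h0 | h0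
      · refine ⟨0, ?_⟩
        filter_upwards [self_mem_nhdsWithin] with r hr hr'
        have hr : r < t := hr
        linarith [hr'.1]
      · obtain ⟨l', hl'⟩ := hl t h0
        exact ⟨_, (hlim hl').mono fun r hr _ => hr⟩
    refine ⟨{r | ‖f r‖ ≤ max (max C (‖l‖ + 1)) ‖f t‖}, ?_, _, fun r hr => hr⟩
    have h1 : ∀ᶠ r in 𝓝 t, r ∈ Icc 0 T → ‖f r‖ ≤ max (max C (‖l‖ + 1)) ‖f t‖ := by
      rw [← nhdsLT_sup_nhdsGE, ← Ioi_insert, nhdsWithin_insert]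
      refine eventually_sup.2 ⟨hC.mono fun r hr h => ?_, eventually_sup.2 ⟨?_, ?_⟩⟩
      · exact (hr h).trans ((le_max_left _ _).trans (le_max_left _ _))
      · exact fun _ => le_max_right _ _
      · exact (hlim hl1).mono fun r hr _ => hr.trans ((le_max_right _ _).trans (le_max_left _ _))
    exact eventually_nhdsWithin_iff.2 h1

theorem intervalIntegrable_of_piecewise {E : Type*} [NormedAddCommGroup E] {f : ℝ → E} {D : Set ℝ}
    {T C : ℝ} (hT : 0 ≤ T) (hD : D.Finite) (hf : ContinuousOn f (Icc 0 T \ D))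
    (hC : ∀ s ∈ Icc 0 T, ‖f s‖ ≤ C) : IntervalIntegrable f MeasureTheory.volume 0 T := by
  rw [intervalIntegrable_iff_integrableOn_Icc_of_le hT]
  have hm : MeasurableSet (Icc 0 T \ D) := measurableSet_Icc.diff hD.measurableSet
  have h1 : MeasureTheory.IntegrableOn f (Icc 0 T \ D) MeasureTheory.volume := by
    refine MeasureTheory.IntegrableOn.of_bound ?_ (hf.aestronglyMeasurable hm) C ?_
    · exact (MeasureTheory.measure_mono sdiff_subset).trans_lt (by simp)
    · filter_upwards [MeasureTheory.ae_restrict_mem hm] with s hs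
      exact hC s hs.1
  exact h1.congr_set_ae (MeasureTheory.sdiff_null_ae_eq_self (hD.measure_zero _)).symm

namespace ContinuousBernoulliShift

variable {H : Type*} [NormedAddCommGroup H] [InnerProductSpace ℂ H] [CompleteSpace H]
variable {B : ContinuousBernoulliShift H}

theorem piecewiseStopContinuous_of_continuousOn {E : Type*} [NormedAddCommGroup E]
    [InnerProductSpace ℂ E] {x : ℝ → (E →L[ℂ] E)} (hx : ContinuousOn x (Ici 0)) :
    PiecewiseStopContinuous x := by
  have h1 : ∀ t, 0 ≤ t → ∀ ξ : E, ContinuousWithinAt (fun s => x s ξ) (Ici 0) t := fun t ht ξ =>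
    (ContinuousLinearMap.apply ℂ E ξ).continuous.continuousAt.comp_continuousWithinAt (hx t ht)
  refine ⟨fun T => ⟨∅, finite_empty, fun t ht => h1 t ht.1.1⟩, fun t ht ξ => ⟨x t ξ, ?_⟩,
    fun t ht ξ => ⟨x t ξ, ?_⟩⟩
  · exact (h1 t ht ξ).tendsto.mono_left (nhdsWithin_mono _ fun r hr => ht.trans (le_of_lt hr))
  · exact ((h1 t ht.le ξ).continuousAt (Ici_mem_nhds ht)).tendsto.mono_left nhdsWithin_le_nhds

theorem PiecewiseStopContinuous.exists_bound {x : ℝ → (H →L[ℂ] H)} (hx : PiecewiseStopContinuous x)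
    (T : ℝ) : ∃ C, ∀ s ∈ Icc 0 T, ‖x s‖ ≤ C := by
  obtain ⟨C, hC⟩ := banach_steinhaus (g := fun s : Icc 0 T => x s) fun ξ => by
    obtain ⟨C, hC⟩ := exists_bound_of_one_sided_limits (fun t ht => hx.2.1 t ht ξ)
      (fun t ht => hx.2.2 t ht ξ) T
    exact ⟨C, fun s => hC s s.2⟩
  exact ⟨C, fun s hs => hC ⟨s, hs⟩⟩

theorem PiecewiseStopContinuous.intervalIntegrable {x : ℝ → (H →L[ℂ] H)}
    (hx : PiecewiseStopContinuous x) (K : H →L[ℂ] H) (ξ : H) {T : ℝ} (hT : 0 ≤ T) :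
    IntervalIntegrable (fun s => K (x s ξ)) MeasureTheory.volume 0 T := by
  obtain ⟨C, hC⟩ := hx.exists_bound T
  obtain ⟨D, hD, hxD⟩ := hx.1 T
  refine intervalIntegrable_of_piecewise (C := ‖K‖ * (C * ‖ξ‖)) hT hD (fun s hs => ?_) fun s hs => ?_
  · exact K.continuous.continuousAt.comp_continuousWithinAt
      ((hxD s hs ξ).mono (fun r hr => hr.1.1))
  · exact (K.le_opNorm _).trans (mul_le_mul_of_nonneg_left
      ((x s).le_of_opNorm_le (hC s hs) ξ) (norm_nonneg _))

/-! ### The integral equation -/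

theorem isSubdivision_iff {t δ : ℝ} {n : ℕ} {τ : ℕ → ℝ} :
    IsSubdivision 0 t δ (n, τ) ↔ IsPartition t n τ δ :=
  ⟨fun h => ⟨h.left, h.right, fun i hi => ⟨h.lt i hi, h.sub_lt i hi⟩⟩,
    fun h => ⟨h.1, h.2.1, fun i hi => (h.2.2 i hi).1, fun i hi => (h.2.2 i hi).2⟩⟩

theorem IsAdapted.range_mem {x : ℝ → (H →L[ℂ] H)} (hx : B.IsAdapted x) {t : ℝ} (ht : 0 ≤ t)
    (ξ : H) : x t ξ ∈ B.orb (B.alg (Iic t)) :=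
  bimod_apply_mem (B.A₀_le_alg _ ordConnected_Iic) (hx t ht) ξ

namespace IsCentredAdditiveCocycle

variable {c : ℝ → (H →L[ℂ] H)} (hc : B.IsCentredAdditiveCocycle c)
include hc

theorem itoSum_eq {x : ℝ → (H →L[ℂ] H)} (hx : B.IsAdapted x) {t δ : ℝ} {p : ℕ × (ℕ → ℝ)}
    (hp : IsSubdivision 0 t δ p) :
    B.itoSum c x p.1 p.2 = intervalSum (fun s t => B.noise c s t * x s) p := by
  refine Finset.sum_congr rfl fun i hi => ?_
  have hi := Finset.mem_range.1 hi
  have h0 := (hp.mem_Icc hi.le).1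
  exact hc.noise_mul h0 (hp.lt i hi).le
    (proj_mul_bimod (B.A₀_le_alg _ ordConnected_Iic) (hx _ h0))

theorem hasItoIntegral_iff {x : ℝ → (H →L[ℂ] H)} (hx : B.IsAdapted x) {t : ℝ} {I : H →L[ℂ] H} :
    B.HasItoIntegral c x t I ↔ ∀ ξ, Tendsto
      (fun p => intervalSum (fun s t => B.noise c s t * x s) p ξ) (mesh 0 t) (𝓝 (I ξ)) := by
  refine forall_congr' fun ξ => ?_
  rw [(hasBasis_mesh 0 t).tendsto_iff Metric.nhds_basis_ball]
  refine forall₂_congr fun ε _ => exists_congr fun δ => and_congr_right fun _ => ?_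
  constructor
  · intro h p hp
    rw [Metric.mem_ball, dist_eq_norm, ← hc.itoSum_eq hx hp]
    exact h p.1 p.2 (isSubdivision_iff.1 hp)
  · intro h n τ hp
    have hp := isSubdivision_iff.2 hp
    have h1 := h (n, τ) hp
    rwa [Metric.mem_ball, dist_eq_norm, ← hc.itoSum_eq hx hp] at h1

theorem isSolution {K : H →L[ℂ] H} (hK : K ∈ B.A₀) {u : ℝ → (H →L[ℂ] H)}
    (hu : IsProcess (fun t => B.bimodSubmodule (B.alg (Icc 0 t))) u)
    (hsol : ∀ t, 0 ≤ t → u t = B.e₀ + sdeIntegral (B.noise c) K u 0 t) : B.IsSolution c K u := by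
  have had : B.IsAdapted u := fun t ht => bimod_mono (alg_Icc_le_Iic 0 t) (hu.2 t ht)
  refine ⟨⟨had, piecewiseStopContinuous_of_continuousOn hu.1⟩, fun t ht => ?_⟩
  have hcont : ContinuousOn u (Icc 0 t) := hu.1.mono Icc_subset_Ici_self
  obtain ⟨J, hJ⟩ := hc.orthogonalNoise.exists_tendsto_noise le_rfl ht
    (fun s hs ξ => had.range_mem hs.1 ξ) hcont
  have hKu : ContinuousOn (fun s => K * u s) (Icc 0 t) := continuousOn_const.mul hcont
  refine ⟨J, (hc.hasItoIntegral_iff had).2 fun ξ =>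
    ((ContinuousLinearMap.apply ℂ H ξ).continuous.tendsto J).comp hJ, fun ξ => ?_⟩
  have hmesh := mesh_neBot ht
  have h1 : sdeIntegral (B.noise c) K u 0 t = J + ∫ s in (0 : ℝ)..t, K * u s := by
    refine tendsto_nhds_unique
      (tendsto_sdeIntegral hc.orthogonalNoise (hc.adaptedClass hK) hu le_rfl ht)
      ((hJ.add (tendsto_riemannSum ht hKu)).congr fun p => ?_)
    exact (intervalSum_add _ _ p).symm
  have h2 : (∫ s in (0 : ℝ)..t, K * u s) ξ = ∫ s in (0 : ℝ)..t, K (u s ξ) :=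
    ContinuousLinearMap.intervalIntegral_apply
      (ContinuousOn.intervalIntegrable (by rwa [uIcc_of_le ht])) ξ
  rw [hsol t ht, h1, add_apply, add_apply, h2, add_assoc]

/-- The difference of two solutions is halved in the weighted norm, hence vanishes. -/
theorem solution_unique {K : H →L[ℂ] H} {u v : ℝ → (H →L[ℂ] H)} (hu : B.IsSolution c K u)
    (hv : B.IsSolution c K v) {t : ℝ} (ht : 0 ≤ t) : v t = u t := by
  have hD := hc.orthogonalNoise
  set Q := B.lift (star (c 1) * c 1)
  set l := rate Q K with hl
  have hl0 : 0 < l := rate_pos Q K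
  have hlK : 4 * ‖K‖ ≤ l := by rw [hl, rate]; linarith [norm_nonneg Q]
  obtain ⟨Cu, hCu⟩ := hu.1.2.exists_bound t
  obtain ⟨Cv, hCv⟩ := hv.1.2.exists_bound t
  refine sub_eq_zero.1 (eq_zero_of_halving (w := fun s => v s - u s) (T := t) (M₀ := Cv + Cu) hl0
    (fun s hs => (norm_sub_le _ _).trans (add_le_add (hCv s hs) (hCu s hs))) ?_ t
    (right_mem_Icc.2 ht))
  intro M hM hw s hs
  have hmesh := mesh_neBot hs.1
  obtain ⟨I, hI, hIu⟩ := hu.2 s hs.1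
  obtain ⟨J, hJ, hJv⟩ := hv.2 s hs.1
  rw [hc.hasItoIntegral_iff hu.1.1] at hI
  rw [hc.hasItoIntegral_iff hv.1.1] at hJ
  refine ContinuousLinearMap.opNorm_le_bound _ (by positivity) fun ξ => ?_
  have hwξ : ∀ r ∈ Icc 0 s, ‖v r ξ - u r ξ‖ ≤ M * ‖ξ‖ * Real.exp (l * r) := fun r hr =>
    ((v r - u r).le_of_opNorm_le (hw r ⟨hr.1, hr.2.trans hs.2⟩) ξ).trans_eq (by ring)
  -- The Itô integrals exist in the strong sense only, so the estimate is made at the vector `ξ`.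
  have h1 : ‖J ξ - I ξ‖ ≤ M * ‖ξ‖ / 4 * Real.exp (l * s) := by
    refine le_of_tendsto ((hJ ξ).sub (hI ξ)).norm ?_
    filter_upwards [eventually_mesh one_pos] with p hp
    rw [intervalSum_apply, intervalSum_apply, ← intervalSum_sub]
    have := hD.norm_intervalSum_le_exp K le_rfl hp (y := fun r => v r ξ - u r ξ) (M := M * ‖ξ‖)
      (fun r hr => Submodule.sub_mem _ (hv.1.1.range_mem hr.1 ξ) (hu.1.1.range_mem hr.1 ξ))
      (by positivity) hwξ
    refine (congrArg norm (Finset.sum_congr rfl fun i _ => ?_)).trans_le this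
    exact (map_sub (B.noise c _ _) _ _).symm
  have h2 : ‖∫ r in (0 : ℝ)..s, K (v r ξ - u r ξ)‖ ≤ M * ‖ξ‖ / 4 * Real.exp (l * s) := by
    have hint : ∫ r in (0 : ℝ)..s, ‖K‖ * (M * ‖ξ‖) * Real.exp (l * r)
        = ‖K‖ * (M * ‖ξ‖) * ((Real.exp (l * s) - 1) / l) := by
      rw [intervalIntegral.integral_const_mul,
        intervalIntegral.integral_comp_mul_left (fun r => Real.exp r) hl0.ne', integral_exp,
        mul_zero, Real.exp_zero, smul_eq_mul, div_eq_inv_mul]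
    refine (intervalIntegral.norm_integral_le_of_norm_le hs.1
      (g := fun r => ‖K‖ * (M * ‖ξ‖) * Real.exp (l * r)) ?_
      (Continuous.intervalIntegrable (by fun_prop) _ _)).trans ?_
    · filter_upwards with r hr
      refine (K.le_opNorm _).trans ?_
      rw [mul_assoc]
      exact mul_le_mul_of_nonneg_left (hwξ r ⟨hr.1.le, hr.2⟩) (norm_nonneg _)
    · rw [hint, mul_div_assoc', div_le_iff₀ hl0]
      have h3 : 0 ≤ M * ‖ξ‖ * Real.exp (l * s) := by positivity
      have h4 : 0 ≤ ‖K‖ * (M * ‖ξ‖) := by positivity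
      nlinarith [mul_le_mul_of_nonneg_left hlK h3]
  have h3 : (v s - u s) ξ = (J ξ - I ξ) + ∫ r in (0 : ℝ)..s, K (v r ξ - u r ξ) := by
    have e : ∫ r in (0 : ℝ)..s, K (v r ξ - u r ξ)
        = (∫ r in (0 : ℝ)..s, K (v r ξ)) - ∫ r in (0 : ℝ)..s, K (u r ξ) := by
      rw [← intervalIntegral.integral_sub (hv.1.2.intervalIntegrable K ξ hs.1)
        (hu.1.2.intervalIntegrable K ξ hs.1)]
      simp only [map_sub]
    rw [sub_apply, hIu, hJv, e]
    abel
  rw [h3]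
  refine (norm_add_le _ _).trans ((add_le_add h1 h2).trans_eq ?_)
  ring

end IsCentredAdditiveCocycle

/-! ### The cocycle identity -/

theorem IsIndepPair.leftMul_eq_of_le {N N' M : VonNeumannAlgebra H} (h : B.IsIndepPair N M)
    (hN : N' ≤ N) (h0 : B.A₀ ≤ N') {x : H →L[ℂ] H} (hx : x ∈ B.bimod N') :
    B.leftMul N M x = B.leftMul N' M x := by
  rw [h.leftMul_mono (h.mono hN le_rfl h0 h.le_right) hN le_rfl hx,
    h.leftMul_mul_proj (bimod_mono hN hx)]

theorem IsIndepPair.leftMul_sum {N M : VonNeumannAlgebra H} (h : B.IsIndepPair N M) {ι : Type*}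
    (s : Finset ι) (f : ι → (H →L[ℂ] H)) (hf : ∀ i ∈ s, f i ∈ B.bimod N) :
    B.leftMul N M (∑ i ∈ s, f i) = ∑ i ∈ s, B.leftMul N M (f i) := by
  classical
  induction s using Finset.induction_on with
  | empty =>
    have h0 : (0 : H →L[ℂ] H) ∈ B.bimod N := (B.bimodSubmodule N).zero_mem
    have := h.leftMul_sub h0 h0
    rw [sub_self, sub_self] at this
    simpa using this
  | insert i s hi ih =>
    have hs : ∀ j ∈ s, f j ∈ B.bimod N := fun j hj => hf j (Finset.mem_insert_of_mem hj)
    rw [Finset.sum_insert hi, Finset.sum_insert hi, h.leftMul_add (hf i (Finset.mem_insert_self i s))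
      ((B.bimodSubmodule N).sum_mem hs), ih hs]

namespace IsCentredAdditiveCocycle

variable {c : ℝ → (H →L[ℂ] H)} (hc : B.IsCentredAdditiveCocycle c) {K : H →L[ℂ] H} (hK : K ∈ B.A₀)
  {u : ℝ → (H →L[ℂ] H)} (hu : IsProcess (fun t => B.bimodSubmodule (B.alg (Icc 0 t))) u)
  (hsol : ∀ t, 0 ≤ t → u t = B.e₀ + sdeIntegral (B.noise c) K u 0 t)

include hc hu in
theorem leftMul_incr (hK : K ∈ B.A₀) {r s t : ℝ} (hr : 0 ≤ r) (hrs : r ≤ s) (ht : 0 ≤ t) :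
    B.leftMul (B.alg (Icc t (s + t))) (B.alg (Iic t)) (B.U t * incr (B.noise c) K u r s)
      = incr (fun r s => B.noise c (r + t) (s + t)) K
        (fun r => B.leftMul (B.alg (Icc t (r + t))) (B.alg (Iic t)) (B.U t * u r)) r s := by
  have hp := isIndepPair_Icc_Iic (B := B) t (s + t)
  have hle := alg_Icc_mono (B := B) (le_refl t) (show r + t ≤ s + t by linarith)
  have hur := U_mul_mem_Icc t (hu.2 r hr)
  have hus := U_mul_mem_Icc t ((hc.adaptedClass hK).noise r s hr hrs _ (hu.2 r hr))
  rw [zero_add] at hur hus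
  have hmem := bimod_mono hle hur
  have hKm := mul_mem_bimod (hp.le_left hK) hmem
  have e : B.U t * incr (B.noise c) K u r s
      = B.U t * (B.noise c r s * u r) + ((s - r : ℝ) : ℂ) • (K * (B.U t * u r)) := by
    rw [incr, mul_add, ← Complex.coe_smul, mul_smul_comm, ← mul_assoc _ K, U_comm hK, mul_assoc K]
  rw [e, hp.leftMul_add hus ((B.bimodSubmodule _).smul_mem _ hKm), hp.leftMul_smul hKm,
    hp.leftMul_mul (hp.le_left hK) hmem, hc.leftMul_noise hr hrs ht (hu.2 r hr),
    hp.leftMul_eq_of_le hle (B.A₀_le_alg _ ordConnected_Icc) hur, incr, Complex.coe_smul]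

include hc hK hu hsol

/-- Both sides of the cocycle identity, as functions of `s`, solve the integral equation for the
shifted noise with initial value `u t`. -/
theorem cocycleIdentity : B.CocycleIdentity u := by
  intro s t hs ht
  have hcl := hc.adaptedClass hK
  have hD := hc.orthogonalNoise
  have hut := hu.2 t ht
  have hutP : B.proj (B.alg (Iic t)) * u t = u t :=
    proj_mul_bimod (B.A₀_le_alg _ ordConnected_Iic) (bimod_mono (alg_Icc_le_Iic 0 t) hut)
  have hU : ∀ r, 0 ≤ r → B.U t * u r ∈ B.bimod (B.alg (Icc t (r + t))) := fun r hr => by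
    have := U_mul_mem_Icc t (hu.2 r hr)
    rwa [zero_add] at this
  have hp := fun r => isIndepPair_Icc_Iic (B := B) t (r + t)
  set L : ℝ → (H →L[ℂ] H) := fun r =>
    B.leftMul (B.alg (Icc t (r + t))) (B.alg (Iic t)) (B.U t * u r) with hL
  -- The increments of `u (r + t)` satisfy the equation for the shifted noise.
  have hshift : ∀ r, 0 ≤ r → Tendsto (intervalSum (incr (fun r s => B.noise c (r + t) (s + t)) K
      fun r => u (r + t))) (mesh 0 r) (𝓝 (u (r + t) - u t)) := by
    intro r hr
    have h1 := tendsto_sdeIntegral hD hcl hu ht (show t ≤ r + t by linarith)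
    have h2 : sdeIntegral (B.noise c) K u t (r + t) = u (r + t) - u t := by
      rw [hsol (r + t) (by linarith), hsol t ht,
        sdeIntegral_add hD hcl hu le_rfl ht (show t ≤ r + t by linarith)]
      abel
    rw [h2] at h1
    have h3 := tendsto_mesh_shift 0 r t
    rw [zero_add] at h3
    refine (h1.comp h3).congr fun p => Finset.sum_congr rfl fun i _ => ?_
    simp only [incr]
    rw [add_sub_add_right_eq_sub]
  -- So do the increments of `(S_t u_r) u_t`: left multiplication is applied to the Itô sums and is
  -- norm continuous.
  have hprod : ∀ r, 0 ≤ r → Tendsto (intervalSum (incr (fun r s => B.noise c (r + t) (s + t)) K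
      fun r => L r * u t)) (mesh 0 r) (𝓝 (L r * u t - u t)) := by
    intro r hr
    have hmesh := mesh_neBot hr
    have h1 := tendsto_sdeIntegral hD hcl hu le_rfl hr
    have hmem := sdeIntegral_mem hD hcl hu hr
    have hmemU := U_mul_mem_Icc t hmem
    rw [zero_add] at hmemU
    set J := sdeIntegral (B.noise c) K u 0 r with hJ
    have h2 : L r * u t - u t = B.leftMul (B.alg (Icc t (r + t))) (B.alg (Iic t)) (B.U t * J)
        * u t := by
      have e : B.U t * u r = B.e₀ + B.U t * J := by rw [hsol r hr, mul_add, U_mul_e₀]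
      rw [hL]
      simp only
      rw [e, (hp r).leftMul_add (e₀_mem_bimod _) hmemU, (hp r).leftMul_e₀, add_mul, hutP,
        add_sub_cancel_left]
    have hstep : ∀ δ (p : ℕ × (ℕ → ℝ)), IsSubdivision 0 r δ p → ∀ i ∈ Finset.range p.1,
        B.U t * incr (B.noise c) K u (p.2 i) (p.2 (i + 1))
          ∈ B.bimod (B.alg (Icc t (p.2 (i + 1) + t))) ∧
        B.U t * incr (B.noise c) K u (p.2 i) (p.2 (i + 1)) ∈ B.bimod (B.alg (Icc t (r + t))) := by
      intro δ p hp' i hi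
      have hi := Finset.mem_range.1 hi
      have h0 := (hp'.mem_Icc hi.le).1
      have hlt := (hp'.lt i hi).le
      have hm := hu.2 _ h0
      have h3 : incr (B.noise c) K u (p.2 i) (p.2 (i + 1))
          ∈ B.bimodSubmodule (B.alg (Icc 0 (p.2 (i + 1)))) := by
        rw [incr, ← Complex.coe_smul]
        exact add_mem (hcl.noise _ _ h0 hlt _ hm)
          (Submodule.smul_mem _ _ (hcl.drift _ (h0.trans hlt) _ (hcl.mono hlt hm)))
      have h4 := U_mul_mem_Icc t h3
      rw [zero_add] at h4
      exact ⟨h4, bimod_mono (alg_Icc_mono le_rfl (by linarith [(hp'.mem_Icc hi).2])) h4⟩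
    have hsum : ∀ δ (p : ℕ × (ℕ → ℝ)), IsSubdivision 0 r δ p →
        B.U t * intervalSum (incr (B.noise c) K u) p ∈ B.bimod (B.alg (Icc t (r + t))) ∧
        B.leftMul (B.alg (Icc t (r + t))) (B.alg (Iic t))
          (B.U t * intervalSum (incr (B.noise c) K u) p) * u t
        = intervalSum (incr (fun r s => B.noise c (r + t) (s + t)) K fun r => L r * u t) p := by
      intro δ p hp'
      have hst := fun i hi => (hstep δ p hp' i hi).2
      rw [intervalSum, Finset.mul_sum]
      refine ⟨(B.bimodSubmodule _).sum_mem hst, ?_⟩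
      rw [(hp r).leftMul_sum _ _ hst, Finset.sum_mul]
      refine Finset.sum_congr rfl fun i hi => ?_
      have hi' := Finset.mem_range.1 hi
      have h0 := (hp'.mem_Icc hi'.le).1
      rw [(hp r).leftMul_eq_of_le (alg_Icc_mono le_rfl (by linarith [(hp'.mem_Icc hi').2]))
        (B.A₀_le_alg _ ordConnected_Icc) (hstep δ p hp' i hi).1,
        hc.leftMul_incr hu hK h0 (hp'.lt i hi').le ht]
      simp only [incr, add_mul, mul_assoc, smul_mul_assoc]
      rfl
    rw [h2, tendsto_iff_norm_sub_tendsto_zero]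
    refine squeeze_zero' (g := fun p => ‖intervalSum (incr (B.noise c) K u) p - J‖ * ‖u t‖)
      (Eventually.of_forall fun p => norm_nonneg _) ?_ ?_
    · filter_upwards [eventually_mesh one_pos] with p hp'
      obtain ⟨h3, h4⟩ := hsum 1 p hp'
      rw [← h4, ← sub_mul, ← (hp r).leftMul_sub h3 hmemU, ← mul_sub]
      have h5 : B.U t * (intervalSum (incr (B.noise c) K u) p - J)
          ∈ B.bimod (B.alg (Icc t (r + t))) := by
        rw [mul_sub]
        exact (B.bimodSubmodule _).sub_mem h3 hmemU
      refine ((hp r).norm_leftMul_mul h5 _).trans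
        (mul_le_mul_of_nonneg_right ?_ (norm_nonneg _))
      refine ContinuousLinearMap.opNorm_le_bound _ (norm_nonneg _) fun ξ => ?_
      rw [mul_app, norm_U_apply]
      exact ContinuousLinearMap.le_opNorm _ _
    · have := (tendsto_iff_norm_sub_tendsto_zero.1 h1).mul_const ‖u t‖
      rwa [zero_mul] at this
  obtain ⟨M, hM⟩ := isCompact_Icc.exists_bound_of_continuousOn
    (hu.1.mono (fun r (hr : r ∈ Icc 0 (s + t)) => hr.1))
  have hfin : u (s + t) - L s * u t = 0 := by
    refine eq_zero_of_tendsto_incr (K := K) (hD.shift ht) (w := fun r => u (r + t) - L r * u t)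
      (T := s) (M₀ := M + M * M) (fun r hr ξ => ?_) (fun r hr => ?_) (fun r hr => ?_) s
      (right_mem_Icc.2 hs)
    · refine Submodule.sub_mem _ (hcl.range _ (add_nonneg hr.1 ht) _
        (hu.2 _ (add_nonneg hr.1 ht)) ξ) ?_
      exact (hp r).leftMul_apply_mem (alg_Icc_le_Iic _ _) (alg_Iic_mono (by linarith [hr.1]))
        (hU r hr.1) _
    · have h1 := hM (r + t) ⟨add_nonneg hr.1 ht, by linarith [hr.2]⟩
      have h2 := hM r ⟨hr.1, by linarith [hr.2]⟩
      have h3 := hM t ⟨ht, by linarith⟩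
      refine (norm_sub_le _ _).trans (add_le_add h1 ?_)
      refine ((hp r).norm_leftMul_mul (hU r hr.1) _).trans ?_
      have h4 : ‖B.U t * u r‖ ≤ ‖u r‖ := by
        refine ContinuousLinearMap.opNorm_le_bound _ (norm_nonneg _) fun ξ => ?_
        rw [mul_app, norm_U_apply]
        exact ContinuousLinearMap.le_opNorm _ _
      exact mul_le_mul (h4.trans h2) h3 (norm_nonneg _) ((norm_nonneg _).trans h2)
    · have h1 := (hshift r hr.1).sub (hprod r hr.1)
      rw [sub_sub_sub_cancel_right] at h1
      refine h1.congr fun p => ?_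
      rw [← intervalSum_sub]
      exact Finset.sum_congr rfl fun i _ => (incr_sub _ K _ _ _ _).symm
  rw [add_comm t s, (hp s).indepMul_eq (hU s hs) hutP]
  exact sub_eq_zero.1 hfin

end IsCentredAdditiveCocycle

end ContinuousBernoulliShift

/-! ### Completely positive maps on `A₀` -/

theorem hasDerivWithinAt_zero_of_norm_le {E : Type*} [NormedAddCommGroup E] [NormedSpace ℝ E]
    {f : ℝ → E} {C : ℝ} (h : ∀ t ∈ Icc (0 : ℝ) 1, ‖f t‖ ≤ C * (t * √t)) :
    HasDerivWithinAt f 0 (Ici 0) 0 := by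
  have h0 : f 0 = 0 := by simpa using h 0 (by simp)
  rw [hasDerivWithinAt_iff_isLittleO]
  simp only [h0, sub_zero, smul_zero]
  have h1 : f =O[𝓝[Ici 0] (0 : ℝ)] fun t => t * √t := by
    refine Asymptotics.IsBigO.of_bound C ?_
    filter_upwards [self_mem_nhdsWithin, nhdsWithin_le_nhds (Iic_mem_nhds one_pos)] with t ht ht1
    have ht : 0 ≤ t := ht
    rw [Real.norm_of_nonneg (by positivity)]
    exact h t ⟨ht, ht1⟩
  refine h1.trans_isLittleO ?_
  have h2 : (fun t : ℝ => √t) =o[𝓝[Ici 0] 0] fun _ => (1 : ℝ) := by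
    rw [Asymptotics.isLittleO_one_iff]
    have := Real.continuous_sqrt.tendsto 0
    rw [Real.sqrt_zero] at this
    exact this.mono_left nhdsWithin_le_nhds
  simpa using (Asymptotics.isBigO_refl (fun t : ℝ => t) (𝓝[Ici 0] 0)).mul_isLittleO h2

namespace ContinuousBernoulliShift

variable {H : Type*} [NormedAddCommGroup H] [InnerProductSpace ℂ H] [CompleteSpace H]
variable {B : ContinuousBernoulliShift H}

instance completeSpace_vonNeumannAlgebra (N : VonNeumannAlgebra H) :
    CompleteSpace N.toStarSubalgebra := by
  have h : IsClosed (N.toStarSubalgebra : Set (H →L[ℂ] H)) := by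
    have := Set.isClosed_centralizer (Set.centralizer (N : Set (H →L[ℂ] H)))
    rwa [VonNeumannAlgebra.centralizer_centralizer] at this
  exact h.completeSpace_coe

variable (B) in
/-- The isometric embedding `a ↦ a e₀` of `A₀` into the bounded operators. -/
def embed : B.A₀.toStarSubalgebra →L[ℂ] (H →L[ℂ] H) :=
  LinearMap.mkContinuous
    { toFun := fun a => (a : H →L[ℂ] H) * B.e₀
      map_add' := fun a b => add_mul (a : H →L[ℂ] H) b B.e₀
      map_smul' := fun r a => smul_mul_assoc r (a : H →L[ℂ] H) B.e₀ } 1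
    fun a => by rw [one_mul]; exact (norm_mul_e₀ a.2).le

theorem embed_apply (a : B.A₀.toStarSubalgebra) : B.embed a = (a : H →L[ℂ] H) * B.e₀ := rfl

theorem norm_embed (a : B.A₀.toStarSubalgebra) : ‖B.embed a‖ = ‖a‖ := norm_mul_e₀ a.2

theorem embed_injective {a b : B.A₀.toStarSubalgebra} (h : B.embed a = B.embed b) : a = b :=
  Subtype.ext (ext_A₀ a.2 b.2 h)

theorem isReduced_ip_mul {x : H →L[ℂ] H} (hx : x ∈ B.bimod B.A) (a : B.A₀.toStarSubalgebra) :
    B.IsReduced (star x * ((a : H →L[ℂ] H) * x)) :=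
  isReduced_ip hx (mul_mem_bimod (B.A₀_le a.2) hx)

theorem norm_star_mul_mul_le (x y : H →L[ℂ] H) (a : B.A₀.toStarSubalgebra) :
    ‖star x * ((a : H →L[ℂ] H) * y)‖ ≤ ‖x‖ * ‖y‖ * ‖a‖ := by
  have h1 := norm_mul_le (star x) ((a : H →L[ℂ] H) * y)
  have h2 := norm_mul_le (a : H →L[ℂ] H) y
  rw [norm_star] at h1
  refine h1.trans ((mul_le_mul_of_nonneg_left h2 (norm_nonneg _)).trans_eq ?_)
  change ‖x‖ * (‖a‖ * ‖y‖) = _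
  ring

open Classical in
variable (B) in
/-- The completely positive map `a ↦ ⟨x, a x⟩` on `A₀`, for `x` in the bimodule of `A` (zero for
other operators). -/
def compression (x : H →L[ℂ] H) : B.A₀.toStarSubalgebra →L[ℂ] B.A₀.toStarSubalgebra :=
  if hx : x ∈ B.bimod B.A then
    LinearMap.mkContinuous
      { toFun := fun a => ⟨B.lift (star x * ((a : H →L[ℂ] H) * x)), lift_mem _⟩
        map_add' := fun a b => embed_injective (by
          rw [map_add]
          simp only [embed_apply, (isReduced_ip_mul hx _).lift_mul_e₀]
          change star x * (((a : H →L[ℂ] H) + b) * x) = _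
          rw [add_mul, mul_add])
        map_smul' := fun r a => embed_injective (by
          rw [RingHom.id_apply, map_smul]
          simp only [embed_apply, (isReduced_ip_mul hx _).lift_mul_e₀]
          change star x * ((r • (a : H →L[ℂ] H)) * x) = _
          rw [smul_mul_assoc, mul_smul_comm]) }
      (‖x‖ * ‖x‖) fun a => by
        rw [← norm_embed]
        change ‖B.lift (star x * ((a : H →L[ℂ] H) * x)) * B.e₀‖ ≤ _
        rw [(isReduced_ip_mul hx a).lift_mul_e₀]
        exact norm_star_mul_mul_le x x a
  else 0

theorem embed_compression {x : H →L[ℂ] H} (hx : x ∈ B.bimod B.A) (a : B.A₀.toStarSubalgebra) :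
    B.embed (B.compression x a) = star x * ((a : H →L[ℂ] H) * x) := by
  unfold compression
  rw [dif_pos hx]
  exact (isReduced_ip_mul hx a).lift_mul_e₀

theorem coe_compression {x : H →L[ℂ] H} (hx : x ∈ B.bimod B.A) (a : B.A₀.toStarSubalgebra) :
    (B.compression x a : H →L[ℂ] H) = B.lift (star x * ((a : H →L[ℂ] H) * x)) := by
  unfold compression
  rw [dif_pos hx]
  rfl

theorem compression_eq {x : H →L[ℂ] H} (hx : x ∈ B.bimod B.A) {a b : B.A₀.toStarSubalgebra}
    (h : star x * ((a : H →L[ℂ] H) * x) = B.embed b) : B.compression x a = b :=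
  embed_injective (by rw [embed_compression hx, h])

theorem isCompletelyPositive_compression {x : H →L[ℂ] H} (hx : x ∈ B.bimod B.A) :
    IsCompletelyPositive (B.compression x) := by
  intro n M hM
  refine matrixPos_of_reduced (B := B) (fun i j => (B.compression x (M i j)).2) fun ξ hξ => ?_
  obtain ⟨r, hr, h⟩ := hM fun i => x (ξ i)
  refine ⟨r, hr, ?_⟩
  rw [← h]
  refine Finset.sum_congr rfl fun i _ => Finset.sum_congr rfl fun j _ => ?_
  have h1 := DFunLike.congr_fun (embed_compression hx (M i j)) (ξ j)
  rw [embed_apply, mul_app, hξ j, mul_app, mul_app] at h1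
  rw [h1, inner_star_right]

theorem norm_compression_sub_le {x y : H →L[ℂ] H} (hx : x ∈ B.bimod B.A) (hy : y ∈ B.bimod B.A) :
    ‖B.compression x - B.compression y‖ ≤ ‖x - y‖ * (‖x‖ + ‖y‖) := by
  refine ContinuousLinearMap.opNorm_le_bound _ (by positivity) fun a => ?_
  rw [← norm_embed, sub_apply, map_sub, embed_compression hx, embed_compression hy]
  have e : star x * ((a : H →L[ℂ] H) * x) - star y * ((a : H →L[ℂ] H) * y)
      = star (x - y) * ((a : H →L[ℂ] H) * x) + star y * ((a : H →L[ℂ] H) * (x - y)) := by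
    rw [star_sub, sub_mul, mul_sub, mul_sub]; abel
  rw [e]
  refine (norm_add_le _ _).trans ((add_le_add (norm_star_mul_mul_le _ _ _)
    (norm_star_mul_mul_le _ _ _)).trans_eq ?_)
  ring

theorem continuousOn_compression {u : ℝ → (H →L[ℂ] H)} {s : Set ℝ}
    (hu : ∀ t ∈ s, u t ∈ B.bimod B.A) (hc : ContinuousOn u s) :
    ContinuousOn (fun t => B.compression (u t)) s := by
  intro t ht
  rw [ContinuousWithinAt, tendsto_iff_norm_sub_tendsto_zero]
  have h1 : Tendsto (fun r => ‖u r - u t‖ * (‖u r‖ + ‖u t‖)) (𝓝[s] t) (𝓝 0) := by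
    have h2 := tendsto_iff_norm_sub_tendsto_zero.1 (hc t ht)
    have h3 := h2.mul ((hc t ht).norm.add_const ‖u t‖)
    rwa [zero_mul] at h3
  refine squeeze_zero' (Eventually.of_forall fun r => norm_nonneg _) ?_ h1
  filter_upwards [self_mem_nhdsWithin] with r hr
  exact norm_compression_sub_le (hu r hr) (hu t ht)

/-- The compression by a product of independent elements is the composition of the compressions, by
the inner product formula. -/
theorem compression_leftMul {N M : VonNeumannAlgebra H} (h : B.IsIndepPair N M) {x y : H →L[ℂ] H}
    (hx : x ∈ B.bimod N) (hy : y ∈ B.bimod B.A) (hyM : B.proj M * y = y)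
    (hxy : B.leftMul N M x * y ∈ B.bimod B.A) :
    B.compression (B.leftMul N M x * y) = B.compression y * B.compression x := by
  refine ContinuousLinearMap.ext fun a => compression_eq hxy ?_
  change _ = B.embed (B.compression y (B.compression x a))
  rw [embed_compression hy, coe_compression (bimod_mono h.le hx)]
  refine ContinuousLinearMap.ext fun η => ext_inner_left ℂ fun ξ => ?_
  have hya : ∀ ζ, B.proj M (y ζ) = y ζ := fun ζ => DFunLike.congr_fun hyM ζ
  rw [← mul_assoc (a : H →L[ℂ] H), ← h.leftMul_mul (h.le_left a.2) hx]
  simp only [mul_app]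
  rw [inner_star_right, inner_star_right, mul_app,
    h.inner_leftMul hx (mul_mem_bimod (h.le_left a.2) hx), hya, hya]

theorem compression_U_mul (t : ℝ) {x : H →L[ℂ] H} (hx : x ∈ B.bimod B.A)
    (hx' : B.U t * x ∈ B.bimod B.A) : B.compression (B.U t * x) = B.compression x := by
  refine ContinuousLinearMap.ext fun a => compression_eq hx' ?_
  rw [embed_compression hx, star_mul, ← mul_assoc (a : H →L[ℂ] H), ← U_comm a.2, mul_assoc,
    mul_assoc, ← mul_assoc (star (B.U t)), star_U_mul_U, one_mul]

theorem compression_e₀ : B.compression B.e₀ = 1 := by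
  refine ContinuousLinearMap.ext fun a => compression_eq (e₀_mem_bimod _) ?_
  rw [star_e₀, (isReduced_mul_e₀ a.2).left]
  rfl

/-! ### Expansion of the solution for small times -/

namespace IsCentredAdditiveCocycle

variable {c : ℝ → (H →L[ℂ] H)} (hc : B.IsCentredAdditiveCocycle c) {K : H →L[ℂ] H} (hK : K ∈ B.A₀)
  {u : ℝ → (H →L[ℂ] H)} (hu : IsProcess (fun t => B.bimodSubmodule (B.alg (Icc 0 t))) u)
  (hsol : ∀ t, 0 ≤ t → u t = B.e₀ + sdeIntegral (B.noise c) K u 0 t)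

include hc in
/-- The norm of a cocycle grows like that of Brownian motion. -/
theorem norm_apply {t : ℝ} (ht : 0 ≤ t) : ‖c t‖ = √t * ‖c 1‖ := by
  have h := hc.covariance (one_mem B.A₀) ht
  rw [one_mul, one_mul] at h
  have h2 : ‖c t‖ * ‖c t‖ = t * (‖c 1‖ * ‖c 1‖) := by
    rw [← CStarRing.norm_star_mul_self, h, norm_smul, CStarRing.norm_star_mul_self,
      Real.norm_of_nonneg ht]
  rw [← Real.sqrt_mul_self (norm_nonneg (c t)), h2, Real.sqrt_mul ht,
    Real.sqrt_mul_self (norm_nonneg _)]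

include hc hK

theorem sdeIntegral_e₀ {t : ℝ} (ht : 0 ≤ t) :
    sdeIntegral (B.noise c) K (fun _ => B.e₀) 0 t = c t + t • (K * B.e₀) := by
  have hmesh := mesh_neBot ht
  refine tendsto_nhds_unique (tendsto_sdeIntegral hc.orthogonalNoise (hc.adaptedClass hK)
    ⟨continuousOn_const, fun t _ => e₀_mem_bimod _⟩ le_rfl ht) (tendsto_const_nhds.congr' ?_)
  filter_upwards [eventually_mesh one_pos] with p hp
  have h1 : intervalSum (incr (B.noise c) K fun _ => B.e₀) p
      = ∑ i ∈ Finset.range p.1, ((c (p.2 (i + 1)) + p.2 (i + 1) • (K * B.e₀))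
        - (c (p.2 i) + p.2 i • (K * B.e₀))) := by
    refine Finset.sum_congr rfl fun i hi => ?_
    have hi := Finset.mem_range.1 hi
    rw [incr, hc.noise_mul_e₀ (hp.mem_Icc hi.le).1 (hp.lt i hi).le, sub_smul]
    abel
  rw [h1, Finset.sum_range_sub (fun i => c (p.2 i) + p.2 i • (K * B.e₀)), hp.left, hp.right,
    hc.zero]
  simp

include hu hsol

/-- The first order expansion of the solution: inserting `u - e₀ = O(t ^ (1 / 2))` into the integral
equation improves the error to `O(t)`. -/
theorem exists_norm_sub_le : ∃ C, 0 ≤ C ∧ ∀ t ∈ Icc (0 : ℝ) 1, ‖u t - B.e₀ - c t‖ ≤ C * t := by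
  have hD := hc.orthogonalNoise
  have hV := hc.adaptedClass hK
  obtain ⟨M, hM⟩ := isCompact_Icc.exists_bound_of_continuousOn
    (hu.1.mono (fun r (hr : r ∈ Icc (0 : ℝ) 1) => hr.1))
  have hM0 : 0 ≤ M := (norm_nonneg _).trans (hM 0 (by simp))
  set Q := B.lift (star (c 1) * c 1)
  set k : ℝ := √‖Q‖ + ‖K‖ with hk
  have hk0 : 0 ≤ k := by positivity
  have hbd : ∀ t ∈ Icc (0 : ℝ) 1, √(‖Q‖ * (t - 0)) + ‖K‖ * (t - 0) ≤ k * √t := by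
    intro t ht
    have h1 : t ≤ √t := Real.le_sqrt_of_sq_le (by nlinarith [ht.1, ht.2])
    rw [sub_zero, Real.sqrt_mul (norm_nonneg _), hk, add_mul]
    exact add_le_add_right (mul_le_mul_of_nonneg_left h1 (norm_nonneg _)) _
  have hconst : IsProcess (fun t => B.bimodSubmodule (B.alg (Icc 0 t))) fun _ => B.e₀ :=
    ⟨continuousOn_const, fun t _ => e₀_mem_bimod _⟩
  have h1 : ∀ t ∈ Icc (0 : ℝ) 1, ‖u t - B.e₀‖ ≤ M * k * √t := by
    intro t ht
    rw [hsol t ht.1, add_sub_cancel_left]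
    refine (norm_sdeIntegral_le hD hV hu le_rfl ht.1
      fun s hs => hM s ⟨hs.1, hs.2.trans ht.2⟩).trans ?_
    rw [mul_assoc]
    exact mul_le_mul_of_nonneg_left (hbd t ht) hM0
  refine ⟨M * k * k + ‖K * B.e₀‖, by positivity, fun t ht => ?_⟩
  have h2 := sdeIntegral_sub hD hV hu hconst le_rfl ht.1
  rw [hc.sdeIntegral_e₀ hK ht.1] at h2
  have h3 : u t - B.e₀ - c t
      = sdeIntegral (B.noise c) K (fun s => u s - B.e₀) 0 t + t • (K * B.e₀) := by
    rw [h2, hsol t ht.1]; abel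
  have h4 := norm_sdeIntegral_le hD hV (hu.sub hconst) le_rfl ht.1 (M := M * k * √t)
    fun s hs => (h1 s ⟨hs.1, hs.2.trans ht.2⟩).trans
      (mul_le_mul_of_nonneg_left (Real.sqrt_le_sqrt hs.2) (by positivity))
  rw [h3]
  refine (norm_add_le _ _).trans ?_
  rw [norm_smul, Real.norm_of_nonneg ht.1, add_mul, mul_comm t]
  refine add_le_add_left (h4.trans ?_) _
  refine (mul_le_mul_of_nonneg_left (hbd t ht) (by positivity)).trans_eq ?_
  rw [show M * k * √t * (k * √t) = M * k * k * (√t * √t) by ring, Real.mul_self_sqrt ht.1]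

end IsCentredAdditiveCocycle

end ContinuousBernoulliShift

/-! ### The semigroups -/

theorem hasDerivAt_smul_add_mul {R : Type*} [NormedRing R] [NormedAlgebra ℂ R] (T : R →L[ℂ] R)
    {f g : ℝ → R} {f' g' : R} {t : ℝ} (hf : HasDerivAt f f' t) (hg : HasDerivAt g g' t) :
    HasDerivAt (fun t => t • T + ContinuousLinearMap.mul ℂ R (f t)
        + (ContinuousLinearMap.mul ℂ R).flip (g t))
      (T + ContinuousLinearMap.mul ℂ R f' + (ContinuousLinearMap.mul ℂ R).flip g') t := by
  have h1 := (hasDerivAt_id t).smul_const T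
  rw [one_smul] at h1
  exact (h1.add (((ContinuousLinearMap.mul ℂ R).restrictScalars
    ℝ).hasFDerivAt.comp_hasDerivAt t hf)).add
    (((ContinuousLinearMap.mul ℂ R).flip.restrictScalars ℝ).hasFDerivAt.comp_hasDerivAt t hg)

/-- A family of operators on an algebra whose first order expansion at `0` has the remainder
`O(t ^ (3 / 2))`. -/
theorem hasDerivWithinAt_of_expansion {R : Type*} [NormedRing R] [NormedAlgebra ℂ R]
    {Φ : ℝ → R →L[ℂ] R} (T : R →L[ℂ] R) {f g : ℝ → R} {f' g' : R} {C : ℝ} (hC : 0 ≤ C)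
    (hf : HasDerivAt f f' 0) (hg : HasDerivAt g g' 0)
    (h : ∀ t ∈ Icc (0 : ℝ) 1, ∀ a,
      ‖Φ t a - a - (t • T a + f t * a + a * g t)‖ ≤ C * (t * √t) * ‖a‖) :
    HasDerivWithinAt Φ (T + ContinuousLinearMap.mul ℂ R f' + (ContinuousLinearMap.mul ℂ R).flip g')
      (Ici 0) 0 := by
  have hG := hasDerivAt_smul_add_mul T hf hg
  set G := fun t => t • T + ContinuousLinearMap.mul ℂ R (f t)
        + (ContinuousLinearMap.mul ℂ R).flip (g t) with hGdef
  have hrem : HasDerivWithinAt (fun t => Φ t - ContinuousLinearMap.id ℂ R - G t) 0 (Ici 0) 0 :=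
    hasDerivWithinAt_zero_of_norm_le (C := C) fun t ht =>
      ContinuousLinearMap.opNorm_le_bound _ (by have := ht.1; positivity) fun a => h t ht a
  have := (hrem.add_const (ContinuousLinearMap.id ℂ R)).add hG.hasDerivWithinAt
  rw [zero_add] at this
  have e : ∀ t, Φ t = Φ t - ContinuousLinearMap.id ℂ R - G t + ContinuousLinearMap.id ℂ R + G t :=
    fun t => by abel
  exact this.congr (fun t _ => e t) (e 0)

namespace ContinuousBernoulliShift

variable {H : Type*} [NormedAddCommGroup H] [InnerProductSpace ℂ H] [CompleteSpace H]
variable {B : ContinuousBernoulliShift H}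

namespace IsCentredAdditiveCocycle

variable {c : ℝ → (H →L[ℂ] H)} (hc : B.IsCentredAdditiveCocycle c) {K : B.A₀.toStarSubalgebra}
  {u : ℝ → (H →L[ℂ] H)} (hu : IsProcess (fun t => B.bimodSubmodule (B.alg (Icc 0 t))) u)
  (hsol : ∀ t, 0 ≤ t → u t = B.e₀ + sdeIntegral (B.noise c) K u 0 t)

include hu in
theorem mem_bimod {t : ℝ} (ht : 0 ≤ t) : u t ∈ B.bimod B.A :=
  bimod_mono (B.alg_le _ ordConnected_Icc) (hu.2 t ht)

include hc hu hsol

theorem solution_zero : u 0 = B.e₀ := by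
  have h := norm_sdeIntegral_le hc.orthogonalNoise (hc.adaptedClass K.2) hu le_rfl le_rfl
    (M := ‖u 0‖) fun s hs => by rw [le_antisymm hs.2 hs.1]
  rw [sub_zero, mul_zero, mul_zero, Real.sqrt_zero, add_zero, mul_zero] at h
  rw [hsol 0 le_rfl, norm_le_zero_iff.1 h, add_zero]

/-- The increments of the noise have vanishing conditional expectation. -/
theorem e₀_mul_solution {t : ℝ} (ht : 0 ≤ t) :
    B.e₀ * u t = B.e₀ + ∫ s in (0 : ℝ)..t, (K : H →L[ℂ] H) * (B.e₀ * u s) := by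
  have hmesh := mesh_neBot ht
  have h1 := (tendsto_sdeIntegral hc.orthogonalNoise (hc.adaptedClass K.2) hu le_rfl ht).const_mul
    B.e₀
  have h2 : ContinuousOn (fun s => (K : H →L[ℂ] H) * (B.e₀ * u s)) (Icc 0 t) :=
    continuousOn_const.mul (continuousOn_const.mul (hu.1.mono Icc_subset_Ici_self))
  rw [hsol t ht, mul_add, e₀_mul_e₀]
  congr 1
  refine tendsto_nhds_unique h1 ((tendsto_riemannSum ht h2).congr' ?_)
  filter_upwards [eventually_mesh one_pos] with p hp
  rw [intervalSum, intervalSum, Finset.mul_sum]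
  refine Finset.sum_congr rfl fun i hi => ?_
  have hi := Finset.mem_range.1 hi
  rw [incr, mul_add, ← mul_assoc B.e₀ (B.noise c _ _),
    hc.e₀_mul_noise (hp.mem_Icc hi.le).1 (hp.lt i hi).le, zero_mul, zero_add, mul_smul_comm,
    ← mul_assoc B.e₀, ← e₀_comm K.2, mul_assoc]

/-- Both sides solve the differential equation `y' = K y` with initial value `e₀`. -/
theorem embed_exp {t : ℝ} (ht : 0 ≤ t) : B.embed (NormedSpace.exp (t • K)) = B.e₀ * u t := by
  set κ : H →L[ℂ] H := (K : H →L[ℂ] H) with hκ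
  have hcont : Continuous fun s => κ * (B.e₀ * u (max s 0)) :=
    continuous_const.mul (continuous_const.mul
      (hu.1.comp_continuous (by fun_prop) fun s => mem_Ici.2 (le_max_right _ _)))
  set y : ℝ → (H →L[ℂ] H) := fun r => B.e₀ + ∫ s in (0 : ℝ)..r, κ * (B.e₀ * u (max s 0)) with hy
  have hyu : ∀ r, 0 ≤ r → y r = B.e₀ * u r := by
    intro r hr
    rw [hc.e₀_mul_solution hu hsol hr, hy]
    simp only
    congr 1
    refine intervalIntegral.integral_congr fun s hs => ?_
    rw [uIcc_of_le hr] at hs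
    simp only [max_eq_left hs.1]
    rfl
  have hyd : ∀ r, HasDerivAt y (κ * (B.e₀ * u (max r 0))) r := fun r =>
    (hcont.integral_hasStrictDerivAt 0 r).hasDerivAt.const_add _
  have hed : ∀ r : ℝ, HasDerivAt (fun r : ℝ => B.embed (NormedSpace.exp (r • K)))
      (κ * B.embed (NormedSpace.exp (r • K))) r := by
    intro r
    have h1 := hasDerivAt_exp_smul_const' (𝕂 := ℝ) K r
    have h2 := ((B.embed.restrictScalars ℝ).hasFDerivAt).comp_hasDerivAt r h1
    have h3 : (B.embed.restrictScalars ℝ) (K * NormedSpace.exp (r • K))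
        = κ * B.embed (NormedSpace.exp (r • K)) := by
      change (κ * _) * B.e₀ = κ * (_ * B.e₀)
      rw [mul_assoc]
    rw [h3] at h2
    exact h2
  have hL : ∀ _ : ℝ, LipschitzWith ‖κ‖₊ fun z : H →L[ℂ] H => κ * z := fun _ =>
    LipschitzWith.of_dist_le_mul fun z z' => by
      rw [dist_eq_norm, dist_eq_norm, ← mul_sub]
      exact norm_mul_le _ _
  have := ODE_solution_unique (a := 0) (b := t) hL
    (fun r _ => (hed r).continuousAt.continuousWithinAt) (fun r _ => (hed r).hasDerivWithinAt)
    (g := y) (fun r _ => (hyd r).continuousAt.continuousWithinAt)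
    (fun r hr => by
      have h := hyd r
      rw [max_eq_left hr.1, ← hyu r hr.1] at h
      exact h.hasDerivWithinAt) (by
      rw [hyu 0 le_rfl, hc.solution_zero hu hsol, zero_smul, NormedSpace.exp_zero, e₀_mul_e₀,
        embed_apply]
      exact one_mul _)
  exact (this (right_mem_Icc.2 ht)).trans (hyu t ht)

/-- The compressions by a solution form a semigroup, by the cocycle identity. -/
theorem compression_add {s t : ℝ} (hs : 0 ≤ s) (ht : 0 ≤ t) :
    B.compression (u (s + t)) = B.compression (u s) * B.compression (u t) := by
  have hp := isIndepPair_Icc_Iic (B := B) s (s + t)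
  have h1 := U_mul_mem_Icc s (hu.2 t ht)
  rw [zero_add, add_comm t s] at h1
  have hP : B.proj (B.alg (Iic s)) * u s = u s :=
    proj_mul_bimod (B.A₀_le_alg _ ordConnected_Iic) (bimod_mono (alg_Icc_le_Iic 0 s) (hu.2 s hs))
  have h2 := hc.cocycleIdentity K.2 hu hsol t s ht hs
  rw [hp.indepMul_eq h1 hP] at h2
  have h3 := mem_bimod hu (add_nonneg hs ht)
  rw [h2] at h3
  rw [h2, compression_leftMul hp h1 (mem_bimod hu hs) hP h3,
    compression_U_mul s (mem_bimod hu ht) (bimod_mono hp.le h1)]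

theorem isContSemigroup_compression : IsContSemigroup fun t => B.compression (u t) := by
  refine ⟨?_, fun s t hs ht => hc.compression_add hu hsol hs ht,
    continuousOn_compression (fun t ht => mem_bimod hu ht) hu.1⟩
  simp only
  rw [hc.solution_zero hu hsol, compression_e₀]

end IsCentredAdditiveCocycle

variable (B) in
/-- The operator `a ↦ Λ a + K⋆ a + a K`, where `Λ` is the covariance of a cocycle with value `x` at
time `1`. -/
def generator (x : H →L[ℂ] H) (K : B.A₀.toStarSubalgebra) :
    B.A₀.toStarSubalgebra →L[ℂ] B.A₀.toStarSubalgebra :=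
  B.compression x + ContinuousLinearMap.mul ℂ _ (star K) + (ContinuousLinearMap.mul ℂ _).flip K

theorem generator_apply (x : H →L[ℂ] H) (K a : B.A₀.toStarSubalgebra) :
    B.generator x K a = B.compression x a + star K * a + a * K := rfl

/-- The expansion of the compression of `e₀ + p + g` when `p` is centred. -/
theorem compression_expansion {p g : H →L[ℂ] H} (hp : B.e₀ * p = 0) (a : H →L[ℂ] H)
    (ha : a ∈ B.A₀) :
    star (B.e₀ + p + g) * (a * (B.e₀ + p + g)) - (a * B.e₀ + star p * (a * p) + a * (B.e₀ * g)
        + star (B.e₀ * g) * a)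
      = star p * (a * g) + star g * (a * p) + star g * (a * g) := by
  have h1 : B.e₀ * (a * p) = 0 := by rw [← mul_assoc, ← e₀_comm ha, mul_assoc, hp, mul_zero]
  have h2 : star p * (a * B.e₀) = 0 := by
    rw [e₀_comm ha, ← mul_assoc]
    have := congrArg star hp
    rw [star_mul, star_e₀, star_zero] at this
    rw [this, zero_mul]
  have h3 : B.e₀ * (a * g) = a * (B.e₀ * g) := by rw [← mul_assoc, ← e₀_comm ha, mul_assoc]
  have h4 : star g * (a * B.e₀) = star (B.e₀ * g) * a := by
    rw [e₀_comm ha, star_mul, star_e₀, mul_assoc]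
  have h5 : B.e₀ * (a * B.e₀) = a * B.e₀ := (isReduced_mul_e₀ ha).left
  simp only [star_add, star_e₀, mul_add, add_mul, h1, h2, h3, h4, h5]
  abel

namespace IsCentredAdditiveCocycle

variable {c : ℝ → (H →L[ℂ] H)} (hc : B.IsCentredAdditiveCocycle c) {K : B.A₀.toStarSubalgebra}
  {u : ℝ → (H →L[ℂ] H)} (hu : IsProcess (fun t => B.bimodSubmodule (B.alg (Icc 0 t))) u)
  (hsol : ∀ t, 0 ≤ t → u t = B.e₀ + sdeIntegral (B.noise c) K u 0 t)

include hc hu hsol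

/-- By `compression_expansion` for `u t = e₀ + c t + g` with `g = O(t)` and `e₀ g = (exp (t K) - 1)
e₀`, the remainder is of the order of `‖c t‖ ‖g‖ = O(t ^ (3 / 2))`. -/
theorem hasDerivWithinAt_compression :
    HasDerivWithinAt (fun t => B.compression (u t)) (B.generator (c 1) K) (Ici 0) 0 := by
  obtain ⟨C, hC0, hC⟩ := hc.exists_norm_sub_le K.2 hu hsol
  have h1A := bimod_mono (B.alg_le _ ordConnected_Icc) (hc.adapted 1 zero_le_one)
  set X : ℝ → B.A₀.toStarSubalgebra := fun t => NormedSpace.exp (t • K) - 1 with hX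
  have hXd : HasDerivAt X K 0 := by
    have := (hasDerivAt_exp_smul_const (𝕂 := ℝ) K 0).sub_const 1
    rwa [zero_smul, NormedSpace.exp_zero, one_mul] at this
  refine hasDerivWithinAt_of_expansion (B.compression (c 1)) (C := 2 * ‖c 1‖ * C + C * C)
    (by positivity) hXd.star hXd fun t ht a => ?_
  have huA := mem_bimod hu ht.1
  set p := c t with hp
  set g := u t - B.e₀ - p with hg
  have hup : u t = B.e₀ + p + g := by rw [hg]; abel
  have hp0 : B.e₀ * p = 0 := hc.centred t ht.1
  have hXg : B.embed (X t) = B.e₀ * g := by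
    rw [hX, map_sub, hc.embed_exp hu hsol ht.1, hg, mul_sub, mul_sub, hp0, e₀_mul_e₀, sub_zero,
      embed_apply]
    congr 1
  have e : B.embed (B.compression (u t) a - a
        - (t • B.compression (c 1) a + star (X t) * a + a * X t))
      = star p * ((a : H →L[ℂ] H) * g) + star g * ((a : H →L[ℂ] H) * p)
        + star g * ((a : H →L[ℂ] H) * g) := by
    rw [← compression_expansion hp0 a a.2, ← hup]
    have k2 : B.embed (t • B.compression (c 1) a) = star p * ((a : H →L[ℂ] H) * p) := by
      rw [hp, hc.covariance a.2 ht.1, ← embed_compression h1A]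
      exact (B.embed.restrictScalars ℝ).map_smul t _
    have k3 : B.embed (a * X t) = (a : H →L[ℂ] H) * (B.e₀ * g) := by
      rw [← hXg]
      exact mul_assoc _ _ _
    have k4 : B.embed (star (X t) * a) = star (B.e₀ * g) * a := by
      rw [← hXg, embed_apply, embed_apply, star_mul, star_e₀, ← e₀_comm (star_mem (X t).2),
        mul_assoc, ← e₀_comm a.2, ← mul_assoc]
      rfl
    rw [map_sub, map_sub, map_add, map_add, k2, k3, k4, embed_compression huA, embed_apply]
    abel
  have hgn : ‖g‖ ≤ C * t := hC t ht
  have hpn : ‖p‖ = √t * ‖c 1‖ := hc.norm_apply ht.1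
  rw [← norm_embed, e]
  refine (norm_add₃_le.trans (add_le_add (add_le_add (norm_star_mul_mul_le _ _ _)
    (norm_star_mul_mul_le _ _ _)) (norm_star_mul_mul_le _ _ _))).trans ?_
  rw [← add_mul, ← add_mul]
  refine mul_le_mul_of_nonneg_right ?_ (norm_nonneg _)
  have hs : √t * √t = t := Real.mul_self_sqrt ht.1
  have hs0 := Real.sqrt_nonneg t
  have hs1 : √t ≤ 1 := Real.sqrt_le_one.2 ht.2
  have hpg : ‖p‖ * ‖g‖ ≤ √t * ‖c 1‖ * (C * t) := by
    rw [hpn]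
    exact mul_le_mul_of_nonneg_left hgn (by positivity)
  have hgg : ‖g‖ * ‖g‖ ≤ C * C * (t * √t) := by
    have h1 : t * t ≤ t * √t := by
      refine mul_le_mul_of_nonneg_left ?_ ht.1
      nlinarith
    calc ‖g‖ * ‖g‖ ≤ (C * t) * (C * t) :=
          mul_le_mul hgn hgn (norm_nonneg _) ((norm_nonneg _).trans hgn)
      _ = C * C * (t * t) := by ring
      _ ≤ _ := mul_le_mul_of_nonneg_left h1 (by positivity)
  rw [mul_comm ‖g‖ ‖p‖]
  linarith

end IsCentredAdditiveCocycle

end ContinuousBernoulliShift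

/-! ### Fixed points of semigroups and unitality -/

/-- A norm continuous semigroup whose generator kills `x` fixes `x`. -/
theorem IsContSemigroup.apply_eq_of_generator_apply_eq_zero {E : Type*} [NormedAddCommGroup E]
    [NormedSpace ℂ E] {T : ℝ → E →L[ℂ] E} {L : E →L[ℂ] E} (hT : IsContSemigroup T)
    (hL : HasDerivWithinAt T L (Ici 0) 0) {x : E} (hx : L x = 0) {t : ℝ} (ht : 0 ≤ t) :
    T t x = x := by
  have happ : ∀ {f : ℝ → E →L[ℂ] E} {s : Set ℝ}, ContinuousOn f s →
      ContinuousOn (fun r => f r x) s :=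
    fun hf => (ContinuousLinearMap.apply ℂ E x).continuous.comp_continuousOn hf
  have h0 : HasDerivWithinAt (fun s => T s x) 0 (Ici 0) 0 := by
    have := (((ContinuousLinearMap.apply ℂ E x).restrictScalars
      ℝ).hasFDerivAt).comp_hasDerivWithinAt 0 hL
    have e : ((ContinuousLinearMap.apply ℂ E x).restrictScalars ℝ) L = 0 := hx
    rw [e] at this
    exact this
  have hder : ∀ r ∈ Ico 0 t, HasDerivWithinAt (fun s => T s x) 0 (Ici r) r := by
    intro r hr
    have h1 : HasDerivWithinAt (fun s => T (s - r) x) 0 (Ici r) r := by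
      have hid : HasDerivWithinAt (fun s => s - r) 1 (Ici r) r :=
        (hasDerivWithinAt_id r _).sub_const r
      have := h0.scomp_of_eq r hid (fun s hs => sub_nonneg.2 (mem_Ici.1 hs)) (sub_self r).symm
      rwa [smul_zero] at this
    have h3 := (((T r).restrictScalars ℝ).hasFDerivAt).comp_hasDerivWithinAt r h1
    rw [map_zero] at h3
    have e : ∀ s ∈ Ici r, T s x = T r (T (s - r) x) := by
      intro s hs
      have := hT.2.1 r (s - r) hr.1 (sub_nonneg.2 hs)
      rw [add_sub_cancel] at this
      rw [this]
      rfl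
    exact h3.congr e (e r self_mem_Ici)
  have := constant_of_has_deriv_right_zero (f := fun s => T s x)
    (happ (hT.2.2.mono Icc_subset_Ici_self)) hder t (right_mem_Icc.2 ht)
  rw [this, hT.1]
  rfl

theorem apply_generator_eq_zero {E : Type*} [NormedAddCommGroup E] [NormedSpace ℂ E]
    {T : ℝ → E →L[ℂ] E} {L : E →L[ℂ] E} (hL : HasDerivWithinAt T L (Ici 0) 0) {x : E}
    (h : ∀ t, 0 ≤ t → T t x = x) : L x = 0 := by
  have h1 : HasDerivWithinAt (fun s => T s x) (L x) (Ici 0) 0 :=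
    (((ContinuousLinearMap.apply ℂ E x).restrictScalars ℝ).hasFDerivAt).comp_hasDerivWithinAt 0 hL
  have h2 : HasDerivWithinAt (fun s => T s x) 0 (Ici 0) 0 :=
    (hasDerivWithinAt_const 0 (Ici 0) x).congr (fun t ht => h t ht) (h 0 le_rfl)
  exact (uniqueDiffOn_Ici (0 : ℝ) 0 self_mem_Ici).eq_deriv _ h1 h2

theorem isContSemigroup_exp {R : Type*} [NormedRing R] [NormedAlgebra ℂ R] [CompleteSpace R]
    (a : R) : IsContSemigroup fun t : ℝ => NormedSpace.exp (t • a) := by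
  refine ⟨by simp, fun s t _ _ => ?_, fun t _ =>
    (hasDerivAt_exp_smul_const (𝕂 := ℝ) a t).continuousAt.continuousWithinAt⟩
  let +nondep : NormedAlgebra ℚ R := NormedAlgebra.restrictScalars ℚ ℂ R
  simp only
  rw [add_smul]
  exact NormedSpace.exp_add_of_commute (((Commute.refl a).smul_left s).smul_right t)

namespace ContinuousBernoulliShift

variable {H : Type*} [NormedAddCommGroup H] [InnerProductSpace ℂ H] [CompleteSpace H]
variable {B : ContinuousBernoulliShift H}

theorem norm_e₀_le : ‖B.e₀‖ ≤ 1 := Submodule.starProjection_norm_le _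

/-- A unital compression is a contraction: its norm is at most `‖x‖² = ‖e₀‖`. -/
theorem norm_compression_le_one {x : H →L[ℂ] H} (hx : x ∈ B.bimod B.A) (h : ip x x = B.e₀) :
    ‖B.compression x‖ ≤ 1 := by
  refine ContinuousLinearMap.opNorm_le_bound _ zero_le_one fun a => ?_
  rw [← norm_embed, embed_compression hx]
  refine (norm_star_mul_mul_le x x a).trans (mul_le_mul_of_nonneg_right ?_ (norm_nonneg _))
  rw [← CStarRing.norm_star_mul_self]
  exact (congrArg norm h).trans_le norm_e₀_le

theorem ip_eq_e₀_iff {x : H →L[ℂ] H} (hx : x ∈ B.bimod B.A) :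
    ip x x = B.e₀ ↔ B.compression x 1 = 1 := by
  have h1 : B.embed (B.compression x 1) = ip x x :=
    (embed_compression hx 1).trans (congrArg (star x * ·) (one_mul x))
  have h2 : B.embed 1 = B.e₀ := one_mul B.e₀
  rw [← h1, ← h2]
  exact ⟨embed_injective, congrArg _⟩

/-- As `|c t|² = t |c 1|²`, the sum `|c t|² + t (K + K⋆)` is `t` times the value of the generator at
the unit. -/
theorem IsCentredAdditiveCocycle.generator_one_iff {c : ℝ → (H →L[ℂ] H)}
    (hc : B.IsCentredAdditiveCocycle c) (K : B.A₀.toStarSubalgebra) :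
    B.generator (c 1) K 1 = 0 ↔ ∀ t, 0 ≤ t →
      ip (c t) (c t) + t • (((K + star K : B.A₀.toStarSubalgebra) : H →L[ℂ] H) * B.e₀) = 0 := by
  have h1A := bimod_mono (B.alg_le _ ordConnected_Icc) (hc.adapted 1 zero_le_one)
  have hg : B.embed (B.generator (c 1) K 1)
      = ip (c 1) (c 1) + ((K + star K : B.A₀.toStarSubalgebra) : H →L[ℂ] H) * B.e₀ := by
    have h2 : B.embed (B.compression (c 1) 1) = ip (c 1) (c 1) :=
      (embed_compression h1A 1).trans (congrArg (star (c 1) * ·) (one_mul (c 1)))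
    rw [generator_apply, mul_one, one_mul, add_assoc, map_add, h2, add_comm (star K)]
    rfl
  have ht : ∀ t, 0 ≤ t →
      ip (c t) (c t) + t • (((K + star K : B.A₀.toStarSubalgebra) : H →L[ℂ] H) * B.e₀)
        = t • B.embed (B.generator (c 1) K 1) := by
    intro t ht
    have h3 := hc.covariance (one_mem B.A₀) ht
    rw [one_mul, one_mul] at h3
    rw [hg, smul_add, ip, h3, ip]
  constructor
  · intro h t ht0
    rw [ht t ht0, h, map_zero, smul_zero]
  · intro h
    have h4 := h 1 zero_le_one
    rw [ht 1 zero_le_one, one_smul] at h4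
    exact embed_injective (by rw [h4, map_zero])

end ContinuousBernoulliShift

end NCShift

end

open NCShift NCShift.ContinuousBernoulliShift in
theorem theorem8p1 {H : Type*} [NormedAddCommGroup H] [InnerProductSpace ℂ H] [CompleteSpace H]
    [TopologicalSpace.SeparableSpace H] (B : NCShift.ContinuousBernoulliShift H)
    (c : ℝ → (H →L[ℂ] H)) (hc : B.IsCentredAdditiveCocycle c) (K : B.A₀.toStarSubalgebra) :
    ∃ u : ℝ → (H →L[ℂ] H),
      -- existence and uniqueness of the solution
      B.IsSolution c K u ∧
      (∀ v, B.IsSolution c K v → ∀ t, 0 ≤ t → v t = u t) ∧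
      -- local adaptedness, norm continuity, cocycle identity
      B.IsLocallyAdapted u ∧ ContinuousOn u (Set.Ici 0) ∧ B.CocycleIdentity u ∧
      -- the compression of `u` by the conditional expectation
      (∃ A : ℝ → B.A₀.toStarSubalgebra,
        (∀ t, 0 ≤ t → (A t : H →L[ℂ] H) * B.e₀ = B.e₀ * u t) ∧
        NCShift.IsContSemigroup A ∧
        ∀ t, 0 ≤ t → A t = NormedSpace.exp (t • K)) ∧
      -- the compression `R` of `u`, with the covariance `Λ` of `c` and the generator `L`
      ∃ R : ℝ → (B.A₀.toStarSubalgebra →L[ℂ] B.A₀.toStarSubalgebra),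
      ∃ Λ L : B.A₀.toStarSubalgebra →L[ℂ] B.A₀.toStarSubalgebra,
        (∀ t, 0 ≤ t → ∀ a : B.A₀.toStarSubalgebra,
          (R t a : H →L[ℂ] H) * B.e₀ =
            NCShift.ContinuousBernoulliShift.ip (u t) ((a : H →L[ℂ] H) * u t)) ∧
        (∀ a : B.A₀.toStarSubalgebra,
          (Λ a : H →L[ℂ] H) * B.e₀ =
            NCShift.ContinuousBernoulliShift.ip (c 1) ((a : H →L[ℂ] H) * c 1)) ∧
        (∀ a, L a = Λ a + star K * a + a * K) ∧
        NCShift.IsContSemigroup R ∧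
        (∀ t, 0 ≤ t → NCShift.IsCompletelyPositive (R t)) ∧
        HasDerivWithinAt R L (Set.Ici 0) 0 ∧
        -- the characterization of unitality
        List.TFAE [
          B.IsUnitalCocycle u,
          ∀ t, 0 ≤ t → R t 1 = 1,
          L 1 = 0,
          ∀ t, 0 ≤ t → NCShift.ContinuousBernoulliShift.ip (c t) (c t) +
            t • (((K + star K : B.A₀.toStarSubalgebra) : H →L[ℂ] H) * B.e₀) = 0] ∧
        (B.IsUnitalCocycle u → ∀ t, 0 ≤ t → ‖R t‖ ≤ 1) := by
  obtain ⟨u, hu, hsol⟩ := NCShift.exists_sde_solution hc.orthogonalNoise (hc.adaptedClass K.2)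
    (e₀_mem_bimod (B.alg (Set.Icc 0 0)))
  have hS := hc.isSolution K.2 hu hsol
  have hcoc := hc.cocycleIdentity K.2 hu hsol
  have huA : ∀ t, 0 ≤ t → u t ∈ B.bimod B.A := fun t ht => IsCentredAdditiveCocycle.mem_bimod hu ht
  have h1A := bimod_mono (B.alg_le _ Set.ordConnected_Icc) (hc.adapted 1 zero_le_one)
  have hR := hc.isContSemigroup_compression hu hsol
  have hL := hc.hasDerivWithinAt_compression hu hsol
  refine ⟨u, hS, fun v hv t ht => hc.solution_unique hS hv ht, hu.2, hu.1, hcoc,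
    ⟨fun t => NormedSpace.exp (t • K), fun t ht => hc.embed_exp hu hsol ht, isContSemigroup_exp K,
      fun t _ => rfl⟩, fun t => B.compression (u t), B.compression (c 1), B.generator (c 1) K,
    fun t ht a => embed_compression (huA t ht) a, fun a => embed_compression h1A a,
    fun a => rfl, hR, fun t ht => isCompletelyPositive_compression (huA t ht), hL, ?_,
    fun h t ht => norm_compression_le_one (huA t ht) (h.unital t ht)⟩
  tfae_have 1 → 2 := fun h t ht => (ip_eq_e₀_iff (huA t ht)).1 (h.unital t ht)
  tfae_have 2 → 1 := fun h =>
    { cont := fun ξ η => continuousOn_const.inner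
        ((ContinuousLinearMap.apply ℂ H η).continuous.comp_continuousOn hu.1)
      unital := fun t ht => (ip_eq_e₀_iff (huA t ht)).2 (h t ht)
      adapted := hu.2
      cocycle := hcoc }
  tfae_have 2 → 3 := fun h => apply_generator_eq_zero hL h
  tfae_have 3 → 2 := fun h t ht => hR.apply_eq_of_generator_apply_eq_zero hL h ht
  tfae_have 3 ↔ 4 := hc.generator_one_iff K
  tfae_finish
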